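/- **Setting.** Let $N$ be a connected nilpotent Lie group of dimension $n$ with Lie algebra $\mathfrak n$, let $\langle\cdot,\cdot\rangle$ be a nondegenerate symmetric bilinear form on $\mathfrak n$, and let $ds^2$ be the left-invariant pseudo-Riemannian metric on $N$ that it defines. Let $H$ be a group of smooth automorphisms of $N$ preserving $ds^2$, with Lie algebra $\mathfrak h$ acting on $\mathfrak n$ by derivations, and let $G=N\rtimes H$ act on $M=G/H=N$ ($N$ by left translations, $H$ by automorphisms). We say that $(M=G/H,ds^2)$ is a connected *$G$-geodesic orbit ($GO$) nilmanifold* if every geodesic of $(M,ds^2)$ is, up to parametrisation, an orbit of a one-parameter subgroup of $G$ (a geodesic defined on an arbitrary open interval being contained in such an orbit). It is Riemannian, Lorentz, or trans-Lorentz if $\langle\cdot,\cdot\rangle$ has signature $(n,0)$, $(n-1,1)$, or $(n-2,2)$ respectively. Given such an $M$, we say that $(\mathfrak n,\langle\cdot,\cdot\rangle)$ is a *$2m_0$-dimensional double extension* of a metric Lie algebra $(\mathfrak m_0,\langle\cdot,\cdot\rangle_0)$ if there are subspaces $\mathfrak e\subset[\mathfrak n,\mathfrak n]\subset\mathfrak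 m_1$ of $\mathfrak n$, both $\mathrm{ad}(\mathfrak h)$-invariant, such that $\dim\mathfrak e=m_0$, $\langle\mathfrak e,\mathfrak m_1\rangle=0$, $[\mathfrak e,\mathfrak m_1]=0$, $\dim\mathfrak m_1+\dim\mathfrak e=\dim\mathfrak n$, and $(\mathfrak m_0,\langle\cdot,\cdot\rangle_0)$ is isomorphic, as a Lie algebra with an inner product, to $\mathfrak m_1/\mathfrak e$ with the inner product induced from $\mathfrak m_1$. **Theorem.** Let $(M=G/H,ds^2)$, $G=N\rtimes H$, be a connected trans-Lorentz $G$-geodesic orbit nilmanifold with $N$ nilpotent, and let $\langle\cdot,\cdot\rangle$ be the inner product on $\mathfrak n$ induced by $ds^2$. If the restriction of $\langle\cdot,\cdot\rangle$ to $[\mathfrak n,\mathfrak n]$ is degenerate, then $(\mathfrak n,\langle\cdot,\cdot\rangle)$ is either a $2$-dimensional double extension of the metric Lie algebra of a connected Lorentz $G_0$-geodesic orbit nilmanifold $G_0/H_0$, $G_0=N_0\rtimes H_0$, or a $4$-dimensional double extension of the metric Lie algebra of a connected Riemannian $G_0$-geodesic orbit nilmanifold $G_0/H_0$, $G_0=N_0\rtimes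 H_0$. -/

import Mathlib

open scoped Manifold ContDiff

noncomputable section

/-! ### Smoothness bookkeeping -/

/-- The Lie algebra structure on the tangent space at the identity asks for smoothness
`minSmoothness ℝ 3`, which is just `3`. -/
instance lieGroup_minSmoothness_three {n : ℕ} {N : Type*} [TopologicalSpace N]
    [ChartedSpace (EuclideanSpace ℝ (Fin n)) N] [Group N]
    [LieGroup 𝓘(ℝ, EuclideanSpace ℝ (Fin n)) ∞ N] :
    LieGroup 𝓘(ℝ, EuclideanSpace ℝ (Fin n)) (minSmoothness ℝ 3) N := by
  rw [minSmoothness_of_isRCLikeNormedField]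
  infer_instance

/-! ### Signature of a scalar product -/

/-- `B` is a scalar product (symmetric nondegenerate bilinear form) of signature `(p, q)`. -/
structure HasSignature {V : Type*} [AddCommGroup V] [Module ℝ V]
    (B : LinearMap.BilinForm ℝ V) (p q : ℕ) : Prop where
  isSymm : B.IsSymm
  nondegenerate : B.Nondegenerate
  sigPos_eq : sigPos B.toQuadraticMap = p
  sigNeg_eq : sigNeg B.toQuadraticMap = q

/-! ### Geodesics of a pseudo-Riemannian metric, in charts -/

section Geodesic

variable {n : ℕ} {M : Type*} [TopologicalSpace M] [ChartedSpace (EuclideanSpace ℝ (Fin n)) M]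

/-- The metric `g` read in the preferred chart at `x₀`: at the point `y` of the model space it is
the bilinear form `(u, w) ↦ ∑ i j, g_{ij}(y) u_i w_j`. -/
def metricInChart
    (g : (x : M) → TangentSpace 𝓘(ℝ, EuclideanSpace ℝ (Fin n)) x →
      TangentSpace 𝓘(ℝ, EuclideanSpace ℝ (Fin n)) x → ℝ)
    (x₀ : M) (y u w : EuclideanSpace ℝ (Fin n)) : ℝ :=
  g ((extChartAt 𝓘(ℝ, EuclideanSpace ℝ (Fin n)) x₀).symm y)
    (mfderiv 𝓘(ℝ, EuclideanSpace ℝ (Fin n)) 𝓘(ℝ, EuclideanSpace ℝ (Fin n))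
      (extChartAt 𝓘(ℝ, EuclideanSpace ℝ (Fin n)) x₀).symm y u)
    (mfderiv 𝓘(ℝ, EuclideanSpace ℝ (Fin n)) 𝓘(ℝ, EuclideanSpace ℝ (Fin n))
      (extChartAt 𝓘(ℝ, EuclideanSpace ℝ (Fin n)) x₀).symm y w)

/-- `γ` is a geodesic of `g` on the open set `J` of parameters: it is of class `C²` there and, for
every `t₀ ∈ J`, the geodesic equation (with the free index lowered by the metric)
`∑ g_{lk} c̈_l + ∑ ∂_i g_{jk} ċ_i ċ_j - (1/2) ∑ ∂_k g_{ij} ċ_i ċ_j = 0`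
holds at `t₀` for the local expression `c` of `γ` in the chart at `γ t₀`; here the equation is
contracted with an arbitrary vector `w`. -/
def IsGeodesicOn
    (g : (x : M) → TangentSpace 𝓘(ℝ, EuclideanSpace ℝ (Fin n)) x →
      TangentSpace 𝓘(ℝ, EuclideanSpace ℝ (Fin n)) x → ℝ)
    (γ : ℝ → M) (J : Set ℝ) : Prop :=
  ContMDiffOn 𝓘(ℝ, ℝ) 𝓘(ℝ, EuclideanSpace ℝ (Fin n)) 2 γ J ∧
  ∀ t₀ ∈ J,
    let c : ℝ → EuclideanSpace ℝ (Fin n) :=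
      fun t => extChartAt 𝓘(ℝ, EuclideanSpace ℝ (Fin n)) (γ t₀) (γ t)
    let G := metricInChart g (γ t₀)
    ∀ w : EuclideanSpace ℝ (Fin n),
      G (c t₀) (deriv (deriv c) t₀) w
        + fderiv ℝ (fun y => G y (deriv c t₀) w) (c t₀) (deriv c t₀)
        - (1 / 2 : ℝ) * fderiv ℝ (fun y => G y (deriv c t₀) (deriv c t₀)) (c t₀) w = 0

end Geodesic

/-! ### Geodesic orbit nilmanifolds -/

section Nilmanifold

variable {n : ℕ} {N : Type*} [TopologicalSpace N] [ChartedSpace (EuclideanSpace ℝ (Fin n)) N]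
  [Group N]

/-- The left-invariant metric on `N` defined by the form `B` on the tangent space at `1`:
`⟨u, v⟩_x = B (d(L_{x⁻¹}) u, d(L_{x⁻¹}) v)`. -/
def leftInvMetric
    (B : LinearMap.BilinForm ℝ (GroupLieAlgebra 𝓘(ℝ, EuclideanSpace ℝ (Fin n)) N))
    (x : N) (u v : TangentSpace 𝓘(ℝ, EuclideanSpace ℝ (Fin n)) x) : ℝ :=
  B (mfderiv 𝓘(ℝ, EuclideanSpace ℝ (Fin n)) 𝓘(ℝ, EuclideanSpace ℝ (Fin n))
      (fun y : N => x⁻¹ * y) x u)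
    (mfderiv 𝓘(ℝ, EuclideanSpace ℝ (Fin n)) 𝓘(ℝ, EuclideanSpace ℝ (Fin n))
      (fun y : N => x⁻¹ * y) x v)

/-- The action of `G = N ⋊ H` on `G / H = N`: `N` acts by left translations and `H`, a group of
automorphisms of `N`, acts naturally. -/
def semidirectAct {H : Subgroup (MulAut N)} (g : N ⋊[H.subtype] H) (x : N) : N :=
  g.left * (g.right : MulAut N) x

/-- A one-parameter subgroup of `G = N ⋊ H`: a homomorphism `ℝ → G` such that the
resulting action of `ℝ` on `N` is smooth. -/
def IsOneParameterSubgroup (n : ℕ) {N : Type*} [TopologicalSpace N]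
    [ChartedSpace (EuclideanSpace ℝ (Fin n)) N] [Group N] {H : Subgroup (MulAut N)}
    (φ : Multiplicative ℝ →* N ⋊[H.subtype] H) : Prop :=
  ContMDiff (𝓘(ℝ, ℝ).prod 𝓘(ℝ, EuclideanSpace ℝ (Fin n))) 𝓘(ℝ, EuclideanSpace ℝ (Fin n)) ∞
    (fun p : ℝ × N => semidirectAct (φ (Multiplicative.ofAdd p.1)) p.2)

/-- Every geodesic of the left-invariant metric defined by `B` is (up to parametrisation) an orbit
of a one-parameter subgroup of `G = N ⋊ H`. -/
def IsGeodesicOrbit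
    (B : LinearMap.BilinForm ℝ (GroupLieAlgebra 𝓘(ℝ, EuclideanSpace ℝ (Fin n)) N))
    (H : Subgroup (MulAut N)) : Prop :=
  ∀ (J : Set ℝ) (γ : ℝ → N), IsOpen J → J.OrdConnected → IsGeodesicOn (leftInvMetric B) γ J →
    ∃ φ : Multiplicative ℝ →* N ⋊[H.subtype] H, IsOneParameterSubgroup n φ ∧
      ∃ (x : N) (s : ℝ → ℝ), ContDiffOn ℝ ∞ s J ∧
        ∀ t ∈ J, γ t = semidirectAct (φ (Multiplicative.ofAdd (s t))) x

/-- `(G / H, ds²)` with `G = N ⋊ H` is a connected pseudo-Riemannian `G`-geodesic orbit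
nilmanifold: `N` is a connected nilpotent Lie group, the metric is the left-invariant one
defined by the scalar product `B` on the Lie algebra of `N`, and `H` consists of smooth
automorphisms of `N` that preserve the metric. -/
structure IsGONilmanifold [LieGroup 𝓘(ℝ, EuclideanSpace ℝ (Fin n)) ∞ N]
    (B : LinearMap.BilinForm ℝ (GroupLieAlgebra 𝓘(ℝ, EuclideanSpace ℝ (Fin n)) N))
    (H : Subgroup (MulAut N)) : Prop where
  connected : ConnectedSpace N
  nilpotent : Group.IsNilpotent N
  symm : B.IsSymm
  nondegenerate : B.Nondegenerate
  smooth : ∀ a ∈ H,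
    ContMDiff 𝓘(ℝ, EuclideanSpace ℝ (Fin n)) 𝓘(ℝ, EuclideanSpace ℝ (Fin n)) ∞ (a : N → N)
  isometric : ∀ a ∈ H, ∀ u v : GroupLieAlgebra 𝓘(ℝ, EuclideanSpace ℝ (Fin n)) N,
    B (mfderiv 𝓘(ℝ, EuclideanSpace ℝ (Fin n)) 𝓘(ℝ, EuclideanSpace ℝ (Fin n)) (a : N → N) 1 u)
      (mfderiv 𝓘(ℝ, EuclideanSpace ℝ (Fin n)) 𝓘(ℝ, EuclideanSpace ℝ (Fin n)) (a : N → N) 1 v)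
      = B u v
  geodesicOrbit : IsGeodesicOrbit B H

/-- The action `ad_𝔤(𝔥)` on `𝔫` of the Lie algebra `𝔥` of `H`: all the operators
`D = d/dt|_{t = 0} d(a t)_1`, where `a` is a one-parameter subgroup of `H`. -/
def isotropyAlgebra (n : ℕ) {N : Type*} [TopologicalSpace N]
    [ChartedSpace (EuclideanSpace ℝ (Fin n)) N] [Group N] (H : Subgroup (MulAut N)) :
    Set (GroupLieAlgebra 𝓘(ℝ, EuclideanSpace ℝ (Fin n)) N →ₗ[ℝ]
      GroupLieAlgebra 𝓘(ℝ, EuclideanSpace ℝ (Fin n)) N) :=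
  {D | ∃ a : Multiplicative ℝ →* H,
    ContMDiff (𝓘(ℝ, ℝ).prod 𝓘(ℝ, EuclideanSpace ℝ (Fin n))) 𝓘(ℝ, EuclideanSpace ℝ (Fin n)) ∞
      (fun p : ℝ × N => (a (Multiplicative.ofAdd p.1) : MulAut N) p.2) ∧
    ∀ v : EuclideanSpace ℝ (Fin n),
      HasDerivAt (F := EuclideanSpace ℝ (Fin n))
        (fun t : ℝ => mfderiv 𝓘(ℝ, EuclideanSpace ℝ (Fin n)) 𝓘(ℝ, EuclideanSpace ℝ (Fin n))
          (fun y : N => (a (Multiplicative.ofAdd t) : MulAut N) y) 1 v) (D v) 0}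

end Nilmanifold

/-! ### Double extensions -/

/-- The derived algebra `[L, L]`, as a subspace. -/
def derivedSubspace (L : Type*) [LieRing L] [LieAlgebra ℝ L] : Submodule ℝ L :=
  (⁅(⊤ : LieIdeal ℝ L), (⊤ : LieIdeal ℝ L)⁆ : LieIdeal ℝ L).toSubmodule

/-- The metric Lie algebra `(L, B)`, with a set `𝔥` of operators acting on it, is a
`d`-dimensional double extension of the metric Lie algebra `(L₀, B₀)`: there are subspaces
`e ⊆ [L, L] ⊆ m₁` (so `m₁` is an ideal) of `L`, both invariant under `𝔥`, such that
`⟨e, m₁⟩ = 0`, `[e, m₁] = 0`, `dim m₁ + dim e = dim L`, `d = 2 dim e`, and `(L₀, B₀)` is the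
quotient Lie algebra `m₁ / e` with the scalar product induced from `m₁`. The quotient is given by
its projection `π : m₁ → L₀`, a surjective Lie algebra homomorphism with kernel `e`. -/
def IsDoubleExtension {L : Type*} [LieRing L] [LieAlgebra ℝ L] (𝔥 : Set (L →ₗ[ℝ] L))
    (B : LinearMap.BilinForm ℝ L) (d : ℕ)
    {L₀ : Type*} [LieRing L₀] [LieAlgebra ℝ L₀] (B₀ : LinearMap.BilinForm ℝ L₀) : Prop :=
  ∃ (m₁ : LieIdeal ℝ L) (e : Submodule ℝ L) (π : m₁ →ₗ⁅ℝ⁆ L₀),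
    e ≤ derivedSubspace L ∧ derivedSubspace L ≤ m₁.toSubmodule ∧
    (∀ A ∈ 𝔥, ∀ x ∈ m₁, A x ∈ m₁) ∧ (∀ A ∈ 𝔥, ∀ x ∈ e, A x ∈ e) ∧
    (∀ x ∈ e, ∀ y ∈ m₁, B x y = 0) ∧ (∀ x ∈ e, ∀ y ∈ m₁, ⁅x, y⁆ = 0) ∧
    Module.finrank ℝ m₁ + Module.finrank ℝ e = Module.finrank ℝ L ∧
    d = 2 * Module.finrank ℝ e ∧
    Function.Surjective π ∧ (∀ x : m₁, π x = 0 ↔ (x : L) ∈ e) ∧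
    (∀ x y : m₁, B₀ (π x) (π y) = B x y)

end

/-! The hypothesis on geodesics is equivalent to algebra. Translated to the identity, the velocity V
of a geodesic satisfies Euler's equation ⟨V', w⟩ = ⟨V, [V, w]⟩. Inserting an orbit of a
one-parameter subgroup shows that every T admits a skew derivation D and a real k with ⟨T, [T, w]⟩ =
⟨D T, w⟩ + k ⟨T, w⟩ for all w (`isAlgebraicGO_of_isGONilmanifold`). If W is invariant under all skew
derivations, T ⊥ W and w ∈ W, the right side vanishes whatever D and k are. So elements of W act
skew-symmetrically on Wᗮ (`IsAlgebraicGO.lie_skew_apply`), and they act nilpotently.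

Let r be the radical of the form on the derived algebra. It is nonzero and isotropic, so of
dimension 1 or 2; let e be its intersection with the last term of the lower central series that it
meets. The heart of the proof is [e, eᗮ] = 0 (`exists_isotropic_of_degenerate`). A nilpotent
operator that preserves Rᗮ for a maximal isotropic plane R, and is skew there, maps Rᗮ into R; this
governs the case dim r = 2. If r = ℝu and ad u ≠ 0 on uᗮ, there is a chain w₃ ↦ w₂ ↦ w₁ ↦ 0 under ad
u. Every skew derivation has the same eigenvalue on w₁ as on u; this forces w₁ to be central, and
then to lie in r, which is absurd (`false_of_ad_sq_ne_zero`).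

With m₁ = eᗮ, the quotient eᗮ / e inherits the algebraic condition, and its form has index 2 - dim
e: Lorentz or Riemannian. To come back to groups one needs k = 0, which in index at most one follows
from a trace argument (`IsAlgebraicGO.exists_skewDerivation`, `lie_eq_zero_of_boost`). The quotient
is integrated to a group by the Campbell-Hausdorff product on its own vector space, and there every
geodesic is an explicit orbit (`isGONilmanifold_grp`). -/

open scoped Manifold ContDiff

noncomputable section

open Set Filter Topology VectorField

/-! ### The Maurer-Cartan form in charts. -/

section LocalCoordinates

variable {E : Type*} [NormedAddCommGroup E] [NormedSpace ℝ E]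
  {N : Type*} [TopologicalSpace N] [ChartedSpace E N]

lemma mfderiv_eq_fderiv_extChartAt_comp {f : E → N} {y : E} {x : N}
    (hf : MDifferentiableAt 𝓘(ℝ, E) 𝓘(ℝ, E) f y) (hx : f y = x) :
    (mfderiv 𝓘(ℝ, E) 𝓘(ℝ, E) f y : E → E) =
      fderiv ℝ (fun z => extChartAt 𝓘(ℝ, E) x (f z)) y := by
  subst hx
  rw [hf.mfderiv]
  simp only [writtenInExtChartAt, mfld_simps, fderivWithin_univ]
  rfl

lemma mfderiv_eq_fderiv_writtenInExtChartAt {f : N → N} {x x' : N}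
    (hf : MDifferentiableAt 𝓘(ℝ, E) 𝓘(ℝ, E) f x) (hx : f x = x') :
    (mfderiv 𝓘(ℝ, E) 𝓘(ℝ, E) f x : E → E) =
      fderiv ℝ (fun z => extChartAt 𝓘(ℝ, E) x' (f ((extChartAt 𝓘(ℝ, E) x).symm z)))
        (extChartAt 𝓘(ℝ, E) x x) := by
  subst hx
  rw [hf.mfderiv]
  simp only [writtenInExtChartAt, mfld_simps, fderivWithin_univ]
  rfl

variable [Group N]

variable (E) in
/-- The derivative of the left translation by `x` at `z`, between the model spaces. -/
def leftMulDeriv (x z : N) : E →L[ℝ] E :=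
  mfderiv 𝓘(ℝ, E) 𝓘(ℝ, E) (fun y : N => x * y) z

lemma leftMulDeriv_one (z : N) : leftMulDeriv E 1 z = ContinuousLinearMap.id ℝ E := by
  have h : (fun y : N => 1 * y) = id := by ext; simp
  rw [leftMulDeriv, h]
  exact mfderiv_id

variable [LieGroup 𝓘(ℝ, E) ∞ N]

lemma contMDiffAt_extChartAt_symm_of_mem {x₀ : N} {y : E}
    (hy : y ∈ (extChartAt 𝓘(ℝ, E) x₀).target) :
    ContMDiffAt 𝓘(ℝ, E) 𝓘(ℝ, E) ∞ (extChartAt 𝓘(ℝ, E) x₀).symm y :=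
  (contMDiffOn_extChartAt_symm x₀).contMDiffAt
    ((isOpen_extChartAt_target x₀).mem_nhds hy)

/-- The left-invariant Maurer-Cartan form of `N` read in the chart at `x₀`. -/
def mcForm (x₀ : N) (y : E) : E →L[ℝ] E :=
  (leftMulDeriv E ((extChartAt 𝓘(ℝ, E) x₀).symm y)⁻¹ ((extChartAt 𝓘(ℝ, E) x₀).symm y)).comp
    (show E →L[ℝ] E from mfderiv 𝓘(ℝ, E) 𝓘(ℝ, E) (extChartAt 𝓘(ℝ, E) x₀).symm y)

/-- The quotient `(a, b) ↦ a⁻¹ b` read in the chart at `x₀`, with values in the chart at `1`. -/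
def leftQuotient (x₀ : N) (p : E × E) : E :=
  extChartAt 𝓘(ℝ, E) (1 : N)
    (((extChartAt 𝓘(ℝ, E) x₀).symm p.1)⁻¹ * (extChartAt 𝓘(ℝ, E) x₀).symm p.2)

lemma contDiffAt_leftQuotient {x₀ : N} {y : E} (hy : y ∈ (extChartAt 𝓘(ℝ, E) x₀).target) :
    ContDiffAt ℝ ∞ (leftQuotient x₀) (y, y) := by
  rw [← contMDiffAt_iff_contDiffAt]
  have h1 : ContMDiffAt 𝓘(ℝ, E × E) 𝓘(ℝ, E) ∞
      (fun p : E × E => (extChartAt 𝓘(ℝ, E) x₀).symm p.1) (y, y) :=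
    ContMDiffAt.comp (I' := 𝓘(ℝ, E)) (y, y) (contMDiffAt_extChartAt_symm_of_mem hy)
      contDiffAt_fst.contMDiffAt
  have h2 : ContMDiffAt 𝓘(ℝ, E × E) 𝓘(ℝ, E) ∞
      (fun p : E × E => (extChartAt 𝓘(ℝ, E) x₀).symm p.2) (y, y) :=
    ContMDiffAt.comp (I' := 𝓘(ℝ, E)) (y, y) (contMDiffAt_extChartAt_symm_of_mem hy)
      contDiffAt_snd.contMDiffAt
  have h3 := h1.inv.mul h2
  refine ContMDiffAt.comp (I' := 𝓘(ℝ, E)) (y, y) ?_ h3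
  simp only [inv_mul_cancel]
  exact contMDiffAt_extChartAt

/-- Writing the form as a partial derivative of one smooth map of two variables is what gives its
smoothness in the base point. -/
lemma mcForm_eq_fderiv {x₀ : N} {y : E} (hy : y ∈ (extChartAt 𝓘(ℝ, E) x₀).target) :
    mcForm x₀ y = fderiv ℝ (fun z => leftQuotient x₀ (y, z)) y := by
  have h1 : MDifferentiableAt 𝓘(ℝ, E) 𝓘(ℝ, E) (extChartAt 𝓘(ℝ, E) x₀).symm y :=
    (contMDiffAt_extChartAt_symm_of_mem hy).mdifferentiableAt (by simp)
  have h2 : MDifferentiableAt 𝓘(ℝ, E) 𝓘(ℝ, E)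
      (fun z : N => ((extChartAt 𝓘(ℝ, E) x₀).symm y)⁻¹ * z) ((extChartAt 𝓘(ℝ, E) x₀).symm y) :=
    (contMDiff_mul_left (I := 𝓘(ℝ, E)) (n := ∞)).mdifferentiable (by simp) _
  have h3 := mfderiv_comp y h2 h1
  have h4 := mfderiv_eq_fderiv_extChartAt_comp (x := (1 : N)) (h2.comp y h1) (by simp)
  ext w
  have := congrFun h4 w
  rw [h3] at this
  exact this

lemma contDiffAt_mcForm {x₀ : N} {y : E} (hy : y ∈ (extChartAt 𝓘(ℝ, E) x₀).target) :
    ContDiffAt ℝ ∞ (mcForm x₀) y := by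
  have h : mcForm x₀ =ᶠ[𝓝 y] fun y => fderiv ℝ (fun z => leftQuotient x₀ (y, z)) y := by
    filter_upwards [(isOpen_extChartAt_target x₀).mem_nhds hy] with y' hy'
    exact mcForm_eq_fderiv hy'
  refine ContDiffAt.congr_of_eventuallyEq ?_ h
  exact ContDiffAt.fderiv (n := ∞) (f := fun y z => leftQuotient x₀ (y, z)) (g := id)
    (contDiffAt_leftQuotient hy) contDiffAt_id (by simp)

lemma mcForm_extChartAt_one :
    mcForm (1 : N) (extChartAt 𝓘(ℝ, E) (1 : N) 1) = ContinuousLinearMap.id ℝ E := by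
  rw [mcForm_eq_fderiv (mem_extChartAt_target 1)]
  have : (fun z => leftQuotient (1 : N) (extChartAt 𝓘(ℝ, E) (1 : N) 1, z))
      =ᶠ[𝓝 (extChartAt 𝓘(ℝ, E) (1 : N) 1)] id := by
    filter_upwards [(isOpen_extChartAt_target (1 : N)).mem_nhds
      (mem_extChartAt_target (I := 𝓘(ℝ, E)) (1 : N))] with z hz
    rw [leftQuotient, (extChartAt 𝓘(ℝ, E) (1 : N)).left_inv (mem_extChartAt_source (1 : N)),
      inv_one, one_mul, (extChartAt 𝓘(ℝ, E) (1 : N)).right_inv hz, id]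
  rw [this.fderiv_eq, fderiv_id]

lemma leftMulDeriv_comp (x x' z : N) :
    (leftMulDeriv E x (x' * z)).comp (leftMulDeriv E x' z) = leftMulDeriv E (x * x') z := by
  have h1 : MDifferentiableAt 𝓘(ℝ, E) 𝓘(ℝ, E) (fun y : N => x' * y) z :=
    (contMDiff_mul_left (I := 𝓘(ℝ, E)) (n := ∞)).mdifferentiable (by simp) _
  have h2 : MDifferentiableAt 𝓘(ℝ, E) 𝓘(ℝ, E) (fun y : N => x * y) (x' * z) :=
    (contMDiff_mul_left (I := 𝓘(ℝ, E)) (n := ∞)).mdifferentiable (by simp) _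
  have h4 : (fun y : N => x * y) ∘ (fun y : N => x' * y) = fun y => x * x' * y := by
    ext; simp [mul_assoc]
  have h3 := mfderiv_comp z h2 h1
  rw [h4] at h3
  exact h3.symm

lemma leftMulDeriv_inv_comp (x : N) :
    (leftMulDeriv E x⁻¹ x).comp (leftMulDeriv E x 1) = ContinuousLinearMap.id ℝ E := by
  have := leftMulDeriv_comp (E := E) x⁻¹ x 1
  rwa [mul_one, inv_mul_cancel, leftMulDeriv_one] at this

lemma leftMulDeriv_comp_inv (x : N) :
    (leftMulDeriv E x 1).comp (leftMulDeriv E x⁻¹ x) = ContinuousLinearMap.id ℝ E := by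
  have := leftMulDeriv_comp (E := E) x x⁻¹ x
  rwa [inv_mul_cancel, mul_inv_cancel, leftMulDeriv_one] at this

lemma isInvertible_mcForm {x₀ : N} {y : E} (hy : y ∈ (extChartAt 𝓘(ℝ, E) x₀).target) :
    (mcForm x₀ y).IsInvertible := by
  have h0 : IsManifold 𝓘(ℝ, E) 1 N := IsManifold.of_le (n := ∞) (by simp)
  have h1 := isInvertible_mfderivWithin_extChartAt_symm (I := 𝓘(ℝ, E)) hy
  rw [modelWithCornersSelf_coe, range_id, mfderivWithin_univ] at h1
  exact ContinuousLinearMap.IsInvertible.comp (ContinuousLinearMap.IsInvertible.of_inverse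
    (leftMulDeriv_inv_comp _) (leftMulDeriv_comp_inv _)) h1

/-- In the chart, the left-invariant vector field with value `v` at `1` is `y ↦ Θ_y⁻¹ v`. -/
lemma mcForm_mpullback_mulInvariantVectorField {x₀ : N} {y : E}
    (hy : y ∈ (extChartAt 𝓘(ℝ, E) x₀).target) (v : GroupLieAlgebra 𝓘(ℝ, E) N) :
    mcForm x₀ y (mpullbackWithin 𝓘(ℝ, E) 𝓘(ℝ, E) (extChartAt 𝓘(ℝ, E) x₀).symm
      (mulInvariantVectorField v) (range 𝓘(ℝ, E)) y) = v := by
  have h0 : IsManifold 𝓘(ℝ, E) 1 N := IsManifold.of_le (n := ∞) (by simp)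
  have h1 := isInvertible_mfderivWithin_extChartAt_symm (I := 𝓘(ℝ, E)) hy
  rw [mpullbackWithin_apply]
  rw [modelWithCornersSelf_coe, range_id, mfderivWithin_univ] at h1 ⊢
  obtain ⟨e, he⟩ := h1
  have h2 := congrArg (fun f : E →L[ℝ] E => f v)
    (leftMulDeriv_inv_comp (E := E) ((extChartAt 𝓘(ℝ, E) x₀).symm y))
  refine Eq.trans ?_ h2
  rw [← he]
  simp only [mcForm, ← he]
  simp only [ContinuousLinearMap.inverse_equiv]
  exact congrArg _ (e.apply_symm_apply _)

variable [CompleteSpace E] [LieGroup 𝓘(ℝ, E) (minSmoothness ℝ 3) N]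

variable (N) in
/-- The Lie bracket of the Lie algebra of `N`, on the model space. -/
def groupBracket : E → E → E :=
  fun (v w : GroupLieAlgebra 𝓘(ℝ, E) N) => (⁅v, w⁆ : GroupLieAlgebra 𝓘(ℝ, E) N)

/-- The Lie algebra bracket comes from left-invariant vector fields. At the centre of the chart the
derivative of the chart is the identity, so the bracket of fields can be computed in coordinates
there. -/
lemma mcForm_lieBracket (x₀ : N) (v w : E) :
    mcForm x₀ (extChartAt 𝓘(ℝ, E) x₀ x₀) (lieBracket ℝ
      (fun y => (mpullbackWithin 𝓘(ℝ, E) 𝓘(ℝ, E) (extChartAt 𝓘(ℝ, E) x₀).symm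
        (mulInvariantVectorField (G := N) v) (range 𝓘(ℝ, E)) y : E))
      (fun y => (mpullbackWithin 𝓘(ℝ, E) 𝓘(ℝ, E) (extChartAt 𝓘(ℝ, E) x₀).symm
        (mulInvariantVectorField (G := N) w) (range 𝓘(ℝ, E)) y : E))
        (extChartAt 𝓘(ℝ, E) x₀ x₀)) = groupBracket N v w := by
  have h0 : IsManifold 𝓘(ℝ, E) 1 N := IsManifold.of_le (n := ∞) (by simp)
  have h1 := congrFun (mulInvariantVector_mlieBracket (I := 𝓘(ℝ, E))
    (G := N) v w) x₀
  have h2 := mcForm_mpullback_mulInvariantVectorField (mem_extChartAt_target x₀)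
    (groupBracket (E := E) N v w)
  have key : ∀ (u : GroupLieAlgebra 𝓘(ℝ, E) N) (x : N), x = x₀ →
      (mulInvariantVectorField u x : E) = mulInvariantVectorField u x₀ := by
    rintro u _ rfl; rfl
  have h3 : ∀ z : E, (show E →L[ℝ] E from mfderivWithin 𝓘(ℝ, E) 𝓘(ℝ, E)
      (extChartAt 𝓘(ℝ, E) x₀).symm (range 𝓘(ℝ, E)) (extChartAt 𝓘(ℝ, E) x₀ x₀)).inverse z = z :=
    fun z => mfderivWithin_extChartAt_symm_inverse_apply (I := 𝓘(ℝ, E)) (x := x₀) z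
  have h4 : mcForm x₀ (extChartAt 𝓘(ℝ, E) x₀ x₀)
      (mulInvariantVectorField (groupBracket (E := E) N v w) x₀ : E)
        = groupBracket N v w :=
    (congrArg _ ((h3 _).trans (key _ _ (extChartAt_to_inv x₀)))).symm.trans h2
  refine Eq.trans ?_ h4
  refine congrArg _ ?_
  have h5 : ∀ z : E, (show E →L[ℝ] E from mfderiv 𝓘(ℝ, E) 𝓘(ℝ, E)
      (extChartAt 𝓘(ℝ, E) x₀) x₀).inverse z = z := by
    intro z
    have : (show E →L[ℝ] E from mfderiv 𝓘(ℝ, E) 𝓘(ℝ, E) (extChartAt 𝓘(ℝ, E) x₀) x₀)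
      = ContinuousLinearMap.id ℝ E := mfderiv_extChartAt_self
    rw [this, ContinuousLinearMap.inverse_id]; rfl
  refine Eq.trans ?_ h1.symm
  refine Eq.trans (b := (_ : E)) ?_ (h5 _).symm
  simp only [modelWithCornersSelf_coe, range_id, preimage_univ, inter_univ]
  exact (congrFun lieBracketWithin_univ _).symm

/-- The Maurer-Cartan equation at the centre of a chart. -/
lemma fderiv_mcForm_sub (x₀ : N) (u w : E) :
    fderiv ℝ (mcForm x₀) (extChartAt 𝓘(ℝ, E) x₀ x₀) u w
      - fderiv ℝ (mcForm x₀) (extChartAt 𝓘(ℝ, E) x₀ x₀) w u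
      = -groupBracket N (mcForm x₀ (extChartAt 𝓘(ℝ, E) x₀ x₀) u)
          (mcForm x₀ (extChartAt 𝓘(ℝ, E) x₀ x₀) w) := by
  set y₀ := extChartAt 𝓘(ℝ, E) x₀ x₀ with hy₀
  have hy : y₀ ∈ (extChartAt 𝓘(ℝ, E) x₀).target := mem_extChartAt_target x₀
  have hΘ : DifferentiableAt ℝ (mcForm x₀) y₀ := (contDiffAt_mcForm hy).differentiableAt (by simp)
  let X : E → E → E := fun v => mpullbackWithin 𝓘(ℝ, E) 𝓘(ℝ, E) (extChartAt 𝓘(ℝ, E) x₀).symm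
        (mulInvariantVectorField (G := N) v) (range 𝓘(ℝ, E))
  have hX : ∀ v, ∀ y ∈ (extChartAt 𝓘(ℝ, E) x₀).target, X v y = (mcForm x₀ y).inverse v := by
    intro v y hy
    obtain ⟨e, he⟩ := isInvertible_mcForm hy
    have := mcForm_mpullback_mulInvariantVectorField hy v
    rw [← he] at this ⊢
    rw [ContinuousLinearMap.inverse_equiv]
    exact e.injective (this.trans (e.apply_symm_apply v).symm)
  have hXd : ∀ v, DifferentiableAt ℝ (X v) y₀ := by
    intro v
    have h1 : ContDiffAt ℝ ∞ (fun y => (mcForm x₀ y).inverse) y₀ :=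
      ((isInvertible_mcForm hy).contDiffAt_map_inverse).comp y₀ (contDiffAt_mcForm hy)
    have h2 : DifferentiableAt ℝ (fun y => (mcForm x₀ y).inverse v) y₀ :=
      (h1.differentiableAt (by simp)).clm_apply (differentiableAt_const v)
    refine h2.congr_of_eventuallyEq ?_
    filter_upwards [(isOpen_extChartAt_target x₀).mem_nhds hy] with y hy'
    exact hX v y hy'
  -- Derivative of the constant function `y ↦ mcForm x₀ y (X v y)`, whose value is `v`.
  have hD : ∀ v z, fderiv ℝ (mcForm x₀) y₀ z (X v y₀) + mcForm x₀ y₀ (fderiv ℝ (X v) y₀ z) = 0 := by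
    intro v z
    have h1 := hΘ.hasFDerivAt.clm_apply (hXd v).hasFDerivAt
    have h2 : (fun y => mcForm x₀ y (X v y)) =ᶠ[𝓝 y₀] fun _ => v := by
      filter_upwards [(isOpen_extChartAt_target x₀).mem_nhds hy] with y hy'
      exact mcForm_mpullback_mulInvariantVectorField hy' v
    have h3 := h1.unique ((hasFDerivAt_const v y₀).congr_of_eventuallyEq h2)
    have h4 := congrArg (fun f => f z) h3
    simp at h4
    rw [add_comm]; exact h4
  have hinj : Function.Injective (mcForm x₀ y₀) := by
    obtain ⟨e, he⟩ := isInvertible_mcForm hy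
    rw [← he]; exact e.injective
  have hXv : ∀ z, X (mcForm x₀ y₀ z) y₀ = z := fun z =>
    hinj (mcForm_mpullback_mulInvariantVectorField hy _)
  have h5 := mcForm_lieBracket x₀ (mcForm x₀ y₀ u) (mcForm x₀ y₀ w)
  change mcForm x₀ y₀ (fderiv ℝ (X (mcForm x₀ y₀ w)) y₀ (X (mcForm x₀ y₀ u) y₀)
    - fderiv ℝ (X (mcForm x₀ y₀ u)) y₀ (X (mcForm x₀ y₀ w) y₀)) = _ at h5
  rw [hXv, hXv, map_sub] at h5
  have h6 := hD (mcForm x₀ y₀ w) u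
  have h7 := hD (mcForm x₀ y₀ u) w
  rw [hXv] at h6 h7
  rw [← h5, eq_neg_of_add_eq_zero_left h6, eq_neg_of_add_eq_zero_left h7]
  abel

end LocalCoordinates

/-! ### Mixed second derivatives. -/

section Calculus

variable {E F G : Type*} [NormedAddCommGroup E] [NormedSpace ℝ E] [NormedAddCommGroup F]
  [NormedSpace ℝ F] [NormedAddCommGroup G] [NormedSpace ℝ G]

lemma hasFDerivAt_fderiv_snd {f : E × F → G} {a : E} {b : F} (hf : ContDiffAt ℝ 2 f (a, b)) :
    HasFDerivAt (fun y => fderiv ℝ (fun z => f (y, z)) b)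
      (((ContinuousLinearMap.compL ℝ F (E × F) G).flip (ContinuousLinearMap.inr ℝ E F)).comp
        ((fderiv ℝ (fderiv ℝ f) (a, b)).comp (ContinuousLinearMap.inl ℝ E F))) a := by
  have h1 : ∀ᶠ p in 𝓝 (a, b), DifferentiableAt ℝ f p := by
    filter_upwards [hf.eventually (by simp)] with p hp using hp.differentiableAt (by simp)
  have h2 : ∀ᶠ y in 𝓝 a, DifferentiableAt ℝ f (y, b) :=
    (Continuous.tendsto (by fun_prop : Continuous fun y : E => (y, b)) a).eventually h1
  have h3 : (fun y => fderiv ℝ (fun z => f (y, z)) b) =ᶠ[𝓝 a]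
      fun y => (fderiv ℝ f (y, b)).comp (ContinuousLinearMap.inr ℝ E F) := by
    filter_upwards [h2] with y hy
    exact (hy.hasFDerivAt.comp b (hasFDerivAt_prodMk_right y b)).fderiv
  have h4 : HasFDerivAt (fderiv ℝ f) (fderiv ℝ (fderiv ℝ f) (a, b)) (a, b) :=
    ((hf.fderiv_right (m := 1) (by norm_num)).differentiableAt (by simp)).hasFDerivAt
  have h5 := HasFDerivAt.comp (g := fderiv ℝ f) (f := fun y => (y, b)) a h4
    (hasFDerivAt_prodMk_left a b)
  exact (((ContinuousLinearMap.compL ℝ F (E × F) G).flip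
    (ContinuousLinearMap.inr ℝ E F)).hasFDerivAt.comp a h5).congr_of_eventuallyEq h3

lemma hasFDerivAt_fderiv_fst {f : E × F → G} {a : E} {b : F} (hf : ContDiffAt ℝ 2 f (a, b)) :
    HasFDerivAt (fun z => fderiv ℝ (fun y => f (y, z)) a)
      (((ContinuousLinearMap.compL ℝ E (E × F) G).flip (ContinuousLinearMap.inl ℝ E F)).comp
        ((fderiv ℝ (fderiv ℝ f) (a, b)).comp (ContinuousLinearMap.inr ℝ E F))) b := by
  have h1 : ∀ᶠ p in 𝓝 (a, b), DifferentiableAt ℝ f p := by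
    filter_upwards [hf.eventually (by simp)] with p hp using hp.differentiableAt (by simp)
  have h2 : ∀ᶠ z in 𝓝 b, DifferentiableAt ℝ f (a, z) :=
    (Continuous.tendsto (by fun_prop : Continuous fun z : F => (a, z)) b).eventually h1
  have h3 : (fun z => fderiv ℝ (fun y => f (y, z)) a) =ᶠ[𝓝 b]
      fun z => (fderiv ℝ f (a, z)).comp (ContinuousLinearMap.inl ℝ E F) := by
    filter_upwards [h2] with z hz
    exact (hz.hasFDerivAt.comp a (hasFDerivAt_prodMk_left a z)).fderiv
  have h4 : HasFDerivAt (fderiv ℝ f) (fderiv ℝ (fderiv ℝ f) (a, b)) (a, b) :=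
    ((hf.fderiv_right (m := 1) (by norm_num)).differentiableAt (by simp)).hasFDerivAt
  have h5 := h4.comp b (hasFDerivAt_prodMk_right a b)
  exact (((ContinuousLinearMap.compL ℝ E (E × F) G).flip
    (ContinuousLinearMap.inl ℝ E F)).hasFDerivAt.comp b h5).congr_of_eventuallyEq h3

lemma fderiv_fderiv_snd_eq_fst {f : E × F → G} {a : E} {b : F} (hf : ContDiffAt ℝ 2 f (a, b))
    (u : E) (w : F) :
    fderiv ℝ (fun y => fderiv ℝ (fun z => f (y, z)) b) a u w =
      fderiv ℝ (fun z => fderiv ℝ (fun y => f (y, z)) a) b w u := by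
  rw [(hasFDerivAt_fderiv_snd hf).fderiv, (hasFDerivAt_fderiv_fst hf).fderiv]
  exact (hf.isSymmSndFDerivAt (by simp)).eq (u, 0) (0, w)

end Calculus

/-! ### Curves in a Lie group and the geodesic expression. -/

section Curves

variable {E : Type*} [NormedAddCommGroup E] [NormedSpace ℝ E]
  {N : Type*} [TopologicalSpace N] [ChartedSpace E N] [Group N]

variable (E) in
/-- The velocity of a curve in a Lie group, translated to the identity from the left. -/
def bodyVelocity (γ : ℝ → N) (t : ℝ) : E :=
  deriv (fun τ => extChartAt 𝓘(ℝ, E) (1 : N) ((γ t)⁻¹ * γ τ)) t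

variable [LieGroup 𝓘(ℝ, E) ∞ N]

lemma hasDerivAt_leftQuotient_curve {x₀ : N} {γ : ℝ → N} {c : ℝ → E} {c' : E} {t : ℝ}
    (hc : HasDerivAt c c' t) (hct : c t ∈ (extChartAt 𝓘(ℝ, E) x₀).target)
    (hγ : ∀ᶠ τ in 𝓝 t, γ τ = (extChartAt 𝓘(ℝ, E) x₀).symm (c τ)) :
    HasDerivAt (fun τ => extChartAt 𝓘(ℝ, E) (1 : N) ((γ t)⁻¹ * γ τ)) (mcForm x₀ (c t) c') t := by
  have h1 : (fun τ => extChartAt 𝓘(ℝ, E) (1 : N) ((γ t)⁻¹ * γ τ)) =ᶠ[𝓝 t]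
      fun τ => leftQuotient x₀ (c t, c τ) := by
    filter_upwards [hγ] with τ hτ
    rw [hγ.self_of_nhds, hτ, leftQuotient]
  refine HasDerivAt.congr_of_eventuallyEq ?_ h1
  rw [mcForm_eq_fderiv hct]
  have h2 : DifferentiableAt ℝ (fun z => leftQuotient x₀ (c t, z)) (c t) := by
    have := (contDiffAt_leftQuotient hct).differentiableAt (by simp)
    exact this.comp (c t) (by fun_prop : DifferentiableAt ℝ (fun z => (c t, z)) (c t))
  exact h2.hasFDerivAt.comp_hasDerivAt t hc

lemma bodyVelocity_eq {x₀ : N} {γ : ℝ → N} {c : ℝ → E} {c' : E} {t : ℝ}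
    (hc : HasDerivAt c c' t) (hct : c t ∈ (extChartAt 𝓘(ℝ, E) x₀).target)
    (hγ : ∀ᶠ τ in 𝓝 t, γ τ = (extChartAt 𝓘(ℝ, E) x₀).symm (c τ)) :
    bodyVelocity E γ t = mcForm x₀ (c t) c' :=
  (hasDerivAt_leftQuotient_curve hc hct hγ).deriv

lemma hasDerivAt_bodyVelocity {x₀ : N} {γ : ℝ → N} {c c₁ : ℝ → E} {c₂ : E} {t : ℝ}
    (hc : ∀ᶠ τ in 𝓝 t, HasDerivAt c (c₁ τ) τ) (hc₁ : HasDerivAt c₁ c₂ t)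
    (hct : c t ∈ (extChartAt 𝓘(ℝ, E) x₀).target)
    (hγ : ∀ᶠ τ in 𝓝 t, γ τ = (extChartAt 𝓘(ℝ, E) x₀).symm (c τ)) :
    HasDerivAt (bodyVelocity E γ)
      (fderiv ℝ (mcForm x₀) (c t) (c₁ t) (c₁ t) + mcForm x₀ (c t) c₂) t := by
  have h0 : ∀ᶠ τ in 𝓝 t, c τ ∈ (extChartAt 𝓘(ℝ, E) x₀).target :=
    hc.self_of_nhds.continuousAt.eventually ((isOpen_extChartAt_target x₀).mem_nhds hct)
  have h1 : bodyVelocity E γ =ᶠ[𝓝 t] fun τ => mcForm x₀ (c τ) (c₁ τ) := by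
    filter_upwards [hc, h0, hγ.eventually_nhds] with τ h1 h2 h3 using bodyVelocity_eq h1 h2 h3
  refine HasDerivAt.congr_of_eventuallyEq ?_ h1
  have h2 := ((contDiffAt_mcForm hct).differentiableAt (by simp)).hasFDerivAt.comp_hasDerivAt t
    hc.self_of_nhds
  exact h2.clm_apply hc₁

variable [CompleteSpace E] [LieGroup 𝓘(ℝ, E) (minSmoothness ℝ 3) N]

/-- The metric in the chart is B(Θ·, Θ·), so its derivatives only involve dΘ, for Θ = `mcForm x₀`.
Apart from the derivative of the body velocity, they combine to the antisymmetric part of dΘ, which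
the Maurer-Cartan equation turns into a bracket. -/
lemma geodesic_expression_eq (B : E →L[ℝ] E →L[ℝ] ℝ) (hB : ∀ x y, B x y = B y x) (x₀ : N)
    (c₁ c₂ w : E) :
    B (mcForm x₀ (extChartAt 𝓘(ℝ, E) x₀ x₀) c₂) (mcForm x₀ (extChartAt 𝓘(ℝ, E) x₀ x₀) w)
      + fderiv ℝ (fun y => B (mcForm x₀ y c₁) (mcForm x₀ y w)) (extChartAt 𝓘(ℝ, E) x₀ x₀) c₁
      - (1 / 2 : ℝ) *
        fderiv ℝ (fun y => B (mcForm x₀ y c₁) (mcForm x₀ y c₁)) (extChartAt 𝓘(ℝ, E) x₀ x₀) w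
    = B (fderiv ℝ (mcForm x₀) (extChartAt 𝓘(ℝ, E) x₀ x₀) c₁ c₁
          + mcForm x₀ (extChartAt 𝓘(ℝ, E) x₀ x₀) c₂)
        (mcForm x₀ (extChartAt 𝓘(ℝ, E) x₀ x₀) w)
      - B (mcForm x₀ (extChartAt 𝓘(ℝ, E) x₀ x₀) c₁)
        (groupBracket N (mcForm x₀ (extChartAt 𝓘(ℝ, E) x₀ x₀) c₁)
          (mcForm x₀ (extChartAt 𝓘(ℝ, E) x₀ x₀) w)) := by
  have hmc := fderiv_mcForm_sub x₀ c₁ w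
  set y₀ := extChartAt 𝓘(ℝ, E) x₀ x₀
  have hΘ := ((contDiffAt_mcForm (N := N) (mem_extChartAt_target x₀)).differentiableAt
    (by simp) : DifferentiableAt ℝ (mcForm x₀) y₀).hasFDerivAt
  have hd : ∀ a b z : E, fderiv ℝ (fun y => B (mcForm x₀ y a) (mcForm x₀ y b)) y₀ z
      = B (fderiv ℝ (mcForm x₀) y₀ z a) (mcForm x₀ y₀ b)
        + B (mcForm x₀ y₀ a) (fderiv ℝ (mcForm x₀) y₀ z b) := by
    intro a b z
    have h1 : ∀ a : E, HasFDerivAt (fun y => mcForm x₀ y a)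
        ((ContinuousLinearMap.apply ℝ E a).comp (fderiv ℝ (mcForm x₀) y₀)) y₀ := fun a =>
      (ContinuousLinearMap.apply ℝ E a).hasFDerivAt.comp y₀ hΘ
    have h2 := (B.hasFDerivAt.comp y₀ (h1 a)).clm_apply (h1 b)
    have h3 := h2.fderiv
    simp only [Function.comp_def] at h3
    rw [h3]
    simp [add_comm]
  rw [hd, hd]
  have h : groupBracket N (mcForm x₀ y₀ c₁) (mcForm x₀ y₀ w)
    = fderiv ℝ (mcForm x₀) y₀ w c₁ - fderiv ℝ (mcForm x₀) y₀ c₁ w := by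
    rw [← neg_eq_iff_eq_neg.mpr hmc]; abel
  rw [h, map_sub, map_add, add_apply, hB (fderiv ℝ (mcForm x₀) y₀ w c₁)]
  ring

end Curves

/-! ### The adjoint representation and its derivative. -/

section Adjoint

variable {E : Type*} [NormedAddCommGroup E] [NormedSpace ℝ E]
  {N : Type*} [TopologicalSpace N] [ChartedSpace E N] [Group N]

variable (E) in
/-- The derivative at `1` of a map fixing `1`. -/
def derivAtOne (f : N → N) : E →L[ℝ] E :=
  mfderiv 𝓘(ℝ, E) 𝓘(ℝ, E) f 1

lemma derivAtOne_eq_fderiv {f : N → N} (hf : ContMDiffAt 𝓘(ℝ, E) 𝓘(ℝ, E) ∞ f 1) (h1 : f 1 = 1) :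
    derivAtOne E f = fderiv ℝ (fun z => extChartAt 𝓘(ℝ, E) (1 : N)
      (f ((extChartAt 𝓘(ℝ, E) (1 : N)).symm z))) (extChartAt 𝓘(ℝ, E) (1 : N) 1) := by
  ext w
  exact congrFun (mfderiv_eq_fderiv_writtenInExtChartAt (hf.mdifferentiableAt (by simp)) h1) w

lemma derivAtOne_comp {f g : N → N} (hf : ContMDiffAt 𝓘(ℝ, E) 𝓘(ℝ, E) ∞ f 1)
    (hg : ContMDiffAt 𝓘(ℝ, E) 𝓘(ℝ, E) ∞ g 1) (h1 : g 1 = 1) :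
    derivAtOne E (f ∘ g) = (derivAtOne E f).comp (derivAtOne E g) := by
  have hf' : MDifferentiableAt 𝓘(ℝ, E) 𝓘(ℝ, E) f (g 1) := by
    rw [h1]; exact hf.mdifferentiableAt (by simp)
  have h := mfderiv_comp 1 hf' (hg.mdifferentiableAt (by simp))
  have key : ∀ x : N, x = 1 → (show E →L[ℝ] E from mfderiv 𝓘(ℝ, E) 𝓘(ℝ, E) f x)
      = derivAtOne E f := by
    rintro _ rfl; rfl
  have h2 := key _ h1
  rw [← h2]
  exact h

lemma derivAtOne_id : derivAtOne E (id : N → N) = ContinuousLinearMap.id ℝ E := mfderiv_id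

/-- Multiplication in the chart at `1`. -/
def chartMul (N : Type*) [TopologicalSpace N] [ChartedSpace E N] [Group N] (p : E × E) : E :=
  extChartAt 𝓘(ℝ, E) (1 : N)
    ((extChartAt 𝓘(ℝ, E) (1 : N)).symm p.1 * (extChartAt 𝓘(ℝ, E) (1 : N)).symm p.2)

/-- Conjugation in the chart at `1`. -/
def chartConj (N : Type*) [TopologicalSpace N] [ChartedSpace E N] [Group N] (p : E × E) : E :=
  extChartAt 𝓘(ℝ, E) (1 : N)
    ((extChartAt 𝓘(ℝ, E) (1 : N)).symm p.1 * (extChartAt 𝓘(ℝ, E) (1 : N)).symm p.2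
      * ((extChartAt 𝓘(ℝ, E) (1 : N)).symm p.1)⁻¹)

lemma chartMul_right_one {y : E} (hy : y ∈ (extChartAt 𝓘(ℝ, E) (1 : N)).target) :
    chartMul N (y, extChartAt 𝓘(ℝ, E) (1 : N) 1) = y := by
  rw [chartMul]
  simp only [extChartAt_to_inv, mul_one]
  exact (extChartAt 𝓘(ℝ, E) (1 : N)).right_inv hy

lemma chartMul_left_one {y : E} (hy : y ∈ (extChartAt 𝓘(ℝ, E) (1 : N)).target) :
    chartMul N (extChartAt 𝓘(ℝ, E) (1 : N) 1, y) = y := by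
  rw [chartMul]
  simp only [extChartAt_to_inv, one_mul]
  exact (extChartAt 𝓘(ℝ, E) (1 : N)).right_inv hy

lemma chartConj_right_one (y : E) :
    chartConj N (y, extChartAt 𝓘(ℝ, E) (1 : N) 1) = extChartAt 𝓘(ℝ, E) (1 : N) 1 := by
  rw [chartConj]
  simp only [extChartAt_to_inv, mul_one, mul_inv_cancel]

variable [LieGroup 𝓘(ℝ, E) ∞ N]

variable (E) in
/-- The adjoint representation. -/
def groupAd (g : N) : E →L[ℝ] E := derivAtOne E fun h : N => g * h * g⁻¹

lemma contMDiff_conj (g : N) : ContMDiff 𝓘(ℝ, E) 𝓘(ℝ, E) ∞ fun h : N => g * h * g⁻¹ :=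
  (contMDiff_const.mul contMDiff_id).mul contMDiff_const

lemma contMDiffAt_extChartAt_symm_fst :
    ContMDiffAt 𝓘(ℝ, E × E) 𝓘(ℝ, E) ∞
      (fun p : E × E => (extChartAt 𝓘(ℝ, E) (1 : N)).symm p.1)
      (extChartAt 𝓘(ℝ, E) (1 : N) 1, extChartAt 𝓘(ℝ, E) (1 : N) 1) :=
  ContMDiffAt.comp (I' := 𝓘(ℝ, E)) (_, _)
    (contMDiffAt_extChartAt_symm_of_mem (mem_extChartAt_target 1)) contDiffAt_fst.contMDiffAt

lemma contMDiffAt_extChartAt_symm_snd :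
    ContMDiffAt 𝓘(ℝ, E × E) 𝓘(ℝ, E) ∞
      (fun p : E × E => (extChartAt 𝓘(ℝ, E) (1 : N)).symm p.2)
      (extChartAt 𝓘(ℝ, E) (1 : N) 1, extChartAt 𝓘(ℝ, E) (1 : N) 1) :=
  ContMDiffAt.comp (I' := 𝓘(ℝ, E)) (_, _)
    (contMDiffAt_extChartAt_symm_of_mem (mem_extChartAt_target 1)) contDiffAt_snd.contMDiffAt

lemma contDiffAt_chartMul : ContDiffAt ℝ ∞ (chartMul (E := E) N)
    (extChartAt 𝓘(ℝ, E) (1 : N) 1, extChartAt 𝓘(ℝ, E) (1 : N) 1) := by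
  rw [← contMDiffAt_iff_contDiffAt]
  refine ContMDiffAt.comp (I' := 𝓘(ℝ, E)) _ ?_
    (contMDiffAt_extChartAt_symm_fst.mul contMDiffAt_extChartAt_symm_snd)
  simp only [extChartAt_to_inv, mul_one]
  exact contMDiffAt_extChartAt

lemma contDiffAt_chartConj : ContDiffAt ℝ ∞ (chartConj (E := E) N)
    (extChartAt 𝓘(ℝ, E) (1 : N) 1, extChartAt 𝓘(ℝ, E) (1 : N) 1) := by
  rw [← contMDiffAt_iff_contDiffAt]
  refine ContMDiffAt.comp (I' := 𝓘(ℝ, E)) _ ?_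
    ((contMDiffAt_extChartAt_symm_fst.mul contMDiffAt_extChartAt_symm_snd).mul
      contMDiffAt_extChartAt_symm_fst.inv)
  simp only [extChartAt_to_inv, mul_one, mul_inv_cancel]
  exact contMDiffAt_extChartAt

lemma groupAd_eq_fderiv (y : E) :
    groupAd E ((extChartAt 𝓘(ℝ, E) (1 : N)).symm y) =
      fderiv ℝ (fun z => chartConj N (y, z)) (extChartAt 𝓘(ℝ, E) (1 : N) 1) :=
  derivAtOne_eq_fderiv (contMDiff_conj _).contMDiffAt (by simp)

lemma eventually_differentiableAt_chartMul :
    ∀ᶠ p in 𝓝 (extChartAt 𝓘(ℝ, E) (1 : N) 1, extChartAt 𝓘(ℝ, E) (1 : N) 1),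
      DifferentiableAt ℝ (chartMul (E := E) N) p := by
  have h : ContDiffAt ℝ 1 (chartMul (E := E) N)
    (extChartAt 𝓘(ℝ, E) (1 : N) 1, extChartAt 𝓘(ℝ, E) (1 : N) 1) :=
      contDiffAt_chartMul.of_le (by simp)
  filter_upwards [h.eventually (by simp)] with p hp using hp.differentiableAt (by simp)

lemma eventually_differentiableAt_chartConj :
    ∀ᶠ p in 𝓝 (extChartAt 𝓘(ℝ, E) (1 : N) 1, extChartAt 𝓘(ℝ, E) (1 : N) 1),
      DifferentiableAt ℝ (chartConj (E := E) N) p := by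
  have h : ContDiffAt ℝ 1 (chartConj (E := E) N)
    (extChartAt 𝓘(ℝ, E) (1 : N) 1, extChartAt 𝓘(ℝ, E) (1 : N) 1) :=
      contDiffAt_chartConj.of_le (by simp)
  filter_upwards [h.eventually (by simp)] with p hp using hp.differentiableAt (by simp)

/-- Derivative in z at the identity of (y z y⁻¹) y = y z. -/
lemma fderiv_chartMul_comp_groupAd :
    ∀ᶠ y in 𝓝 (extChartAt 𝓘(ℝ, E) (1 : N) 1),
      (fderiv ℝ (fun z => chartMul N (z, y)) (extChartAt 𝓘(ℝ, E) (1 : N) 1)).comp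
        (fderiv ℝ (fun z => chartConj N (y, z)) (extChartAt 𝓘(ℝ, E) (1 : N) 1))
      = fderiv ℝ (fun z => chartMul N (y, z)) (extChartAt 𝓘(ℝ, E) (1 : N) 1) := by
  set y₀ := extChartAt 𝓘(ℝ, E) (1 : N) 1 with hy₀
  have c1 : Continuous fun y : E => (y₀, y) := by fun_prop
  have c2 : Continuous fun y : E => (y, y₀) := by fun_prop
  have h1 := (c1.tendsto y₀).eventually (eventually_differentiableAt_chartMul (E := E) (N := N))
  have h3 := (c2.tendsto y₀).eventually (eventually_differentiableAt_chartConj (E := E) (N := N))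
  have h4 := (isOpen_extChartAt_target (I := 𝓘(ℝ, E)) (1 : N)).mem_nhds
    (mem_extChartAt_target (I := 𝓘(ℝ, E)) (1 : N))
  filter_upwards [h1, h3, h4] with y h1 h3 h4
  have d1 : DifferentiableAt ℝ (fun z => chartMul N (z, y)) (chartConj N (y, y₀)) := by
    rw [chartConj_right_one]
    exact DifferentiableAt.comp (g := chartMul N) (f := fun z => (z, y)) y₀ h1 (by fun_prop)
  have d2 : DifferentiableAt ℝ (fun z => chartConj N (y, z)) y₀ :=
    DifferentiableAt.comp (g := chartConj N) (f := fun z => (y, z)) y₀ h3 (by fun_prop)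
  have h5 := fderiv_comp y₀ d1 d2
  rw [chartConj_right_one] at h5
  rw [← hy₀] at h5
  rw [← h5]
  refine Filter.EventuallyEq.fderiv_eq ?_
  have h6 : ContinuousAt (fun z => (extChartAt 𝓘(ℝ, E) (1 : N)).symm y
      * (extChartAt 𝓘(ℝ, E) (1 : N)).symm z * ((extChartAt 𝓘(ℝ, E) (1 : N)).symm y)⁻¹) y₀ := by
    have := (contMDiff_conj (E := E) ((extChartAt 𝓘(ℝ, E) (1 : N)).symm y)).contMDiffAt.comp
      y₀ (contMDiffAt_extChartAt_symm_of_mem (mem_extChartAt_target (I := 𝓘(ℝ, E)) (1 : N)))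
    exact this.continuousAt
  have h7 : ∀ᶠ z in 𝓝 y₀, (extChartAt 𝓘(ℝ, E) (1 : N)).symm y
      * (extChartAt 𝓘(ℝ, E) (1 : N)).symm z * ((extChartAt 𝓘(ℝ, E) (1 : N)).symm y)⁻¹
      ∈ (extChartAt 𝓘(ℝ, E) (1 : N)).source := by
    refine h6.eventually ((isOpen_extChartAt_source (1 : N)).mem_nhds ?_)
    simp [hy₀]
  filter_upwards [h7] with z hz
  simp only [Function.comp, chartMul, chartConj]
  rw [(extChartAt 𝓘(ℝ, E) (1 : N)).left_inv hz, inv_mul_cancel_right]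

/-- Derivative in z at the identity of y⁻¹ (y z) = z. -/
lemma mcForm_comp_fderiv_chartMul :
    ∀ᶠ y in 𝓝 (extChartAt 𝓘(ℝ, E) (1 : N) 1),
      (mcForm (1 : N) y).comp
        (fderiv ℝ (fun z => chartMul N (y, z)) (extChartAt 𝓘(ℝ, E) (1 : N) 1))
      = ContinuousLinearMap.id ℝ E := by
  set y₀ := extChartAt 𝓘(ℝ, E) (1 : N) 1 with hy₀
  have c2 : Continuous fun y : E => (y, y₀) := by fun_prop
  have h1 := (c2.tendsto y₀).eventually (eventually_differentiableAt_chartMul (E := E) (N := N))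
  have h4 := (isOpen_extChartAt_target (I := 𝓘(ℝ, E)) (1 : N)).mem_nhds
    (mem_extChartAt_target (I := 𝓘(ℝ, E)) (1 : N))
  filter_upwards [h1, h4] with y h1 hy
  have d1 : DifferentiableAt ℝ (fun z => leftQuotient (1 : N) (y, z)) (chartMul N (y, y₀)) := by
    rw [chartMul_right_one hy]
    exact DifferentiableAt.comp (g := leftQuotient (1 : N)) (f := fun z => (y, z)) y
      ((contDiffAt_leftQuotient hy).differentiableAt (by simp)) (by fun_prop)
  have d2 : DifferentiableAt ℝ (fun z => chartMul N (y, z)) y₀ :=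
    DifferentiableAt.comp (g := chartMul N) (f := fun z => (y, z)) y₀ h1 (by fun_prop)
  have h5 := fderiv_comp y₀ d1 d2
  rw [chartMul_right_one hy, ← mcForm_eq_fderiv hy] at h5
  rw [← h5]
  have h6 : ContinuousAt (fun z => (extChartAt 𝓘(ℝ, E) (1 : N)).symm y
      * (extChartAt 𝓘(ℝ, E) (1 : N)).symm z) y₀ := by
    have := (contMDiff_mul_left (I := 𝓘(ℝ, E)) (n := ∞)
      (a := (extChartAt 𝓘(ℝ, E) (1 : N)).symm y)).contMDiffAt.comp
      y₀ (contMDiffAt_extChartAt_symm_of_mem (mem_extChartAt_target (I := 𝓘(ℝ, E)) (1 : N)))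
    exact this.continuousAt
  have h7 : ∀ᶠ z in 𝓝 y₀, (extChartAt 𝓘(ℝ, E) (1 : N)).symm y
      * (extChartAt 𝓘(ℝ, E) (1 : N)).symm z ∈ (extChartAt 𝓘(ℝ, E) (1 : N)).source := by
    refine h6.eventually ((isOpen_extChartAt_source (1 : N)).mem_nhds ?_)
    beta_reduce
    rw [hy₀, extChartAt_to_inv, mul_one]
    exact (extChartAt 𝓘(ℝ, E) (1 : N)).map_target hy
  have h8 : ((fun z => leftQuotient (1 : N) (y, z)) ∘ fun z => chartMul N (y, z)) =ᶠ[𝓝 y₀] id := by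
    filter_upwards [h7, h4] with z hz hz'
    simp only [Function.comp, chartMul, leftQuotient]
    rw [(extChartAt 𝓘(ℝ, E) (1 : N)).left_inv hz, inv_mul_cancel_left,
      (extChartAt 𝓘(ℝ, E) (1 : N)).right_inv hz', id]
  rw [h8.fderiv_eq, fderiv_id]

variable [CompleteSpace E] [LieGroup 𝓘(ℝ, E) (minSmoothness ℝ 3) N]

/-- Differentiating the two preceding identities in y expresses the derivative of Ad through mixed
second derivatives of the multiplication. Their symmetry turns it into minus the antisymmetric part
of the derivative of the Maurer-Cartan form, which is the bracket. -/
lemma fderiv_chartConj_fderiv (v w : E) :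
    DifferentiableAt ℝ (fun y => fderiv ℝ (fun z => chartConj N (y, z))
        (extChartAt 𝓘(ℝ, E) (1 : N) 1)) (extChartAt 𝓘(ℝ, E) (1 : N) 1) ∧
    fderiv ℝ (fun y => fderiv ℝ (fun z => chartConj N (y, z)) (extChartAt 𝓘(ℝ, E) (1 : N) 1))
      (extChartAt 𝓘(ℝ, E) (1 : N) 1) v w = groupBracket N v w := by
  have hmc := fderiv_mcForm_sub (1 : N) v w
  have e1 := fderiv_chartMul_comp_groupAd (E := E) (N := N)
  have e2 := mcForm_comp_fderiv_chartMul (E := E) (N := N)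
  rw [mcForm_extChartAt_one] at hmc
  have hΘ0 := mcForm_extChartAt_one (E := E) (N := N)
  have htgt := (isOpen_extChartAt_target (I := 𝓘(ℝ, E)) (1 : N)).mem_nhds
    (mem_extChartAt_target (I := 𝓘(ℝ, E)) (1 : N))
  have hM := (contDiffAt_chartMul (E := E) (N := N)).of_le
    (show (2 : WithTop ℕ∞) ≤ ∞ from WithTop.coe_le_coe.mpr le_top)
  have hC := (contDiffAt_chartConj (E := E) (N := N)).of_le
    (show (2 : WithTop ℕ∞) ≤ ∞ from WithTop.coe_le_coe.mpr le_top)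
  have hΘ := ((contDiffAt_mcForm (N := N) (mem_extChartAt_target 1)).differentiableAt
    (by simp) : DifferentiableAt ℝ (mcForm (1 : N)) (extChartAt 𝓘(ℝ, E) (1 : N) 1))
  have p20 : fderiv ℝ (fun z => chartMul N (extChartAt 𝓘(ℝ, E) (1 : N) 1, z))
      (extChartAt 𝓘(ℝ, E) (1 : N) 1) = ContinuousLinearMap.id ℝ E := by
    have : (fun z => chartMul N (extChartAt 𝓘(ℝ, E) (1 : N) 1, z))
        =ᶠ[𝓝 (extChartAt 𝓘(ℝ, E) (1 : N) 1)] id := by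
      filter_upwards [htgt] with z hz using chartMul_left_one hz
    rw [this.fderiv_eq, fderiv_id]
  have p10 : fderiv ℝ (fun z => chartMul N (z, extChartAt 𝓘(ℝ, E) (1 : N) 1))
      (extChartAt 𝓘(ℝ, E) (1 : N) 1) = ContinuousLinearMap.id ℝ E := by
    have : (fun z => chartMul N (z, extChartAt 𝓘(ℝ, E) (1 : N) 1))
        =ᶠ[𝓝 (extChartAt 𝓘(ℝ, E) (1 : N) 1)] id := by
      filter_upwards [htgt] with z hz using chartMul_right_one hz
    rw [this.fderiv_eq, fderiv_id]
  have c0 : fderiv ℝ (fun z => chartConj N (extChartAt 𝓘(ℝ, E) (1 : N) 1, z))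
      (extChartAt 𝓘(ℝ, E) (1 : N) 1) = ContinuousLinearMap.id ℝ E := by
    have := e1.self_of_nhds
    rwa [p10, p20, ContinuousLinearMap.id_comp] at this
  set y₀ := extChartAt 𝓘(ℝ, E) (1 : N) 1 with hy₀
  have d1 := (hasFDerivAt_fderiv_fst hM).differentiableAt
  have d2 := (hasFDerivAt_fderiv_snd hM).differentiableAt
  have dC := (hasFDerivAt_fderiv_snd hC).differentiableAt
  refine ⟨dC, ?_⟩
  have q2 := (hΘ.hasFDerivAt.clm_comp d2.hasFDerivAt).unique
    ((hasFDerivAt_const (ContinuousLinearMap.id ℝ E) y₀).congr_of_eventuallyEq e2)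
  have q1 := (d1.hasFDerivAt.clm_comp dC.hasFDerivAt).unique
    (d2.hasFDerivAt.congr_of_eventuallyEq e1)
  have r2 : ∀ a b, fderiv ℝ (fun y => fderiv ℝ (fun z => chartMul N (y, z)) y₀) y₀ a b
      + fderiv ℝ (mcForm (1 : N)) y₀ a b = 0 := by
    intro a b
    have := congrArg (fun f => f a b) q2
    simpa [p20, hΘ0] using this
  have r1 : ∀ a b, fderiv ℝ (fun y => fderiv ℝ (fun z => chartConj N (y, z)) y₀) y₀ a b
      + fderiv ℝ (fun y => fderiv ℝ (fun z => chartMul N (z, y)) y₀) y₀ a b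
      = fderiv ℝ (fun y => fderiv ℝ (fun z => chartMul N (y, z)) y₀) y₀ a b := by
    intro a b
    have := congrArg (fun f => f a b) q1
    simpa [p10, c0] using this
  have s := fderiv_fderiv_snd_eq_fst hM w v
  rw [eq_sub_of_add_eq (r1 v w), ← s, eq_neg_of_add_eq_zero_left (r2 v w),
    eq_neg_of_add_eq_zero_left (r2 w v)]
  simp only [ContinuousLinearMap.id_apply] at hmc
  rw [← neg_eq_iff_eq_neg.mpr hmc]
  abel

/-- The derivative of the adjoint representation is the Lie bracket. -/
lemma hasDerivAt_groupAd {g : ℝ → N} {c : ℝ → E} {v : E} {t : ℝ} (hc : HasDerivAt c v t)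
    (hct : c t = extChartAt 𝓘(ℝ, E) (1 : N) 1)
    (hg : ∀ᶠ τ in 𝓝 t, g τ = (extChartAt 𝓘(ℝ, E) (1 : N)).symm (c τ)) (w : E) :
    HasDerivAt (fun τ => groupAd E (g τ) w) (groupBracket N v w) t := by
  obtain ⟨h1, h2⟩ := fderiv_chartConj_fderiv (N := N) v w
  rw [← h2]
  rw [← hct] at h1
  have h3 := (h1.hasFDerivAt.comp_hasDerivAt t hc).clm_apply (hasDerivAt_const t w)
  rw [map_zero, add_zero, hct] at h3
  refine h3.congr_of_eventuallyEq ?_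
  filter_upwards [hg] with τ hτ
  rw [hτ, groupAd_eq_fderiv]
  rfl

end Adjoint

/-! ### From the nilpotent group to the nilpotent Lie algebra. -/

section DerivAtOne

/-- The iterated commutator `h ↦ ⁅g₁, ⁅g₂, … ⁅gₖ, h⁆⁆⁆`. -/
def iteratedCommutator {N : Type*} [Group N] (l : List N) (h : N) : N :=
  l.foldr (fun g x => g * x * g⁻¹ * x⁻¹) h

lemma iteratedCommutator_mem {N : Type*} [Group N] (l : List N) (h : N) :
    iteratedCommutator l h ∈ Subgroup.lowerCentralSeries (⊤ : Subgroup N) l.length := by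
  induction l with
  | nil => simp
  | cons g l ih =>
    rw [List.length_cons, Subgroup.lowerCentralSeries_succ, Subgroup.commutator_comm]
    exact Subgroup.commutator_mem_commutator (Subgroup.mem_top g) ih

lemma iteratedCommutator_one {N : Type*} [Group N] (l : List N) :
    iteratedCommutator l (1 : N) = 1 := by
  induction l with
  | nil => rfl
  | cons g l ih =>
    change g * iteratedCommutator l 1 * g⁻¹ * (iteratedCommutator l 1)⁻¹ = 1
    simp [ih]

variable {E : Type*} [NormedAddCommGroup E] [NormedSpace ℝ E]
  {N : Type*} [TopologicalSpace N] [ChartedSpace E N] [Group N]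

lemma derivAtOne_const : derivAtOne E (fun _ : N => (1 : N)) = 0 := mfderiv_const

variable [LieGroup 𝓘(ℝ, E) ∞ N]

lemma differentiableAt_writtenAtOne {f : N → N} (hf : ContMDiffAt 𝓘(ℝ, E) 𝓘(ℝ, E) ∞ f 1)
    (h1 : f 1 = 1) :
    DifferentiableAt ℝ (fun z => extChartAt 𝓘(ℝ, E) (1 : N)
      (f ((extChartAt 𝓘(ℝ, E) (1 : N)).symm z))) (extChartAt 𝓘(ℝ, E) (1 : N) 1) := by
  refine ContDiffAt.differentiableAt (n := ∞) ?_ (by simp)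
  rw [← contMDiffAt_iff_contDiffAt]
  have h2 := contMDiffAt_extChartAt_symm_of_mem
    (mem_extChartAt_target (I := 𝓘(ℝ, E)) (1 : N))
  refine ContMDiffAt.comp (I' := 𝓘(ℝ, E)) _ ?_ (ContMDiffAt.comp (I' := 𝓘(ℝ, E)) _ ?_ h2)
  · simp only [extChartAt_to_inv, h1]
    exact contMDiffAt_extChartAt
  · simpa only [extChartAt_to_inv] using hf

lemma eventually_extChartAt_symm_writtenAtOne {f : N → N}
    (hf : ContMDiffAt 𝓘(ℝ, E) 𝓘(ℝ, E) ∞ f 1) (h1 : f 1 = 1) :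
    ∀ᶠ z in 𝓝 (extChartAt 𝓘(ℝ, E) (1 : N) 1), (extChartAt 𝓘(ℝ, E) (1 : N)).symm
      (extChartAt 𝓘(ℝ, E) (1 : N) (f ((extChartAt 𝓘(ℝ, E) (1 : N)).symm z)))
      = f ((extChartAt 𝓘(ℝ, E) (1 : N)).symm z) := by
  have h2 := contMDiffAt_extChartAt_symm_of_mem
    (mem_extChartAt_target (I := 𝓘(ℝ, E)) (1 : N))
  have h3 : ContinuousAt (fun z => f ((extChartAt 𝓘(ℝ, E) (1 : N)).symm z))
      (extChartAt 𝓘(ℝ, E) (1 : N) 1) := by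
    refine ContinuousAt.comp ?_ h2.continuousAt
    simpa only [extChartAt_to_inv] using hf.continuousAt
  have h4 := h3.eventually ((isOpen_extChartAt_source (I := 𝓘(ℝ, E)) (1 : N)).mem_nhds (by
    simp only [extChartAt_to_inv, h1]; exact mem_extChartAt_source 1))
  filter_upwards [h4] with z hz using (extChartAt 𝓘(ℝ, E) (1 : N)).left_inv hz

lemma fderiv_chartMul_one (u w : E) :
    fderiv ℝ (chartMul (E := E) N) (extChartAt 𝓘(ℝ, E) (1 : N) 1, extChartAt 𝓘(ℝ, E) (1 : N) 1)
      (u, w) = u + w := by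
  have htgt := (isOpen_extChartAt_target (I := 𝓘(ℝ, E)) (1 : N)).mem_nhds
    (mem_extChartAt_target (I := 𝓘(ℝ, E)) (1 : N))
  have hd : DifferentiableAt ℝ (chartMul (E := E) N) (extChartAt 𝓘(ℝ, E) (1 : N) 1,
      extChartAt 𝓘(ℝ, E) (1 : N) 1) := contDiffAt_chartMul.differentiableAt (by simp)
  set y₀ := extChartAt 𝓘(ℝ, E) (1 : N) 1 with hy₀
  have h1 : HasFDerivAt (fun z => chartMul N (z, y₀)) (ContinuousLinearMap.id ℝ E) y₀ := by
    refine (hasFDerivAt_id y₀).congr_of_eventuallyEq ?_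
    filter_upwards [htgt] with z hz using chartMul_right_one hz
  have h2 : HasFDerivAt (fun z => chartMul N (y₀, z)) (ContinuousLinearMap.id ℝ E) y₀ := by
    refine (hasFDerivAt_id y₀).congr_of_eventuallyEq ?_
    filter_upwards [htgt] with z hz using chartMul_left_one hz
  have h3 := (HasFDerivAt.comp (g := chartMul N) (f := fun z => (z, y₀)) y₀ hd.hasFDerivAt
    (hasFDerivAt_prodMk_left y₀ y₀)).unique h1
  have h4 := (HasFDerivAt.comp (g := chartMul N) (f := fun z => (y₀, z)) y₀ hd.hasFDerivAt
    (hasFDerivAt_prodMk_right y₀ y₀)).unique h2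
  have h5 := congrArg (fun f => f u) h3
  have h6 := congrArg (fun f => f w) h4
  simp only [ContinuousLinearMap.comp_apply, ContinuousLinearMap.inl_apply,
    ContinuousLinearMap.inr_apply, ContinuousLinearMap.id_apply] at h5 h6
  rw [← h5, ← h6, ← map_add, h5, h6]
  simp

lemma derivAtOne_mul {f g : N → N} (hf : ContMDiffAt 𝓘(ℝ, E) 𝓘(ℝ, E) ∞ f 1)
    (hg : ContMDiffAt 𝓘(ℝ, E) 𝓘(ℝ, E) ∞ g 1) (hf1 : f 1 = 1) (hg1 : g 1 = 1) :
    derivAtOne E (fun h => f h * g h) = derivAtOne E f + derivAtOne E g := by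
  have hfg : ContMDiffAt 𝓘(ℝ, E) 𝓘(ℝ, E) ∞ (fun h => f h * g h) 1 := hf.mul hg
  rw [derivAtOne_eq_fderiv hfg (by simp [hf1, hg1]), derivAtOne_eq_fderiv hf hf1,
    derivAtOne_eq_fderiv hg hg1]
  have h1 : (fun z => extChartAt 𝓘(ℝ, E) (1 : N) (f ((extChartAt 𝓘(ℝ, E) (1 : N)).symm z)
      * g ((extChartAt 𝓘(ℝ, E) (1 : N)).symm z))) =ᶠ[𝓝 (extChartAt 𝓘(ℝ, E) (1 : N) 1)]
      fun z => chartMul N (extChartAt 𝓘(ℝ, E) (1 : N) (f ((extChartAt 𝓘(ℝ, E) (1 : N)).symm z)),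
        extChartAt 𝓘(ℝ, E) (1 : N) (g ((extChartAt 𝓘(ℝ, E) (1 : N)).symm z))) := by
    filter_upwards [eventually_extChartAt_symm_writtenAtOne hf hf1,
      eventually_extChartAt_symm_writtenAtOne hg hg1] with z h1 h2
    rw [chartMul, h1, h2]
  have h2 := (differentiableAt_writtenAtOne hf hf1).hasFDerivAt.prodMk
    (differentiableAt_writtenAtOne hg hg1).hasFDerivAt
  have hd : HasFDerivAt (chartMul (E := E) N)
      (fderiv ℝ (chartMul (E := E) N) (extChartAt 𝓘(ℝ, E) (1 : N) 1, extChartAt 𝓘(ℝ, E) (1 : N) 1))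
      (extChartAt 𝓘(ℝ, E) (1 : N) (f ((extChartAt 𝓘(ℝ, E) (1 : N)).symm
          (extChartAt 𝓘(ℝ, E) (1 : N) 1))),
        extChartAt 𝓘(ℝ, E) (1 : N) (g ((extChartAt 𝓘(ℝ, E) (1 : N)).symm
          (extChartAt 𝓘(ℝ, E) (1 : N) 1)))) := by
    simp only [extChartAt_to_inv, hf1, hg1]
    exact (contDiffAt_chartMul.differentiableAt (by simp)).hasFDerivAt
  have h3 := HasFDerivAt.comp (extChartAt 𝓘(ℝ, E) (1 : N) 1) hd h2
  have h4 := (h3.congr_of_eventuallyEq h1).fderiv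
  rw [h4]
  ext w
  simp only [ContinuousLinearMap.comp_apply, ContinuousLinearMap.prod_apply,
    fderiv_chartMul_one, add_apply]

lemma derivAtOne_inv {f : N → N} (hf : ContMDiffAt 𝓘(ℝ, E) 𝓘(ℝ, E) ∞ f 1) (hf1 : f 1 = 1) :
    derivAtOne E (fun h => (f h)⁻¹) = -derivAtOne E f := by
  have h := derivAtOne_mul (E := E) hf hf.inv hf1 (by simp [hf1])
  simp only [mul_inv_cancel, derivAtOne_const] at h
  exact (neg_eq_of_add_eq_zero_right h.symm).symm

lemma contMDiff_iteratedCommutator (l : List N) :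
    ContMDiff 𝓘(ℝ, E) 𝓘(ℝ, E) ∞ (iteratedCommutator l) := by
  induction l with
  | nil => exact contMDiff_id
  | cons g l ih =>
    exact ((contMDiff_const.mul ih).mul contMDiff_const).mul ih.inv

/-- The map x ↦ g x g⁻¹ x⁻¹ has derivative Ad g - 1 at the identity, and iterating it multiplies the
derivatives. -/
lemma derivAtOne_iteratedCommutator (l : List N) :
    derivAtOne E (iteratedCommutator l) = (l.map fun g => groupAd E g - 1).prod := by
  induction l with
  | nil => exact derivAtOne_id
  | cons g l ih =>
    have hc := (contMDiff_iteratedCommutator (E := E) l).contMDiffAt (x := 1)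
    have h1 : iteratedCommutator (g :: l) = fun h =>
        ((fun h => g * h * g⁻¹) ∘ iteratedCommutator l) h * (iteratedCommutator l h)⁻¹ := rfl
    have hconj := (contMDiff_conj (E := E) g).contMDiffAt (x := 1)
    have hcomp : ContMDiffAt 𝓘(ℝ, E) 𝓘(ℝ, E) ∞
        ((fun h => g * h * g⁻¹) ∘ iteratedCommutator l) 1 :=
      ((contMDiff_conj (E := E) g).comp (contMDiff_iteratedCommutator (E := E) l)).contMDiffAt
    have hinv : ContMDiffAt 𝓘(ℝ, E) 𝓘(ℝ, E) ∞ (fun h => (iteratedCommutator l h)⁻¹) 1 := hc.inv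
    rw [h1, derivAtOne_mul hcomp hinv (by simp [iteratedCommutator_one])
      (by simp [iteratedCommutator_one]), derivAtOne_inv hc (iteratedCommutator_one l),
      derivAtOne_comp hconj hc (iteratedCommutator_one l), List.map_cons, List.prod_cons, ih,
      sub_mul, one_mul, sub_eq_add_neg]
    rfl

lemma exists_prod_groupAd_sub_one_eq_zero [Group.IsNilpotent N] :
    ∃ c : ℕ, ∀ l : List N, l.length = c → (l.map fun g => groupAd E g - 1).prod = 0 := by
  obtain ⟨c, hc⟩ := Subgroup.nilpotent_iff_lowerCentralSeries.mp ‹_›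
  refine ⟨c, fun l hl => ?_⟩
  have h : iteratedCommutator l = fun _ : N => (1 : N) := by
    ext h
    have := iteratedCommutator_mem l h
    rw [hl, hc] at this
    simpa using this
  rw [← derivAtOne_iteratedCommutator, h, derivAtOne_const]

variable [CompleteSpace E] [LieGroup 𝓘(ℝ, E) (minSmoothness ℝ 3) N]

/-- The curve `τ ↦ φ⁻¹ (φ 1 + τ v)` through `1`, for the chart `φ` at `1`. -/
def chartLine (N : Type*) [TopologicalSpace N] [ChartedSpace E N] [Group N] (v : E) (τ : ℝ) : N :=
  (extChartAt 𝓘(ℝ, E) (1 : N)).symm (extChartAt 𝓘(ℝ, E) (1 : N) 1 + τ • v)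

lemma hasDerivAt_groupAd_chartLine (v w : E) :
    HasDerivAt (fun τ => groupAd E (chartLine N v τ) w) (groupBracket N v w) 0 := by
  refine hasDerivAt_groupAd (c := fun τ : ℝ => extChartAt 𝓘(ℝ, E) (1 : N) 1 + τ • v) ?_
    (by simp) (Eventually.of_forall fun τ => rfl) w
  simpa using ((hasDerivAt_id (0 : ℝ)).smul_const v).const_add (extChartAt 𝓘(ℝ, E) (1 : N) 1)

lemma apply_groupBracket_eq_zero (f : E →L[ℝ] E) {v w : E}
    (h : ∀ τ, f ((groupAd E (chartLine N v τ) - 1) w) = 0) : f (groupBracket N v w) = 0 := by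
  have h1 := (hasDerivAt_groupAd_chartLine (N := N) v w).sub_const w
  have h2 := f.hasFDerivAt.comp_hasDerivAt 0 h1
  exact h2.unique ((hasDerivAt_const (0 : ℝ) (0 : E)).congr_of_eventuallyEq
    (Eventually.of_forall h))

/-- The Lie algebra of a nilpotent Lie group is nilpotent. -/
lemma isNilpotent_groupLieAlgebra [Group.IsNilpotent N] :
    LieRing.IsNilpotent (GroupLieAlgebra 𝓘(ℝ, E) N) := by
  obtain ⟨c, hc⟩ := exists_prod_groupAd_sub_one_eq_zero (E := E) (N := N)
  -- A bracket with v is the derivative of one factor Ad g - 1 along a line in the direction v. Each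
  -- step down the lower central series therefore replaces one group element in a vanishing product
  -- of length `c`.
  have key : ∀ k, ∀ x ∈ LieModule.lowerCentralSeries ℝ (GroupLieAlgebra 𝓘(ℝ, E) N)
      (GroupLieAlgebra 𝓘(ℝ, E) N) k, ∀ l : List N, l.length + k = c →
      (l.map fun g => groupAd E g - 1).prod (x : E) = 0 := by
    intro k
    induction k with
    | zero => intro x _ l hl; rw [hc l (by simpa using hl)]; rfl
    | succ k ih =>
      intro x hx l hl
      rw [LieModule.lowerCentralSeries_succ, ← LieSubmodule.mem_toSubmodule,
        LieSubmodule.lieIdeal_oper_eq_linear_span'] at hx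
      obtain ⟨P, hP⟩ : ∃ P : E →L[ℝ] E, P = (l.map fun g => groupAd E g - 1).prod := ⟨_, rfl⟩
      have hP' : ∀ v m : E, (∀ τ, P ((groupAd E (chartLine N v τ) - 1) m) = 0) →
          P (groupBracket N v m) = 0 := fun v m h => apply_groupBracket_eq_zero (N := N) P h
      rw [← hP]
      refine Submodule.span_induction (p := fun (y : GroupLieAlgebra 𝓘(ℝ, E) N) _ =>
        P (y : E) = 0) ?_ ?_ ?_ ?_ hx
      · rintro _ ⟨v, -, m, hm, rfl⟩
        refine hP' v m fun τ => ?_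
        have := ih m hm (l ++ [chartLine (E := E) N v τ]) (by simp; omega)
        rw [List.map_append, List.prod_append, ← hP, List.map_singleton, List.prod_singleton] at this
        exact this
      · exact map_zero _
      · intro a b _ _ ha hb; exact (map_add _ _ _).trans (by rw [ha, hb, add_zero])
      · intro r a _ ha; exact (map_smul _ _ _).trans (by rw [ha, smul_zero])
  refine LieModule.IsNilpotent.mk (R := ℝ) (L := GroupLieAlgebra 𝓘(ℝ, E) N)
    (M := GroupLieAlgebra 𝓘(ℝ, E) N) (k := c) ?_
  rw [LieSubmodule.eq_bot_iff]
  intro x hx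
  exact key c x hx [] (by simp)

/-- The derivative of a smooth automorphism is an automorphism of the Lie algebra. -/
lemma derivAtOne_groupBracket (a : N →* N) (ha : ContMDiff 𝓘(ℝ, E) 𝓘(ℝ, E) ∞ a) (v w : E) :
    derivAtOne E a (groupBracket N v w) =
      groupBracket N (derivAtOne E a v) (derivAtOne E a w) := by
  have h1 := (derivAtOne E a).hasFDerivAt.comp_hasDerivAt 0
    (hasDerivAt_groupAd_chartLine (N := N) v w)
  have hl : HasDerivAt (fun τ : ℝ => extChartAt 𝓘(ℝ, E) (1 : N) 1 + τ • v) v 0 := by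
    simpa using ((hasDerivAt_id (0 : ℝ)).smul_const v).const_add (extChartAt 𝓘(ℝ, E) (1 : N) 1)
  have hd := differentiableAt_writtenAtOne ha.contMDiffAt (map_one a)
  have he := derivAtOne_eq_fderiv (E := E) ha.contMDiffAt (map_one a)
  have h2 := HasFDerivAt.comp_hasDerivAt_of_eq (0 : ℝ) hd.hasFDerivAt hl (by simp)
  rw [← he] at h2
  have h3 := hasDerivAt_groupAd (N := N) (g := fun τ => a (chartLine N v τ)) h2
    (by simp) ?_ (derivAtOne E a w)
  · refine h1.unique (h3.congr_of_eventuallyEq (Eventually.of_forall fun τ => ?_))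
    -- Conjugation is compatible with automorphisms; differentiating this at the identity, and
    -- afterwards in τ, gives compatibility with brackets.
    have h4 : (a : N → N) ∘ (fun h => chartLine N v τ * h * (chartLine N v τ)⁻¹)
      = (fun h => a (chartLine N v τ) * h * (a (chartLine N v τ))⁻¹) ∘ a := by
      ext h; simp
    have h5 := congrArg (derivAtOne E) h4
    rw [derivAtOne_comp ha.contMDiffAt (contMDiff_conj _).contMDiffAt (by simp),
      derivAtOne_comp (contMDiff_conj _).contMDiffAt ha.contMDiffAt (by simp)] at h5
    exact congrArg (fun f => f w) h5
  · have h6 := eventually_extChartAt_symm_writtenAtOne ha.contMDiffAt (map_one a)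
    have h7 := hl.continuousAt.tendsto
    simp only [zero_smul, add_zero] at h7
    filter_upwards [h7.eventually h6] with τ hτ
    exact hτ.symm

end DerivAtOne

/-- The standard Euclidean model space. -/
abbrev Euc (n : ℕ) := EuclideanSpace ℝ (Fin n)

/-! ### The infinitesimal geodesic orbit condition. -/

section Algebra

variable {L : Type*} [LieRing L] [LieAlgebra ℝ L]

/-- `D` is a derivation of `L` that is skew-symmetric for `B`. -/
structure IsSkewDerivation (B : LinearMap.BilinForm ℝ L) (D : L →ₗ[ℝ] L) : Prop where
  leibniz : ∀ x y, D ⁅x, y⁆ = ⁅D x, y⁆ + ⁅x, D y⁆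
  skew : ∀ x y, B (D x) y + B x (D y) = 0

/-- The infinitesimal geodesic orbit condition. -/
def IsAlgebraicGO (B : LinearMap.BilinForm ℝ L) : Prop :=
  ∀ T : L, ∃ D : L →ₗ[ℝ] L, IsSkewDerivation B D ∧
    ∃ k : ℝ, ∀ w, B T ⁅T, w⁆ = B (D T) w + k * B T w

end Algebra

/-! ### Euler's equation for left-invariant metrics. -/

section Geodesics

variable {n : ℕ} {N : Type*} [TopologicalSpace N] [ChartedSpace (Euc n) N] [Group N]

/-- A bilinear form on the Lie algebra, as a continuous bilinear map on the model space. -/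
def formCLM (B : LinearMap.BilinForm ℝ (GroupLieAlgebra 𝓘(ℝ, Euc n) N)) :
    Euc n →L[ℝ] Euc n →L[ℝ] ℝ :=
  LinearMap.toContinuousBilinearMap (E := Euc n) (F := Euc n) (G := ℝ) B

lemma metricInChart_leftInvMetric (B : LinearMap.BilinForm ℝ (GroupLieAlgebra 𝓘(ℝ, Euc n) N))
    (x₀ : N) (y u w : Euc n) : metricInChart (leftInvMetric B) x₀ y u w
      = formCLM B (mcForm x₀ y u) (mcForm x₀ y w) := rfl

variable [LieGroup 𝓘(ℝ, Euc n) ∞ N]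

lemma isBilinearMap_groupBracket : IsBilinearMap ℝ (groupBracket (E := Euc n) N) where
  add_left x y z := add_lie (L := GroupLieAlgebra 𝓘(ℝ, Euc n) N)
    (M := GroupLieAlgebra 𝓘(ℝ, Euc n) N) x y z
  smul_left c x y := smul_lie (L := GroupLieAlgebra 𝓘(ℝ, Euc n) N)
    (M := GroupLieAlgebra 𝓘(ℝ, Euc n) N) c x y
  add_right x y z := lie_add (L := GroupLieAlgebra 𝓘(ℝ, Euc n) N)
    (M := GroupLieAlgebra 𝓘(ℝ, Euc n) N) x y z
  smul_right c x y := lie_smul (L := GroupLieAlgebra 𝓘(ℝ, Euc n) N)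
    (M := GroupLieAlgebra 𝓘(ℝ, Euc n) N) c x y

variable (n N) in
/-- The Lie bracket, as a continuous bilinear map on the model space. -/
def bracketCLM : Euc n →L[ℝ] Euc n →L[ℝ] Euc n :=
  (isBilinearMap_groupBracket (n := n) (N := N)).toContinuousBilinearMap

lemma mcForm_surjective {x₀ : N} {y : Euc n} (hy : y ∈ (extChartAt 𝓘(ℝ, Euc n) x₀).target) :
    Function.Surjective (mcForm x₀ y) := by
  obtain ⟨e, he⟩ := isInvertible_mcForm hy
  rw [← he]; exact e.surjective

/-- The Maurer-Cartan form is invertible, so the test vector ranges over the whole Lie algebra and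
the charts disappear from the equation. -/
lemma isGeodesicOn_leftInvMetric_iff {B : LinearMap.BilinForm ℝ (GroupLieAlgebra 𝓘(ℝ, Euc n) N)}
    (hB : B.IsSymm) {γ : ℝ → N} {J : Set ℝ} (hJ : IsOpen J) :
    IsGeodesicOn (leftInvMetric B) γ J ↔
      ContMDiffOn 𝓘(ℝ, ℝ) 𝓘(ℝ, Euc n) 2 γ J ∧ ∀ t ∈ J,
        DifferentiableAt ℝ (bodyVelocity (Euc n) γ) t ∧
        ∀ w, formCLM B (deriv (bodyVelocity (Euc n) γ) t) w =
          formCLM B (bodyVelocity (Euc n) γ t) (groupBracket N (bodyVelocity (Euc n) γ t) w) := by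
  refine and_congr_right fun hγ => forall₂_congr fun t ht => ?_
  set c : ℝ → Euc n := fun τ => extChartAt 𝓘(ℝ, Euc n) (γ t) (γ τ) with hc
  have hct : c t = extChartAt 𝓘(ℝ, Euc n) (γ t) (γ t) := rfl
  have hγt : ContMDiffAt 𝓘(ℝ, ℝ) 𝓘(ℝ, Euc n) 2 γ t := hγ.contMDiffAt (hJ.mem_nhds ht)
  have hM : IsManifold 𝓘(ℝ, Euc n) 2 N := IsManifold.of_le (n := ∞)
    (WithTop.coe_le_coe.mpr le_top)
  have hc2 : ContDiffAt ℝ 2 c t := by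
    rw [← contMDiffAt_iff_contDiffAt]
    exact ContMDiffAt.comp t contMDiffAt_extChartAt hγt
  have hd1 : ∀ᶠ τ in 𝓝 t, HasDerivAt c (deriv c τ) τ := by
    filter_upwards [hc2.eventually (by simp)] with τ hτ
    exact (hτ.differentiableAt (by simp)).hasDerivAt
  have hd2 : HasDerivAt (deriv c) (deriv (deriv c) t) t := by
    refine DifferentiableAt.hasDerivAt ?_
    have h1 : ContDiffAt ℝ 1 (fderiv ℝ c) t := hc2.fderiv_right (by norm_num)
    have h2 : deriv c = fun τ => fderiv ℝ c τ 1 := by ext1 τ; exact fderiv_apply_one_eq_deriv.symm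
    rw [h2]
    exact (h1.differentiableAt (by simp)).clm_apply (differentiableAt_const _)
  have hsym : ∀ᶠ τ in 𝓝 t, γ τ = (extChartAt 𝓘(ℝ, Euc n) (γ t)).symm (c τ) := by
    filter_upwards [hγt.continuousAt.eventually ((isOpen_extChartAt_source
      (I := 𝓘(ℝ, Euc n)) (γ t)).mem_nhds (mem_extChartAt_source (γ t)))] with τ hτ
    exact ((extChartAt 𝓘(ℝ, Euc n) (γ t)).left_inv hτ).symm
  have htg : c t ∈ (extChartAt 𝓘(ℝ, Euc n) (γ t)).target := mem_extChartAt_target (γ t)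
  have hV := bodyVelocity_eq (hd1.self_of_nhds) htg hsym
  have hV' := hasDerivAt_bodyVelocity hd1 hd2 htg hsym
  have key : ∀ w, _ := fun w => geodesic_expression_eq (formCLM B) (fun x y => hB.eq x y) (γ t)
    (deriv c t) (deriv (deriv c) t) w
  simp only [metricInChart_leftInvMetric]
  rw [← hct] at key
  rw [← hV, ← hV'.deriv] at key
  constructor
  · intro h
    refine ⟨hV'.differentiableAt, fun w => ?_⟩
    obtain ⟨z, rfl⟩ := mcForm_surjective htg w
    have h1 := h z
    rw [hV] at key
    rw [key z, sub_eq_zero] at h1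
    rw [hV]; exact h1
  · rintro ⟨-, h⟩ w
    have h1 := key w
    rw [hV] at h1 h
    rw [h1, sub_eq_zero]
    exact h _

end Geodesics

/-! ### Regularity and local existence of geodesics. -/

section Bootstrap

variable {E F : Type*} [NormedAddCommGroup E] [NormedSpace ℝ E]

/-- The existence theorem for differential equations yields only a differentiable curve; the higher
regularity is recovered by substituting the equation into itself. -/
lemma contDiffOn_of_hasDerivAt_autonomous {f : E → E} {U : Set E} {p : ℝ → E} {J : Set ℝ}
    (hJ : IsOpen J) (hf : ContDiffOn ℝ ∞ f U) (hpU : ∀ t ∈ J, p t ∈ U)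
    (hp : ∀ t ∈ J, HasDerivAt p (f (p t)) t) (m : ℕ) : ContDiffOn ℝ m p J := by
  induction m with
  | zero =>
    exact contDiffOn_zero.mpr fun t ht => (hp t ht).continuousAt.continuousWithinAt
  | succ m ih =>
    rw [Nat.cast_add, Nat.cast_one, contDiffOn_succ_iff_deriv_of_isOpen hJ]
    refine ⟨fun t ht => (hp t ht).differentiableAt.differentiableWithinAt, by simp, ?_⟩
    exact ((hf.of_le (by exact_mod_cast le_top)).comp ih hpU).congr fun t ht => (hp t ht).deriv

end Bootstrap

section Existence

variable {n : ℕ} {N : Type*} [TopologicalSpace N] [ChartedSpace (Euc n) N] [Group N]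
  [LieGroup 𝓘(ℝ, Euc n) ∞ N]

lemma exists_geodesicField {B : LinearMap.BilinForm ℝ (GroupLieAlgebra 𝓘(ℝ, Euc n) N)}
    (hB : B.Nondegenerate) : ∃ F : Euc n → Euc n, ContDiff ℝ ∞ F ∧
      ∀ V w, formCLM B (F V) w = formCLM B V (groupBracket N V w) := by
  let B' : LinearMap.BilinForm ℝ (Euc n) := B
  have hB' : B'.Nondegenerate := hB
  let S₀ : (Euc n →L[ℝ] ℝ) →ₗ[ℝ] Euc n :=
    (LinearMap.BilinForm.toDual B' hB').symm.toLinearMap ∘ₗ ContinuousLinearMap.coeLM ℝ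
  have hS : ∀ f w, formCLM B (S₀ f) w = f w := fun f w =>
    LinearMap.BilinForm.apply_toDual_symm_apply (B := B') (hB := hB') (f : Euc n →ₗ[ℝ] ℝ) w
  let S : (Euc n →L[ℝ] ℝ) →L[ℝ] Euc n := S₀.toContinuousLinearMap
  refine ⟨fun V => S ((formCLM B V).comp (bracketCLM n N V)), ?_, fun V w => hS _ w⟩
  exact S.contDiff.comp ((formCLM B).contDiff.clm_comp (bracketCLM n N).contDiff)

/-- Euler's equation decouples: V' = F(V) lives on the Lie algebra, and the curve is recovered from
y' = Θ_y⁻¹ V, where Θ is the Maurer-Cartan form. A short interval suffices, because the geodesic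
orbit property speaks of geodesics on arbitrary intervals. -/
lemma exists_isGeodesicOn {B : LinearMap.BilinForm ℝ (GroupLieAlgebra 𝓘(ℝ, Euc n) N)}
    (hsymm : B.IsSymm) (hB : B.Nondegenerate) (T : Euc n) :
    ∃ ε > 0, ∃ γ : ℝ → N, IsGeodesicOn (leftInvMetric B) γ (Ioo (-ε) ε) ∧
      bodyVelocity (Euc n) γ 0 = T := by
  obtain ⟨F, hF, hFB⟩ := exists_geodesicField hB
  set y₀ := extChartAt 𝓘(ℝ, Euc n) (1 : N) 1 with hy₀
  let U : Set (Euc n × Euc n) := (extChartAt 𝓘(ℝ, Euc n) (1 : N)).target ×ˢ univ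
  have hU : IsOpen U := (isOpen_extChartAt_target 1).prod isOpen_univ
  let f : Euc n × Euc n → Euc n × Euc n := fun p => ((mcForm (1 : N) p.1).inverse p.2, F p.2)
  have hf : ∀ p ∈ U, ContDiffAt ℝ ∞ f p := by
    rintro ⟨y, V⟩ ⟨hy, -⟩
    have h1 : ContDiffAt ℝ ∞ (fun y => (mcForm (1 : N) y).inverse) y :=
      ((isInvertible_mcForm hy).contDiffAt_map_inverse).comp y (contDiffAt_mcForm hy)
    have h2 : ContDiffAt ℝ ∞ (fun p : Euc n × Euc n => (mcForm (1 : N) p.1).inverse) (y, V) :=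
      ContDiffAt.comp (g := fun y => (mcForm (1 : N) y).inverse) (f := Prod.fst) (y, V) h1
        contDiffAt_fst
    exact (h2.clm_apply contDiffAt_snd).prodMk (hF.contDiffAt.comp (y, V) contDiffAt_snd)
  have hp₀ : (y₀, T) ∈ U := ⟨mem_extChartAt_target 1, mem_univ _⟩
  obtain ⟨p, hp0, ε₁, hε₁, hp⟩ :=
    ((hf _ hp₀).of_le (by simp) :
      ContDiffAt ℝ 1 f (y₀, T)).exists_forall_mem_closedBall_exists_eq_forall_mem_Ioo_hasDerivAt₀ 0
  simp only [zero_sub, zero_add] at hp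
  have hcont : ContinuousAt p 0 := (hp 0 ⟨by linarith, hε₁⟩).continuousAt
  have hev : ∀ᶠ t in 𝓝 (0 : ℝ), p t ∈ U :=
    hcont.eventually (by rw [hp0]; exact hU.mem_nhds hp₀)
  obtain ⟨ε₂, hε₂, hball⟩ := Metric.eventually_nhds_iff.mp hev
  refine ⟨min ε₁ ε₂, lt_min hε₁ hε₂, fun t => (extChartAt 𝓘(ℝ, Euc n) (1 : N)).symm (p t).1, ?_⟩
  set J := Ioo (-min ε₁ ε₂) (min ε₁ ε₂) with hJdef
  have hJ : IsOpen J := isOpen_Ioo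
  have hJ1 : ∀ t ∈ J, HasDerivAt p (f (p t)) t := fun t ht =>
    hp t ⟨by linarith [ht.1, min_le_left ε₁ ε₂], by linarith [ht.2, min_le_left ε₁ ε₂]⟩
  have hJ2 : ∀ t ∈ J, p t ∈ U := fun t ht => hball (by
    rw [Real.dist_eq, sub_zero, abs_lt]
    exact ⟨by linarith [ht.1, min_le_right ε₁ ε₂], by linarith [ht.2, min_le_right ε₁ ε₂]⟩)
  have hpC : ContDiffOn ℝ 2 p J := by
    simpa using contDiffOn_of_hasDerivAt_autonomous hJ
      (fun q hq => (hf q hq).contDiffWithinAt) hJ2 hJ1 2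
  have hc1 : ∀ t ∈ J, HasDerivAt (fun τ => (p τ).1) ((mcForm (1 : N) (p t).1).inverse (p t).2) t :=
    fun t ht => (hJ1 t ht).fst
  have hbody : ∀ t ∈ J, bodyVelocity (Euc n)
      (fun t => (extChartAt 𝓘(ℝ, Euc n) (1 : N)).symm (p t).1) t = (p t).2 := by
    intro t ht
    rw [bodyVelocity_eq (hc1 t ht) (hJ2 t ht).1 (Eventually.of_forall fun τ => rfl)]
    obtain ⟨e, he⟩ := isInvertible_mcForm (hJ2 t ht).1
    rw [← he, ContinuousLinearMap.inverse_equiv]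
    exact e.apply_symm_apply _
  have h0J : (0 : ℝ) ∈ J := ⟨by simp [hε₁, hε₂], by simp [hε₁, hε₂]⟩
  refine ⟨(isGeodesicOn_leftInvMetric_iff hsymm hJ).mpr ⟨?_, fun t ht => ?_⟩, ?_⟩
  · intro t ht
    have h1 : ContMDiffAt 𝓘(ℝ, ℝ) 𝓘(ℝ, Euc n) 2 (fun τ => (p τ).1) t :=
      (contDiffAt_fst.comp t (hpC.contDiffAt (hJ.mem_nhds ht))).contMDiffAt
    have h2 := ((contMDiffAt_extChartAt_symm_of_mem (hJ2 t ht).1).of_le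
      (show (2 : WithTop ℕ∞) ≤ ∞ from WithTop.coe_le_coe.mpr le_top))
    exact (ContMDiffAt.comp t h2 h1).contMDiffWithinAt
  · have h1 : bodyVelocity (Euc n) (fun t => (extChartAt 𝓘(ℝ, Euc n) (1 : N)).symm (p t).1)
        =ᶠ[𝓝 t] fun τ => (p τ).2 := by
      filter_upwards [hJ.mem_nhds ht] with τ hτ using hbody τ hτ
    have h2 : HasDerivAt (bodyVelocity (Euc n)
        (fun t => (extChartAt 𝓘(ℝ, Euc n) (1 : N)).symm (p t).1)) (F (p t).2) t :=
      HasDerivAt.congr_of_eventuallyEq (hJ1 t ht).snd h1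
    refine ⟨h2.differentiableAt, fun w => ?_⟩
    rw [h2.deriv, hFB, hbody t ht]
  · rw [hbody 0 h0J, hp0]

end Existence

/-! ### Derivatives of families of automorphisms. -/

section Families

variable {E : Type*} [NormedAddCommGroup E] [NormedSpace ℝ E]
  {N : Type*} [TopologicalSpace N] [ChartedSpace E N] [Group N] [LieGroup 𝓘(ℝ, E) ∞ N]

lemma differentiableAt_derivAtOne_family {a : ℝ → N → N}
    (ha : ContMDiff (𝓘(ℝ, ℝ).prod 𝓘(ℝ, E)) 𝓘(ℝ, E) ∞ fun p : ℝ × N => a p.1 p.2)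
    (h1 : ∀ s, a s 1 = 1) (s : ℝ) : DifferentiableAt ℝ (fun s => derivAtOne E (a s)) s := by
  have has : ∀ s, ContMDiff 𝓘(ℝ, E) 𝓘(ℝ, E) ∞ (a s) := fun s =>
    ha.comp (contMDiff_const.prodMk contMDiff_id)
  have h2 : (fun s => derivAtOne E (a s)) = fun s => fderiv ℝ (fun z => extChartAt 𝓘(ℝ, E) (1 : N)
      (a s ((extChartAt 𝓘(ℝ, E) (1 : N)).symm z))) (extChartAt 𝓘(ℝ, E) (1 : N) 1) := by
    ext1 s
    exact derivAtOne_eq_fderiv (has s).contMDiffAt (h1 s)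
  have h3 : ContDiffAt ℝ ∞ (fun p : ℝ × E => extChartAt 𝓘(ℝ, E) (1 : N)
      (a p.1 ((extChartAt 𝓘(ℝ, E) (1 : N)).symm p.2))) (s, extChartAt 𝓘(ℝ, E) (1 : N) 1) := by
    rw [← contMDiffAt_iff_contDiffAt]
    have h4 : ContMDiffAt 𝓘(ℝ, ℝ × E) 𝓘(ℝ, E) ∞
        (fun p : ℝ × E => (extChartAt 𝓘(ℝ, E) (1 : N)).symm p.2)
        (s, extChartAt 𝓘(ℝ, E) (1 : N) 1) :=
      ContMDiffAt.comp (I' := 𝓘(ℝ, E)) (_, _)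
        (contMDiffAt_extChartAt_symm_of_mem (mem_extChartAt_target 1)) contDiffAt_snd.contMDiffAt
    have h5 : ContMDiffAt 𝓘(ℝ, ℝ × E) 𝓘(ℝ, ℝ) ∞ (fun p : ℝ × E => p.1)
        (s, extChartAt 𝓘(ℝ, E) (1 : N) 1) := contDiffAt_fst.contMDiffAt
    refine ContMDiffAt.comp (I' := 𝓘(ℝ, E)) _ ?_
      (ContMDiffAt.comp (I' := 𝓘(ℝ, ℝ).prod 𝓘(ℝ, E)) _ ha.contMDiffAt (h5.prodMk h4))
    simp only [extChartAt_to_inv, h1]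
    exact contMDiffAt_extChartAt
  rw [h2]
  exact (hasFDerivAt_fderiv_snd (h3.of_le (WithTop.coe_le_coe.mpr le_top))).differentiableAt

lemma derivAtOne_comp_curve {a : N → N} (ha : ContMDiffAt 𝓘(ℝ, E) 𝓘(ℝ, E) ∞ a 1) (h1 : a 1 = 1)
    {ξ : ℝ → N} {s : ℝ} (hξ : ContMDiffAt 𝓘(ℝ, ℝ) 𝓘(ℝ, E) ∞ ξ s) (hξ1 : ξ s = 1) :
    HasDerivAt (fun r => extChartAt 𝓘(ℝ, E) (1 : N) (a (ξ r)))
      (derivAtOne E a (deriv (fun r => extChartAt 𝓘(ℝ, E) (1 : N) (ξ r)) s)) s := by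
  have h2 : DifferentiableAt ℝ (fun r => extChartAt 𝓘(ℝ, E) (1 : N) (ξ r)) s := by
    refine ContDiffAt.differentiableAt (n := ∞) ?_ (by simp)
    rw [← contMDiffAt_iff_contDiffAt]
    refine ContMDiffAt.comp (I' := 𝓘(ℝ, E)) _ ?_ hξ
    rw [hξ1]; exact contMDiffAt_extChartAt
  have h3 := (differentiableAt_writtenAtOne ha h1).hasFDerivAt
  rw [← derivAtOne_eq_fderiv ha h1] at h3
  have h4 := HasFDerivAt.comp_hasDerivAt_of_eq s h3 h2.hasDerivAt (by rw [hξ1])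
  refine h4.congr_of_eventuallyEq ?_
  filter_upwards [hξ.continuousAt.eventually ((isOpen_extChartAt_source
    (I := 𝓘(ℝ, E)) (1 : N)).mem_nhds (by rw [hξ1]; exact mem_extChartAt_source 1))] with r hr
  simp only [Function.comp, (extChartAt 𝓘(ℝ, E) (1 : N)).left_inv hr]

end Families

section SkewDerivations

variable {L : Type*} [LieRing L] [LieAlgebra ℝ L]

lemma IsSkewDerivation.smul {B : LinearMap.BilinForm ℝ L} {D : L →ₗ[ℝ] L}
    (h : IsSkewDerivation B D) (c : ℝ) : IsSkewDerivation B (c • D) where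
  leibniz x y := by simp [h.leibniz]
  skew x y := by simp [← mul_add, h.skew]

lemma IsSkewDerivation.zero (B : LinearMap.BilinForm ℝ L) : IsSkewDerivation B 0 where
  leibniz x y := by simp
  skew x y := by simp

variable {n : ℕ} {N : Type*} [TopologicalSpace N] [ChartedSpace (Euc n) N] [Group N]
  [LieGroup 𝓘(ℝ, Euc n) ∞ N]

/-- Both properties are the derivative at 0 of the invariance of bracket and form under `R s`. -/
lemma isSkewDerivation_of_hasDerivAt {B : LinearMap.BilinForm ℝ (GroupLieAlgebra 𝓘(ℝ, Euc n) N)}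
    {R : ℝ → Euc n →L[ℝ] Euc n} (h0 : ∀ v, R 0 v = v)
    (hR : ∀ s v w, R s (groupBracket N v w) = groupBracket N (R s v) (R s w))
    (hRB : ∀ s v w, formCLM B (R s v) (R s w) = formCLM B v w)
    {D : GroupLieAlgebra 𝓘(ℝ, Euc n) N →ₗ[ℝ] GroupLieAlgebra 𝓘(ℝ, Euc n) N}
    (hD : ∀ v : Euc n, HasDerivAt (F := Euc n) (fun s => R s v) (D v) 0) :
    IsSkewDerivation B D where
  leibniz := by
    have key : ∀ D' : Euc n → Euc n, (∀ v, HasDerivAt (fun s => R s v) (D' v) 0) → ∀ x y,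
        D' (groupBracket N x y) = groupBracket N (D' x) y + groupBracket N x (D' y) := by
      intro D' hD x y
      have h1 := hD (groupBracket N x y)
      have h2 := ((bracketCLM n N).hasFDerivAt.comp_hasDerivAt (0 : ℝ) (hD x)).clm_apply (hD y)
      simp only [Function.comp_def, h0] at h2
      exact h1.unique (h2.congr_of_eventuallyEq (Eventually.of_forall fun s => hR s x y))
    exact key D hD
  skew := by
    have key : ∀ D' : Euc n → Euc n, (∀ v, HasDerivAt (fun s => R s v) (D' v) 0) → ∀ x y,
        formCLM B (D' x) y + formCLM B x (D' y) = 0 := by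
      intro D' hD x y
      have h2 := ((formCLM B).hasFDerivAt.comp_hasDerivAt (0 : ℝ) (hD x)).clm_apply (hD y)
      simp only [Function.comp_def, h0] at h2
      exact h2.unique ((hasDerivAt_const (0 : ℝ) (formCLM B x y)).congr_of_eventuallyEq
        (Eventually.of_forall fun s => hRB s x y))
    exact key D hD

/-- Elements of the isotropy algebra are skew-symmetric derivations. -/
lemma isSkewDerivation_of_mem_isotropyAlgebra {H : Subgroup (MulAut N)}
    {B : LinearMap.BilinForm ℝ (GroupLieAlgebra 𝓘(ℝ, Euc n) N)} (hGO : IsGONilmanifold B H)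
    {D : GroupLieAlgebra 𝓘(ℝ, Euc n) N →ₗ[ℝ] GroupLieAlgebra 𝓘(ℝ, Euc n) N}
    (hD : D ∈ isotropyAlgebra n H) : IsSkewDerivation B D := by
  obtain ⟨a, -, ha⟩ := hD
  refine isSkewDerivation_of_hasDerivAt
    (R := fun t => derivAtOne (Euc n) fun y : N => (a (Multiplicative.ofAdd t) : MulAut N) y)
    (fun v => ?_) (fun s v w => ?_) (fun s v w => ?_) ha
  · have : (fun y : N => (a (Multiplicative.ofAdd 0) : MulAut N) y) = id := by
      ext y; simp
    rw [this, derivAtOne_id]; rfl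
  · exact derivAtOne_groupBracket ((a (Multiplicative.ofAdd s) : MulAut N) : N →* N)
      (hGO.smooth _ (a (Multiplicative.ofAdd s)).2) v w
  · exact hGO.isometric _ (a (Multiplicative.ofAdd s)).2 v w

end SkewDerivations

/-! ### From orbits to the infinitesimal condition. -/

section GeodesicOrbit

variable {n : ℕ} {N : Type*} [Group N]
  {H : Subgroup (MulAut N)} (φ : Multiplicative ℝ →* N ⋊[H.subtype] H)

/-- The automorphism part of a one-parameter subgroup of `N ⋊ H`. -/
def autPart (s : ℝ) : MulAut N := (φ (Multiplicative.ofAdd s)).right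

lemma autPart_add (s r : ℝ) : autPart φ (s + r) = autPart φ s * autPart φ r := by
  simp [autPart]

lemma autPart_zero : autPart φ 0 = 1 := by
  simp [autPart]

lemma semidirectAct_add (s r : ℝ) (x : N) :
    semidirectAct (φ (Multiplicative.ofAdd (s + r))) x =
      (φ (Multiplicative.ofAdd s)).left *
        autPart φ s (semidirectAct (φ (Multiplicative.ofAdd r)) x) := by
  simp [semidirectAct, autPart, mul_assoc]

/-- Left translation back to the identity cancels the translational part, so the body velocity of an
orbit is moved by the automorphism part alone. -/
lemma inv_mul_semidirectAct (s r : ℝ) (x : N) :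
    (semidirectAct (φ (Multiplicative.ofAdd s)) x)⁻¹ *
      semidirectAct (φ (Multiplicative.ofAdd (s + r))) x =
      autPart φ s (x⁻¹ * semidirectAct (φ (Multiplicative.ofAdd r)) x) := by
  rw [semidirectAct_add]
  simp only [semidirectAct, autPart, map_mul, map_inv]
  group

variable [TopologicalSpace N] [ChartedSpace (Euc n) N] [LieGroup 𝓘(ℝ, Euc n) ∞ N]

/-- Only the action on N is assumed smooth; the automorphism part is recovered from it as (φ_s ·
1)⁻¹ (φ_s · y). -/
lemma contMDiff_autPart (hφ : IsOneParameterSubgroup n φ) :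
    ContMDiff (𝓘(ℝ, ℝ).prod 𝓘(ℝ, Euc n)) 𝓘(ℝ, Euc n) ∞
      fun p : ℝ × N => autPart φ p.1 p.2 := by
  have h1 : ContMDiff (𝓘(ℝ, ℝ).prod 𝓘(ℝ, Euc n)) 𝓘(ℝ, Euc n) ∞
      fun p : ℝ × N => semidirectAct (φ (Multiplicative.ofAdd p.1)) 1 :=
    hφ.comp (contMDiff_fst.prodMk contMDiff_const)
  have h2 := h1.inv.mul hφ
  convert h2 using 1
  ext p
  simp [semidirectAct, autPart]

lemma bodyVelocity_orbit (hφ : IsOneParameterSubgroup n φ) {x : N} {γ : ℝ → N} {σ : ℝ → ℝ}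
    {J : Set ℝ} (hJ : IsOpen J) (hσ : ContDiffOn ℝ ∞ σ J)
    (hγ : ∀ t ∈ J, γ t = semidirectAct (φ (Multiplicative.ofAdd (σ t))) x) {t : ℝ} (ht : t ∈ J) :
    bodyVelocity (Euc n) γ t = deriv σ t • derivAtOne (Euc n) (autPart φ (σ t))
      (deriv (fun r => extChartAt 𝓘(ℝ, Euc n) (1 : N)
        (x⁻¹ * semidirectAct (φ (Multiplicative.ofAdd r)) x)) 0) := by
  have ha : ContMDiff 𝓘(ℝ, Euc n) 𝓘(ℝ, Euc n) ∞ (autPart φ (σ t)) :=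
    (contMDiff_autPart φ hφ).comp (contMDiff_const.prodMk contMDiff_id)
  have hξ : ContMDiff 𝓘(ℝ, ℝ) 𝓘(ℝ, Euc n) ∞
      fun r : ℝ => x⁻¹ * semidirectAct (φ (Multiplicative.ofAdd r)) x :=
    contMDiff_const.mul (hφ.comp (contMDiff_id.prodMk contMDiff_const))
  have h1 := derivAtOne_comp_curve (E := Euc n) ha.contMDiffAt (map_one _) (hξ.contMDiffAt (x := 0))
    (by simp [semidirectAct])
  have h2 : HasDerivAt (fun τ => σ τ - σ t) (deriv σ t) t :=
    ((hσ.contDiffAt (hJ.mem_nhds ht)).differentiableAt (by simp)).hasDerivAt.sub_const _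
  have h3 := HasDerivAt.scomp_of_eq t h1 h2 (by simp)
  refine (h3.congr_of_eventuallyEq ?_).deriv
  filter_upwards [hJ.mem_nhds ht] with τ hτ
  simp only [Function.comp, hγ t ht, hγ τ hτ]
  rw [← inv_mul_semidirectAct, add_sub_cancel]

/-- The geodesic orbit property implies its infinitesimal version. -/
theorem isAlgebraicGO_of_isGONilmanifold
    {B : LinearMap.BilinForm ℝ (GroupLieAlgebra 𝓘(ℝ, Euc n) N)} (hGO : IsGONilmanifold B H) :
    IsAlgebraicGO B := by
  have key : ∀ T : Euc n, ∃ D : GroupLieAlgebra 𝓘(ℝ, Euc n) N →ₗ[ℝ] GroupLieAlgebra 𝓘(ℝ, Euc n) N,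
      IsSkewDerivation B D ∧ ∃ k : ℝ, ∀ w : Euc n,
        formCLM B T (groupBracket N T w) = formCLM B (D T) w + k * formCLM B T w := by
    intro T
    obtain ⟨ε, hε, γ, hγ, hT⟩ := exists_isGeodesicOn hGO.symm hGO.nondegenerate T
    obtain ⟨φ, hφ, x, σ, hσ, hγσ⟩ := hGO.geodesicOrbit _ γ isOpen_Ioo ordConnected_Ioo hγ
    have h0 : (0 : ℝ) ∈ Ioo (-ε) ε := ⟨by linarith, hε⟩
    have hbv := fun t ht => bodyVelocity_orbit φ hφ isOpen_Ioo hσ hγσ (t := t) ht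
    set X := deriv (fun r => extChartAt 𝓘(ℝ, Euc n) (1 : N)
        (x⁻¹ * semidirectAct (φ (Multiplicative.ofAdd r)) x)) 0
    set R : ℝ → Euc n →L[ℝ] Euc n := fun s => derivAtOne (Euc n) (autPart φ s) with hRdef
    have hsm : ∀ s, ContMDiff 𝓘(ℝ, Euc n) 𝓘(ℝ, Euc n) ∞ (autPart φ s) := fun s =>
      (contMDiff_autPart φ hφ).comp (contMDiff_const.prodMk contMDiff_id)
    have hRadd : ∀ s r, R (s + r) = (R s).comp (R r) := by
      intro s r
      have h1 : (autPart φ (s + r) : N → N) = autPart φ s ∘ autPart φ r := by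
        rw [autPart_add]; rfl
      simp only [hRdef]
      rw [h1, derivAtOne_comp (hsm s).contMDiffAt (hsm r).contMDiffAt (map_one _)]
    have hR0 : ∀ v, R 0 v = v := by
      intro v
      have : (autPart φ 0 : N → N) = id := by rw [autPart_zero]; rfl
      simp only [hRdef, this, derivAtOne_id]; rfl
    have hRd : DifferentiableAt ℝ R 0 :=
      differentiableAt_derivAtOne_family (contMDiff_autPart φ hφ) (fun s => map_one _) 0
    let A : GroupLieAlgebra 𝓘(ℝ, Euc n) N →ₗ[ℝ] GroupLieAlgebra 𝓘(ℝ, Euc n) N :=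
      ((deriv R 0 : Euc n →L[ℝ] Euc n) : Euc n →ₗ[ℝ] Euc n)
    have hA : IsSkewDerivation B A := by
      refine isSkewDerivation_of_hasDerivAt (R := R) hR0 (fun s v w => ?_) (fun s v w => ?_)
        fun v => ?_
      · exact derivAtOne_groupBracket ((autPart φ s : MulAut N) : N →* N) (hsm s) v w
      · exact hGO.isometric _ (φ (Multiplicative.ofAdd s)).right.2 v w
      · have h1 := hRd.hasDerivAt.clm_apply (hasDerivAt_const (0 : ℝ) v)
        rw [map_zero, add_zero] at h1
        exact h1
    set T₀ := R (σ 0) X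
    have hTT : T = deriv σ 0 • T₀ := by rw [← hT, hbv 0 h0]
    -- In this case T = 0 and the condition is empty.
    by_cases hs : deriv σ 0 = 0
    · rw [hs, zero_smul] at hTT
      subst hTT
      exact ⟨0, IsSkewDerivation.zero B, 0, fun w => by
        change formCLM B 0 _ = formCLM B 0 w + 0 * formCLM B 0 w
        simp⟩
    have hσ' : ContDiffAt ℝ ∞ σ 0 := hσ.contDiffAt (isOpen_Ioo.mem_nhds h0)
    have hσ1 : HasDerivAt (fun t => σ t - σ 0) (deriv σ 0) 0 :=
      (hσ'.differentiableAt (by simp)).hasDerivAt.sub_const _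
    have hσ2 : HasDerivAt (deriv σ) (deriv (deriv σ) 0) 0 := by
      have h1 : ContDiffAt ℝ 1 (fderiv ℝ σ) 0 := hσ'.fderiv_right (WithTop.coe_le_coe.mpr le_top)
      have h2 : deriv σ = fun τ => fderiv ℝ σ τ 1 := by
        ext1 τ; exact fderiv_apply_one_eq_deriv.symm
      refine DifferentiableAt.hasDerivAt ?_
      rw [h2]
      exact (h1.differentiableAt (by simp)).clm_apply (differentiableAt_const _)
    have hRc : HasDerivAt (fun t => R (σ t - σ 0) T₀) (deriv σ 0 • deriv R 0 T₀) 0 := by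
      have h1 := HasDerivAt.scomp_of_eq (0 : ℝ) hRd.hasDerivAt hσ1 (sub_self _).symm
      simpa using h1.clm_apply (hasDerivAt_const (0 : ℝ) T₀)
    have hV := hσ2.smul hRc
    have hV' : HasDerivAt (bodyVelocity (Euc n) γ) (deriv σ 0 • deriv σ 0 • (deriv R 0) T₀
        + deriv (deriv σ) 0 • (R (σ 0 - σ 0)) T₀) 0 := by
      refine hV.congr_of_eventuallyEq ?_
      filter_upwards [isOpen_Ioo.mem_nhds h0] with t ht
      rw [hbv t ht]
      have := hRadd (σ t - σ 0) (σ 0)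
      rw [sub_add_cancel] at this
      change _ • R (σ t) X = _
      rw [this]; rfl
    -- At 0 one has T = σ' T₀ and V' = σ'² A T₀ + σ'' T₀, which is D T + k T for D = σ' A and k =
    -- σ'' / σ'.
    refine ⟨deriv σ 0 • A, hA.smul _, deriv (deriv σ) 0 / deriv σ 0, fun w => ?_⟩
    have h1 := (((isGeodesicOn_leftInvMetric_iff hGO.symm isOpen_Ioo).mp hγ).2 0 h0).2 w
    rw [hT, hV'.deriv, sub_self, hR0] at h1
    rw [← h1]
    have h2 : ((deriv σ 0 • A) T : Euc n) = deriv σ 0 • deriv σ 0 • deriv R 0 T₀ := by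
      rw [hTT]
      change deriv σ 0 • deriv R 0 (deriv σ 0 • T₀) = _
      rw [map_smul]
    rw [h2, map_add, add_apply]
    congr 1
    rw [hTT]
    simp only [map_smul, smul_apply, smul_eq_mul]
    field_simp
  exact key

end GeodesicOrbit

/-! ### Nilpotent Lie algebras and derivations. -/

section NilpotentAlgebra

variable {L : Type*} [LieRing L] [LieAlgebra ℝ L]

lemma exists_ad_pow_eq_zero [LieRing.IsNilpotent L] (x : L) :
    ∃ m : ℕ, (LieAlgebra.ad ℝ L x) ^ m = 0 :=
  LieModule.isNilpotent_toEnd_of_isNilpotent ℝ L L x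

/-- A nilpotent operator has no nonzero real eigenvalue. Leftover coefficients in the structure
computations below are removed by this. -/
lemma lie_eq_zero_of_lie_eq_smul [LieRing.IsNilpotent L] {x y : L} {c : ℝ} (h : ⁅x, y⁆ = c • y) :
    ⁅x, y⁆ = 0 := by
  obtain ⟨m, hm⟩ := exists_ad_pow_eq_zero x
  have h1 : ∀ k : ℕ, ((LieAlgebra.ad ℝ L x) ^ k) y = c ^ k • y := by
    intro k
    induction k with
    | zero => simp
    | succ k ih => rw [pow_succ', Module.End.mul_apply, ih, map_smul, LieAlgebra.ad_apply, h,
        smul_smul, pow_succ]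
  have h2 := h1 m
  rw [hm, LinearMap.zero_apply] at h2
  rcases smul_eq_zero.mp h2.symm with h3 | h3
  · rw [h, eq_zero_of_pow_eq_zero h3, zero_smul]
  · rw [h3, lie_zero]

lemma derivation_mem_lowerCentralSeries {D : L →ₗ[ℝ] L}
    (hD : ∀ x y, D ⁅x, y⁆ = ⁅D x, y⁆ + ⁅x, D y⁆) (k : ℕ) {x : L}
    (hx : x ∈ LieModule.lowerCentralSeries ℝ L L k) :
    D x ∈ LieModule.lowerCentralSeries ℝ L L k := by
  induction k generalizing x with
  | zero => simp
  | succ k ih =>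
    rw [LieModule.lowerCentralSeries_succ, ← LieSubmodule.mem_toSubmodule,
      LieSubmodule.lieIdeal_oper_eq_linear_span'] at hx ⊢
    induction hx using Submodule.span_induction with
    | mem y hy =>
      obtain ⟨v, -, m, hm, rfl⟩ := hy
      rw [hD]
      exact add_mem (Submodule.subset_span ⟨D v, by trivial, m, hm, rfl⟩)
        (Submodule.subset_span ⟨v, by trivial, D m, ih hm, rfl⟩)
    | zero => simp
    | add a b _ _ ha hb => rw [map_add]; exact add_mem ha hb
    | smul c a _ ha => rw [map_smul]; exact Submodule.smul_mem _ _ ha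

lemma lie_mem_lowerCentralSeries_succ {k : ℕ} (x : L) {y : L}
    (hy : y ∈ LieModule.lowerCentralSeries ℝ L L k) :
    ⁅x, y⁆ ∈ LieModule.lowerCentralSeries ℝ L L (k + 1) := by
  rw [LieModule.lowerCentralSeries_succ]
  exact LieSubmodule.lie_mem_lie (LieSubmodule.mem_top x) hy

lemma lie_mem_derivedSubspace (x y : L) : ⁅x, y⁆ ∈ derivedSubspace L :=
  LieSubmodule.lie_mem_lie (LieSubmodule.mem_top x) (LieSubmodule.mem_top y)

lemma mem_derivedSubspace_iff {x : L} :
    x ∈ derivedSubspace L ↔ x ∈ LieModule.lowerCentralSeries ℝ L L 1 := by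
  rw [LieModule.lowerCentralSeries_succ]; rfl

lemma derivedSubspace_eq_span :
    derivedSubspace L = Submodule.span ℝ {z | ∃ x y : L, ⁅x, y⁆ = z} := by
  refine le_antisymm (fun x hx => ?_) (Submodule.span_le.mpr ?_)
  · have hx' : x ∈ (⁅(⊤ : LieIdeal ℝ L), (⊤ : LieIdeal ℝ L)⁆ : LieIdeal ℝ L).toSubmodule := hx
    rw [LieSubmodule.lieIdeal_oper_eq_linear_span'] at hx'
    refine Submodule.span_mono ?_ hx'
    rintro _ ⟨v, -, m, -, rfl⟩
    exact ⟨v, m, rfl⟩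
  · rintro _ ⟨x, y, rfl⟩
    exact lie_mem_derivedSubspace x y

end NilpotentAlgebra

/-! ### Maximal isotropic subspaces and skew nilpotent operators. -/

section Forms

variable {V : Type*} [AddCommGroup V] [Module ℝ V]

/-- A map preserving the orthogonal complement of a maximal isotropic subspace `R`, nilpotent and
skew there, maps that complement to `R`. -/
lemma mem_of_isNilpotent_skew {B : LinearMap.BilinForm ℝ V} {R : Submodule ℝ V}
    (hR : ∀ x, (∀ r ∈ R, B r x = 0) → B x x ≤ 0 → x ∈ R) {D : V →ₗ[ℝ] V} {m : ℕ}
    (hm : D ^ m = 0) (hD : ∀ x, (∀ r ∈ R, B r x = 0) → ∀ r ∈ R, B r (D x) = 0)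
    (hskew : ∀ x y, (∀ r ∈ R, B r x = 0) → (∀ r ∈ R, B r y = 0) → B (D x) y + B x (D y) = 0)
    {x : V} (hx : ∀ r ∈ R, B r x = 0) : D x ∈ R := by
  have hpow : ∀ k, ∀ r ∈ R, B r ((D ^ k) x) = 0 := by
    intro k
    induction k with
    | zero => simpa using hx
    | succ k ih => rw [pow_succ']; exact hD _ ih
  -- If D^(k+2) x lies in R, it is orthogonal to D^k x. By skewness D^(k+1) x is then null, hence in
  -- R by maximality.
  have key : ∀ k, (D ^ (k + 1)) x ∈ R → D x ∈ R := by
    intro k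
    induction k with
    | zero => simp
    | succ k ih =>
      intro h
      apply ih
      refine hR _ (hpow (k + 1)) (le_of_eq ?_)
      have h1 := hskew ((D ^ (k + 1)) x) ((D ^ k) x) (hpow _) (hpow _)
      rw [← Module.End.mul_apply D, ← Module.End.mul_apply D, ← pow_succ', ← pow_succ',
        hpow k _ h, zero_add] at h1
      exact h1
  refine key m ?_
  rw [pow_succ, Module.End.mul_apply, hm]
  simp

/-- Adjoining x to R keeps the form nonpositive, and R already has the largest dimension allowed. -/
lemma mem_of_isotropic_of_nonpos [FiniteDimensional ℝ V] {B : LinearMap.BilinForm ℝ V}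
    (hs : B.IsSymm) {d : ℕ} (hB : ∀ W : Submodule ℝ V, (∀ x ∈ W, B x x ≤ 0) → Module.finrank ℝ W ≤ d)
    {R : Submodule ℝ V} (hR : ∀ x ∈ R, B x x = 0) (hd : Module.finrank ℝ R = d) (x : V)
    (hx : ∀ r ∈ R, B r x = 0) (hxx : B x x ≤ 0) : x ∈ R := by
  have h1 : Module.finrank ℝ ↥(R ⊔ Submodule.span ℝ {x}) ≤ d := by
    refine hB _ fun y hy => ?_
    obtain ⟨r, hr, z, hz, rfl⟩ := Submodule.mem_sup.mp hy
    obtain ⟨c, rfl⟩ := Submodule.mem_span_singleton.mp hz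
    have h2 := hs.eq x r
    simp only [map_add, map_smul, LinearMap.add_apply, LinearMap.smul_apply, smul_eq_mul,
      hR r hr, hx r hr] at h2 ⊢
    rw [h2]
    nlinarith [mul_self_nonneg c]
  have h3 : R = R ⊔ Submodule.span ℝ {x} :=
    Submodule.eq_of_le_of_finrank_le le_sup_left (hd ▸ h1)
  rw [h3]
  exact Submodule.mem_sup_right (Submodule.mem_span_singleton_self x)

end Forms

/-! ### Invariant subspaces and the geodesic orbit condition. -/

section GeodesicOrbitAlgebra

variable {L : Type*} [LieRing L] [LieAlgebra ℝ L] {B : LinearMap.BilinForm ℝ L}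

lemma IsSkewDerivation.mem_derivedSubspace {D : L →ₗ[ℝ] L} (h : IsSkewDerivation B D) {x : L}
    (hx : x ∈ derivedSubspace L) : D x ∈ derivedSubspace L := by
  rw [mem_derivedSubspace_iff] at hx ⊢
  exact derivation_mem_lowerCentralSeries h.leibniz 1 hx

lemma IsSkewDerivation.mem_orthogonal {D : L →ₗ[ℝ] L} (h : IsSkewDerivation B D)
    {W : Submodule ℝ L} (hW : ∀ x ∈ W, D x ∈ W) {x : L} (hx : x ∈ B.orthogonal W) :
    D x ∈ B.orthogonal W := by
  intro y hy
  have h1 := h.skew y x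
  rw [LinearMap.BilinForm.mem_orthogonal_iff] at hx
  have h2 : B (D y) x = 0 := hx _ (hW y hy)
  rw [h2, zero_add] at h1
  exact h1

/-- The unknown D and k drop out: ⟨D T, w⟩ = -⟨T, D w⟩ vanishes because W is invariant, and k ⟨T, w⟩
because T ⊥ W. -/
lemma IsAlgebraicGO.apply_lie_eq_zero (hGO : IsAlgebraicGO B) {W : Submodule ℝ L}
    (hW : ∀ D, IsSkewDerivation B D → ∀ x ∈ W, D x ∈ W) (hs : B.IsSymm) {w T : L} (hw : w ∈ W)
    (hT : ∀ x ∈ W, B x T = 0) : B T ⁅T, w⁆ = 0 := by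
  obtain ⟨D, hD, k, h⟩ := hGO T
  have h1 := hD.skew T w
  have h2 : ∀ x ∈ W, B T x = 0 := fun x hx => by rw [← hT x hx]; exact hs.eq T x
  rw [h2 _ (hW D hD w hw), add_zero] at h1
  rw [h w, h1, h2 w hw]
  ring

/-- Elements of an invariant subspace `W` act by skew operators on `Wᗮ`. -/
lemma IsAlgebraicGO.lie_skew_apply (hGO : IsAlgebraicGO B) {W : Submodule ℝ L}
    (hW : ∀ D, IsSkewDerivation B D → ∀ x ∈ W, D x ∈ W) (hs : B.IsSymm) {w x y : L} (hw : w ∈ W)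
    (hx : ∀ r ∈ W, B r x = 0) (hy : ∀ r ∈ W, B r y = 0) : B ⁅w, x⁆ y + B x ⁅w, y⁆ = 0 := by
  -- Polarisation of the quadratic identity just proved.
  have h1 := hGO.apply_lie_eq_zero hW hs hw (T := x + y) fun r hr => by
    rw [map_add, hx r hr, hy r hr, add_zero]
  have h2 := hGO.apply_lie_eq_zero hW hs hw hx
  have h3 := hGO.apply_lie_eq_zero hW hs hw hy
  simp only [add_lie, map_add, LinearMap.add_apply, h2, h3] at h1
  have h4 : B ⁅w, x⁆ y = - B y ⁅x, w⁆ := by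
    rw [← lie_skew, map_neg, LinearMap.neg_apply, hs.eq]
  have h5 : B x ⁅w, y⁆ = - B x ⁅y, w⁆ := by
    rw [← lie_skew, map_neg]
  rw [h4, h5]
  linarith

end GeodesicOrbitAlgebra

/-! ### A one-dimensional radical: the chain of three vectors. -/

section LineCase

lemma finrank_span_pair_eq_two {V : Type*} [AddCommGroup V] [Module ℝ V] {u w : V} (hu : u ≠ 0)
    (hw : ∀ c : ℝ, w ≠ c • u) : Module.finrank ℝ (Submodule.span ℝ {u, w}) = 2 := by
  have h1 : LinearIndependent ℝ ![u, w] := by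
    rw [LinearIndependent.pair_iff' hu]
    exact fun a h => hw a h.symm
  have h2 := finrank_span_eq_card h1
  have h3 : range ![u, w] = {u, w} := by
    simp [Matrix.range_cons, Matrix.range_empty, Set.pair_comm]
  rw [h3] at h2
  simpa using h2

variable {L : Type*} [LieRing L] [LieAlgebra ℝ L] {B : LinearMap.BilinForm ℝ L}

lemma exists_mem_lowerCentralSeries_not_mem_succ [LieRing.IsNilpotent L] {x : L} (hx : x ≠ 0) :
    ∃ k, x ∈ LieModule.lowerCentralSeries ℝ L L k ∧
      x ∉ LieModule.lowerCentralSeries ℝ L L (k + 1) := by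
  by_contra! h
  have h1 : ∀ k, x ∈ LieModule.lowerCentralSeries ℝ L L k := by
    intro k
    induction k with
    | zero => simp
    | succ k ih => exact h k ih
  obtain ⟨k, hk⟩ := LieModule.IsNilpotent.nilpotent ℝ L L
  have h2 := h1 k
  rw [hk] at h2
  exact hx (by simpa using h2)

lemma lie_eq_zero_of_lie_eq_smul_left [LieRing.IsNilpotent L] {x y : L} {c : ℝ}
    (h : ⁅x, y⁆ = c • x) : ⁅x, y⁆ = 0 := by
  have h1 : ⁅y, x⁆ = (-c) • x := by rw [← lie_skew, h, neg_smul]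
  rw [← lie_skew, lie_eq_zero_of_lie_eq_smul h1, neg_zero]

/-- If `f ∘ ad w = β f` on the hyperplane `uᗮ` and `f ≠ 0` there, then `β = 0`. -/
lemma eq_zero_of_ad_semi_invariant [LieRing.IsNilpotent L] {w x : L} {f g : L →ₗ[ℝ] ℝ} {β : ℝ}
    (hg : ∀ x, g ⁅w, x⁆ = 0) (hf : ∀ x, g x = 0 → f ⁅w, x⁆ = β * f x) (hx : g x = 0)
    (hfx : f x ≠ 0) : β = 0 := by
  obtain ⟨m, hm⟩ := exists_ad_pow_eq_zero w
  have h1 : ∀ k : ℕ, g (((LieAlgebra.ad ℝ L w) ^ k) x) = 0 ∧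
      f (((LieAlgebra.ad ℝ L w) ^ k) x) = β ^ k * f x := by
    intro k
    induction k with
    | zero => simpa using hx
    | succ k ih =>
      rw [pow_succ', Module.End.mul_apply, LieAlgebra.ad_apply, hf _ ih.1, ih.2]
      exact ⟨hg _, by ring⟩
  have h2 := (h1 m).2
  rw [hm, LinearMap.zero_apply, map_zero] at h2
  rcases mul_eq_zero.mp h2.symm with h3 | h3
  · exact eq_zero_of_pow_eq_zero h3
  · exact absurd h3 hfx

variable [FiniteDimensional ℝ L]

lemma exists_eq_smul_of_orthogonal (hs : B.IsSymm) (hnd : B.Nondegenerate) {u z : L}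
    (h : ∀ x, B u x = 0 → B z x = 0) : ∃ c : ℝ, z = c • u := by
  have h1 := LinearMap.BilinForm.orthogonal_orthogonal hnd hs.isRefl (Submodule.span ℝ {u})
  have h2 : z ∈ B.orthogonal (B.orthogonal (Submodule.span ℝ {u})) := by
    intro x hx
    change B x z = 0
    rw [hs.eq]
    exact h x (hx u (Submodule.mem_span_singleton_self u))
  rw [h1] at h2
  obtain ⟨c, hc⟩ := Submodule.mem_span_singleton.mp h2
  exact ⟨c, hc.symm⟩

lemma mem_span_pair_of_nonpos (hs : B.IsSymm)
    (hB : ∀ W : Submodule ℝ L, (∀ x ∈ W, B x x ≤ 0) → Module.finrank ℝ W ≤ 2) {u w : L}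
    (hu : u ≠ 0) (hw : ∀ c : ℝ, w ≠ c • u) (huu : B u u = 0) (huw : B u w = 0) (hww : B w w = 0) :
    ∀ x, (∀ r ∈ Submodule.span ℝ {u, w}, B r x = 0) → B x x ≤ 0 → x ∈ Submodule.span ℝ {u, w} := by
  refine fun x => mem_of_isotropic_of_nonpos hs hB ?_ ?_ x
  · intro y hy
    obtain ⟨a, b, rfl⟩ := Submodule.mem_span_pair.mp hy
    have hwu : B w u = 0 := by rw [hs.eq, huw]
    simp [huu, huw, hww, hwu]
  · exact finrank_span_pair_eq_two hu hw

variable [LieRing.IsNilpotent L]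

/-- If no vector orthogonal to [u, uᗮ] pairs nontrivially with u, then u itself lies in [u, uᗮ], and
u = [u, x] is impossible in a nilpotent algebra. -/
lemma exists_dual_vector_of_ad (hs : B.IsSymm) (hnd : B.Nondegenerate) {u : L} (hu : u ≠ 0) :
    ∃ ξ, B ξ u = 1 ∧ ∀ x, B u x = 0 → B ξ ⁅u, x⁆ = 0 := by
  let P : Submodule ℝ L := (B.orthogonal (Submodule.span ℝ {u})).map (LieAlgebra.ad ℝ L u)
  have h1 : ∃ ξ ∈ B.orthogonal P, B ξ u ≠ 0 := by
    by_contra! h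
    have h2 : u ∈ B.orthogonal (B.orthogonal P) := h
    rw [LinearMap.BilinForm.orthogonal_orthogonal hnd hs.isRefl] at h2
    obtain ⟨x, -, hx⟩ := h2
    have h3 : ⁅u, x⁆ = (1 : ℝ) • u := by rw [one_smul]; exact hx
    have h4 := lie_eq_zero_of_lie_eq_smul_left h3
    rw [h3, one_smul] at h4
    exact hu h4
  obtain ⟨ξ, hξ, hξu⟩ := h1
  refine ⟨(B ξ u)⁻¹ • ξ, by simp [hξu], fun x hx => ?_⟩
  have h2 : B ⁅u, x⁆ ξ = 0 := hξ _ ⟨x, by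
    intro y hy
    obtain ⟨c, rfl⟩ := Submodule.mem_span_singleton.mp hy
    change B (c • u) x = 0
    rw [map_smul, LinearMap.smul_apply, hx, smul_zero], rfl⟩
  rw [map_smul, LinearMap.smul_apply, hs.eq ξ ⁅u, x⁆, h2, smul_zero]

/-- In the situation of a degenerate derived algebra with one-dimensional radical `ℝ u`, the
operator `ad u` has square zero on `uᗮ`: otherwise the three vectors below give a contradiction. -/
lemma false_of_ad_sq_ne_zero (hs : B.IsSymm) (hnd : B.Nondegenerate) (hGO : IsAlgebraicGO B)
    (hB : ∀ W : Submodule ℝ L, (∀ x ∈ W, B x x ≤ 0) → Module.finrank ℝ W ≤ 2) {u w₃ : L}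
    (hu : u ≠ 0) (hud : u ∈ derivedSubspace L) (hlie : ∀ x y : L, B u ⁅x, y⁆ = 0)
    (hr : ∀ x ∈ derivedSubspace L, (∀ y z : L, B x ⁅y, z⁆ = 0) → ∃ c : ℝ, x = c • u)
    (hinv : ∀ D, IsSkewDerivation B D → ∃ c : ℝ, D u = c • u)
    (hskew : ∀ x y, B u x = 0 → B u y = 0 → B ⁅u, x⁆ y + B x ⁅u, y⁆ = 0)
    (hw₃ : B u w₃ = 0) (hne : ⁅u, ⁅u, w₃⁆⁆ ≠ 0) (hw₁ : ⁅u, ⁅u, ⁅u, w₃⁆⁆⁆ = 0) : False := by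
  have hsy : ∀ x y, B x y = B y x := hs.eq
  -- The chain w₃ ↦ w₂ ↦ w₁ ↦ 0 under ad u. By skewness w₁ is null and orthogonal to w₂, so u and w₁
  -- span a maximal isotropic plane, called R in these comments.
  obtain ⟨w₂, hw₂⟩ : ∃ w, w = ⁅u, w₃⁆ := ⟨_, rfl⟩
  obtain ⟨w₁, hw₁'⟩ : ∃ w, w = ⁅u, w₂⁆ := ⟨_, rfl⟩
  rw [← hw₂, ← hw₁'] at hne hw₁
  have huu : B u u = 0 := by
    rw [derivedSubspace_eq_span] at hud
    have : Submodule.span ℝ {z | ∃ x y : L, ⁅x, y⁆ = z} ≤ LinearMap.ker (B u) := by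
      rw [Submodule.span_le]
      rintro _ ⟨x, y, rfl⟩
      exact hlie x y
    exact this hud
  have hu2 : B u w₂ = 0 := by rw [hw₂]; exact hlie _ _
  have hu1 : B u w₁ = 0 := by rw [hw₁']; exact hlie _ _
  have huD : ∀ y (c : ℝ), c • u = ⁅u, y⁆ → c = 0 := by
    intro y c h
    have h1 := lie_eq_zero_of_lie_eq_smul_left h.symm
    rw [← h] at h1
    exact (smul_eq_zero.mp h1).resolve_right hu
  have h11 : B w₁ w₁ = 0 := by
    have := hskew w₂ w₁ hu2 hu1
    rwa [hw₁, map_zero, add_zero, ← hw₁'] at this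
  have h12 : B w₁ w₂ = 0 := by
    have := hskew w₂ w₂ hu2 hu2
    rw [← hw₁', hsy w₂ w₁] at this
    linarith
  have h1u : ∀ c : ℝ, w₁ ≠ c • u := by
    intro c h
    have := huD w₂ c (by rw [← h, hw₁'])
    rw [this, zero_smul] at h
    exact hne h
  have hR := mem_span_pair_of_nonpos hs hB hu h1u huu hu1 h11
  have hRorth : ∀ x, B u x = 0 → B w₁ x = 0 → ∀ r ∈ Submodule.span ℝ {u, w₁}, B r x = 0 := by
    intro x h1 h2 r hr
    obtain ⟨a, b, rfl⟩ := Submodule.mem_span_pair.mp hr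
    simp [h1, h2]
  have hRorth' : ∀ x, (∀ r ∈ Submodule.span ℝ {u, w₁}, B r x = 0) → B u x = 0 ∧ B w₁ x = 0 :=
    fun x h => ⟨h u (Submodule.subset_span (by simp)), h w₁ (Submodule.subset_span (by simp))⟩
  have h13 : B w₁ w₃ ≠ 0 := by
    intro h
    have h1 := hskew w₂ w₃ hu2 hw₃
    rw [← hw₁', ← hw₂, h, zero_add] at h1
    have h2 := hR w₂ (hRorth w₂ hu2 h12) h1.le
    obtain ⟨a, b, hab⟩ := Submodule.mem_span_pair.mp h2
    apply hne
    rw [hw₁', ← hab]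
    simp [hw₁]
  have h22 : B w₂ w₂ = -B w₁ w₃ := by
    have h1 := hskew w₂ w₃ hu2 hw₃
    rw [← hw₁', ← hw₂] at h1
    linarith
  -- ad u preserves Rᗮ and is nilpotent and skew there, so it maps Rᗮ into R. A component along u
  -- would put a multiple of u into [u, L], which `huD` excludes.
  have hS : ∀ x, B u x = 0 → B w₁ x = 0 → ∃ b : ℝ, ⁅u, x⁆ = b • w₁ := by
    intro x h1 h2
    obtain ⟨m, hm⟩ := exists_ad_pow_eq_zero u
    have h3 : ⁅u, x⁆ ∈ Submodule.span ℝ {u, w₁} := by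
      refine mem_of_isNilpotent_skew hR hm ?_ ?_ (hRorth x h1 h2)
      · intro y hy
        have hy := hRorth' y hy
        refine hRorth _ (hlie _ _) ?_
        have := hskew w₁ y hu1 hy.1
        rwa [hw₁, map_zero, LinearMap.zero_apply, zero_add] at this
      · intro y z hy hz
        exact hskew y z (hRorth' y hy).1 (hRorth' z hz).1
    obtain ⟨a, b, hab⟩ := Submodule.mem_span_pair.mp h3
    have h4 := huD (x - b • w₂) a (by
      rw [lie_sub, ← hab, lie_smul, ← hw₁']; abel)
    rw [h4, zero_smul, zero_add] at hab
    exact ⟨b, hab.symm⟩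
  have hdec : ∀ x, B u x = 0 → ∃ s, ∃ c : ℝ, x = s + c • w₃ ∧ B u s = 0 ∧ B w₁ s = 0 := by
    intro x hx
    refine ⟨x - (B w₁ x / B w₁ w₃) • w₃, B w₁ x / B w₁ w₃, by abel, ?_, ?_⟩
    · rw [map_sub, map_smul, hx, hw₃]; simp
    · rw [map_sub, map_smul, smul_eq_mul]; field_simp; ring
  -- `w₁` is an eigenvector with the same eigenvalue as `u`
  have heig : ∀ D, IsSkewDerivation B D → ∃ c : ℝ, D u = c • u ∧ D w₁ = c • w₁ := by
    intro D hD
    obtain ⟨c, hc⟩ := hinv D hD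
    refine ⟨c, hc, ?_⟩
    have hD3 : B u (D w₃) = 0 := by
      have := hD.skew u w₃
      rw [hc, map_smul, LinearMap.smul_apply, hw₃, smul_zero, zero_add] at this
      exact this
    obtain ⟨s, a, hsa, hs1, hs2⟩ := hdec _ hD3
    obtain ⟨b, hb⟩ := hS s hs1 hs2
    have hD2 : D w₂ = (c + a) • w₂ + b • w₁ := by
      rw [hw₂, hD.leibniz, hc, hsa, lie_add, hb, lie_smul, smul_lie, ← hw₂, add_smul]; abel
    have hD1 : D w₁ = (2 * c + a) • w₁ := by
      rw [hw₁', hD.leibniz, hc, hD2, lie_add, lie_smul, lie_smul, hw₁, smul_lie, ← hw₁']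
      module
    -- Modulo Rᗮ, D w₃ is a w₃, and Leibniz gives D w₁ = (2c + a) w₁. Skewness on the pair w₁, w₃
    -- forces a = -c.
    have h1 := hD.skew w₁ w₃
    rw [hD1, hsa, map_smul, LinearMap.smul_apply, map_add, map_smul, hs2, smul_eq_mul,
      smul_eq_mul] at h1
    have h2 : (2 * (c + a)) * B w₁ w₃ = 0 := by linarith
    have h3 : c + a = 0 := by
      rcases mul_eq_zero.mp h2 with h | h
      · linarith
      · exact absurd h h13
    rw [hD1]; congr 1; linarith
  -- For x = u and x = w₁ the condition reads ⟨T, [T, x]⟩ = (k - c) ⟨T, x⟩ with the same unknown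
  -- factor, which is eliminated.
  have hcross : ∀ T, B T ⁅T, w₁⁆ * B T u = B T ⁅T, u⁆ * B T w₁ := by
    intro T
    obtain ⟨D, hD, k, h⟩ := hGO T
    obtain ⟨c, hc1, hc2⟩ := heig D hD
    have h1 := hD.skew T u
    have h2 := hD.skew T w₁
    rw [hc1, map_smul, smul_eq_mul] at h1
    rw [hc2, map_smul, smul_eq_mul] at h2
    rw [h, h, eq_neg_of_add_eq_zero_left h1, eq_neg_of_add_eq_zero_left h2]
    ring
  obtain ⟨ξ, hξu, hξ⟩ := exists_dual_vector_of_ad hs hnd hu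
  have hξ1 : B ξ w₁ = 0 := by rw [hw₁']; exact hξ _ hu2
  obtain ⟨l, hl⟩ : ∃ l, l = ⁅u, ξ⁆ := ⟨_, rfl⟩
  have hlu : B u l = 0 := by rw [hl]; exact hlie _ _
  have hdec' : ∀ T, ∃ T', T = B T u • ξ + T' ∧ B u T' = 0 := fun T =>
    ⟨T - B T u • ξ, by abel, by rw [map_sub, map_smul, hsy u ξ, hξu, hsy u T]; simp⟩
  -- T is split along ξ and uᗮ. On uᗮ skewness applies, so only l = [u, ξ] contributes.
  have hq : ∀ T, B T ⁅T, u⁆ = -(B l T) * B T u := by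
    intro T
    obtain ⟨T', hT, hT'⟩ := hdec' T
    set t := B T u
    have h1 : B T' ⁅u, T'⁆ = 0 := by
      have := hskew T' T' hT' hT'
      rw [hsy ⁅u, T'⁆] at this; linarith
    have h2 : B T ⁅u, T⁆ = B l T * t := by
      rw [hT]
      simp only [map_add, map_smul, lie_add, lie_smul, LinearMap.add_apply, LinearMap.smul_apply,
        smul_eq_mul, hξ T' hT', h1, ← hl]
      rw [hsy ξ l, hsy T' l]
      ring
    rw [← lie_skew, map_neg, h2]; ring
  have hq1 : ∀ T, B T ⁅T, w₁⁆ = -(B l T) * B T w₁ := by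
    have h0 : ∀ T, B T u ≠ 0 → B T ⁅T, w₁⁆ = -(B l T) * B T w₁ := by
      intro T hT
      have := hcross T
      rw [hq T] at this
      apply mul_right_cancel₀ hT
      rw [this]; ring
    intro T
    -- Cancelling ⟨T, u⟩ is impossible on uᗮ. Both sides being quadratic in T, the identity there
    -- follows from its values at T + ξ, T - ξ and ξ.
    by_cases hT : B T u = 0
    · have h1 := h0 (T + ξ) (by rw [map_add, LinearMap.add_apply, hT, hξu]; norm_num)
      have h2 := h0 (T - ξ) (by rw [map_sub, LinearMap.sub_apply, hT, hξu]; norm_num)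
      have h3 := h0 ξ (by rw [hξu]; norm_num)
      simp only [map_add, map_sub, add_lie, sub_lie, LinearMap.add_apply, LinearMap.sub_apply]
        at h1 h2
      linarith
    · exact h0 T hT
  have hpol : ∀ x y, B x ⁅y, w₁⁆ + B y ⁅x, w₁⁆ = -(B l x * B y w₁ + B l y * B x w₁) := by
    intro x y
    have h1 := hq1 (x + y)
    have h2 := hq1 x
    have h3 := hq1 y
    simp only [map_add, add_lie, LinearMap.add_apply] at h1
    linarith
  -- On Rᗮ the right side of `hpol` vanishes, so ad w₁ is skew there and the argument used for ad u
  -- applies to it.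
  have hw1S : ∀ x, B u x = 0 → B w₁ x = 0 → ⁅w₁, x⁆ ∈ Submodule.span ℝ {u, w₁} := by
    intro x h1 h2
    obtain ⟨m, hm⟩ := exists_ad_pow_eq_zero w₁
    refine mem_of_isNilpotent_skew hR hm ?_ ?_ (hRorth x h1 h2)
    · intro y hy
      have hy := hRorth' y hy
      refine hRorth _ (hlie _ _) ?_
      have := hpol y w₁
      rw [lie_self, map_zero, zero_add, h11, hsy y w₁, hy.2] at this
      change B w₁ ⁅w₁, y⁆ = 0
      rw [← lie_skew, map_neg, this]; simp
    · intro y z hy hz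
      have hy := hRorth' y hy
      have hz := hRorth' z hz
      have := hpol y z
      rw [hsy y w₁, hsy z w₁, hy.2, hz.2] at this
      change B ⁅w₁, y⁆ z + B y ⁅w₁, z⁆ = 0
      rw [← lie_skew w₁ y, ← lie_skew w₁ z, hsy _ z, map_neg, map_neg]
      linarith
  have h1_2 : ⁅w₁, w₂⁆ = 0 := by
    obtain ⟨a, b, hab⟩ := Submodule.mem_span_pair.mp (hw1S w₂ hu2 h12)
    -- w₁ = [u, w₂] lies deeper in the lower central series than u, so [w₁, w₂] cannot have a
    -- component along u.
    obtain ⟨k, hk, hk'⟩ := exists_mem_lowerCentralSeries_not_mem_succ hu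
    have hm : w₁ ∈ LieModule.lowerCentralSeries ℝ L L (k + 1) := by
      rw [hw₁', ← lie_skew]
      exact neg_mem (lie_mem_lowerCentralSeries_succ w₂ hk)
    have hm' : ⁅w₁, w₂⁆ ∈ LieModule.lowerCentralSeries ℝ L L (k + 1) := by
      rw [← lie_skew]
      exact neg_mem (LieSubmodule.lie_mem _ hm)
    have ha : a = 0 := by
      by_contra ha
      apply hk'
      have : u = a⁻¹ • (⁅w₁, w₂⁆ - b • w₁) := by
        rw [← hab, add_sub_cancel_right, smul_smul, inv_mul_cancel₀ ha, one_smul]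
      rw [this]
      exact SMulMemClass.smul_mem _ (sub_mem hm' (SMulMemClass.smul_mem _ hm))
    rw [ha, zero_smul, zero_add] at hab
    exact lie_eq_zero_of_lie_eq_smul_left hab.symm
  have hlieS : ∀ S, B u S = 0 → B w₁ S = 0 → ⁅w₁, S⁆ = 0 := by
    intro S h1 h2
    obtain ⟨a, b, hab⟩ := Submodule.mem_span_pair.mp (hw1S S h1 h2)
    obtain ⟨β, hβ⟩ := hS S h1 h2
    -- By the Jacobi identity the bracket lies in the image of ad u, which again excludes a
    -- component along u.
    have h3 : ⁅w₁, S⁆ = ⁅u, ⁅w₂, S⁆⁆ := by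
      rw [leibniz_lie u w₂ S, ← hw₁', hβ, lie_smul, ← lie_skew w₂ w₁, h1_2]; simp
    have h4 := huD (⁅w₂, S⁆ - b • w₂) a (by
      rw [lie_sub, ← h3, ← hab, lie_smul, ← hw₁']; abel)
    rw [h4, zero_smul, zero_add] at hab
    exact lie_eq_zero_of_lie_eq_smul_left hab.symm
  have hw2S : ∀ S, B u S = 0 → B w₁ S = 0 → B w₁ ⁅w₂, S⁆ = 0 := by
    intro S h1 h2
    obtain ⟨s, c, hsc, hs1, hs2⟩ := hdec ⁅w₂, S⁆ (hlie _ _)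
    obtain ⟨β, hβ⟩ := hS S h1 h2
    obtain ⟨β', hβ'⟩ := hS s hs1 hs2
    have h3 : ⁅u, ⁅w₂, S⁆⁆ = 0 := by
      rw [leibniz_lie u w₂ S, ← hw₁', hlieS S h1 h2, hβ, lie_smul, ← lie_skew w₂ w₁, h1_2]; simp
    rw [hsc, lie_add, lie_smul, hβ', ← hw₂] at h3
    have h4 : B (β' • w₁ + c • w₂) w₂ = 0 := by rw [h3]; simp
    rw [map_add, map_smul, map_smul, LinearMap.add_apply, LinearMap.smul_apply,
      LinearMap.smul_apply, h12, h22, smul_zero, zero_add, smul_eq_mul] at h4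
    have h5 : c = 0 := by
      rcases mul_eq_zero.mp h4 with h | h
      · exact h
      · exact absurd (neg_eq_zero.mp h) h13
    rw [hsc, h5, zero_smul, add_zero, hs2]
  have h1_3 : ⁅w₁, w₃⁆ = 0 := by
    obtain ⟨s, c, hsc, hs1, hs2⟩ := hdec ⁅w₂, w₃⁆ (hlie _ _)
    -- ad w₂ acts on the line uᗮ / Rᗮ, spanned by the class of w₃, as the scalar c; nilpotency makes
    -- it zero.
    have hc : c = 0 := by
      refine eq_zero_of_ad_semi_invariant (w := w₂) (x := w₃) (f := B w₁) (g := B u)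
        (fun x => hlie _ _) (fun x hx => ?_) hw₃ h13
      obtain ⟨s', c', hsc', hs1', hs2'⟩ := hdec x hx
      rw [hsc', lie_add, lie_smul, hsc]
      simp only [map_add, map_smul, hw2S s' hs1' hs2', hs2, hs2', smul_eq_mul]
      ring
    rw [hc, zero_smul, add_zero] at hsc
    obtain ⟨β, hβ⟩ := hS s hs1 hs2
    have h3 : ⁅w₁, w₃⁆ = β • w₁ := by
      rw [← hβ, ← hsc, leibniz_lie u w₂ w₃, ← hw₁', ← hw₂, lie_self, add_zero]
    exact lie_eq_zero_of_lie_eq_smul_left h3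
  have hV : ∀ x, B u x = 0 → ⁅w₁, x⁆ = 0 := by
    intro x hx
    obtain ⟨s, c, hsc, hs1, hs2⟩ := hdec x hx
    rw [hsc, lie_add, lie_smul, h1_3, hlieS s hs1 hs2]; simp
  -- By `hpol` the vector [ξ, w₁] + ⟨l, ξ⟩ w₁ is orthogonal to uᗮ, hence a multiple of u; the
  -- quadratic identity at ξ shows that the multiple is zero. So w₁ is an eigenvector of ad ξ.
  have hξ0 : ⁅ξ, w₁⁆ = 0 := by
    obtain ⟨c, hc⟩ := exists_eq_smul_of_orthogonal hs hnd (u := u)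
      (z := ⁅ξ, w₁⁆ + B l ξ • w₁) (fun S hS0 => by
        have h1 := hpol ξ S
        rw [← lie_skew S w₁, hV S hS0, hξ1] at h1
        rw [hsy, map_add, map_smul, smul_eq_mul]
        simp only [neg_zero, map_zero, zero_add, mul_zero, add_zero] at h1
        rw [h1]; ring)
    have h2 := hq1 ξ
    rw [eq_sub_of_add_eq hc, map_sub, map_smul, map_smul, hξu, hξ1] at h2
    have hc0 : c = 0 := by simpa using h2
    refine lie_eq_zero_of_lie_eq_smul (c := -B l ξ) ?_
    rw [eq_sub_of_add_eq hc, hc0]; simp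
  have hcentral : ∀ x : L, ⁅x, w₁⁆ = 0 := by
    intro x
    obtain ⟨T', hT, hT'⟩ := hdec' x
    rw [hT, add_lie, smul_lie, hξ0, ← lie_skew, hV T' hT']; simp
  -- Now that w₁ is central, the right side of `hpol` is identically zero. Testing it on w₃, where
  -- ⟨w₁, w₃⟩ ≠ 0, gives l = 0.
  have hl0 : ∀ x, B l x = 0 := by
    intro x
    have h1 := hpol w₃ w₃
    have h2 := hpol x w₃
    rw [hcentral, hcentral, hsy w₃ w₁] at *
    have h3 : B l w₃ = 0 := by
      have : B l w₃ * B w₁ w₃ = 0 := by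
        simp only [map_zero] at h1; linarith
      exact (mul_eq_zero.mp this).resolve_right h13
    rw [h3] at h2
    have : B l x * B w₁ w₃ = 0 := by
      simp only [map_zero] at h2; linarith
    exact (mul_eq_zero.mp this).resolve_right h13
  have hl1 : ⁅u, ξ⁆ = 0 := by
    rw [← hl]
    exact hnd.1 l hl0
  have hDT : ∀ T, ∃ b c : ℝ, ⁅u, T⁆ = b • w₁ + c • w₂ := by
    intro T
    obtain ⟨T', hT, hT'⟩ := hdec' T
    obtain ⟨s, c, hsc, hs1, hs2⟩ := hdec T' hT'
    obtain ⟨β, hβ⟩ := hS s hs1 hs2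
    refine ⟨β, c, ?_⟩
    rw [hT, lie_add, lie_smul, hl1, hsc, lie_add, hβ, lie_smul, ← hw₂]; simp
  have hDD : ∀ T, ∃ c : ℝ, ⁅u, ⁅u, T⁆⁆ = c • w₁ := by
    intro T
    obtain ⟨b, c, h⟩ := hDT T
    refine ⟨c, ?_⟩
    rw [h, lie_add, lie_smul, lie_smul, hw₁, ← hw₁']; simp
  -- Expand by Leibniz: (ad u)² takes values in the central line ℝw₁, and ad u in the abelian span
  -- of w₁ and w₂.
  have hDDlie : ∀ x y : L, ⁅u, ⁅u, ⁅x, y⁆⁆⁆ = 0 := by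
    intro x y
    obtain ⟨b, c, h⟩ := hDT x
    obtain ⟨b', c', h'⟩ := hDT y
    obtain ⟨d, hd⟩ := hDD x
    obtain ⟨d', hd'⟩ := hDD y
    have hc' : ∀ x : L, ⁅w₁, x⁆ = 0 := fun x => by rw [← lie_skew, hcentral]; simp
    have h0 : ⁅⁅u, x⁆, ⁅u, y⁆⁆ = 0 := by
      rw [h, h']
      simp [hcentral, hc']
    rw [leibniz_lie u x y, lie_add, leibniz_lie u ⁅u, x⁆ y, leibniz_lie u x ⁅u, y⁆, hd, hd', h0,
      smul_lie, lie_smul, hcentral, hc']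
    simp
  -- Moving ad u across the form twice turns ⟨w₁, [y, z]⟩ into ⟨w₃, (ad u)² [y, z]⟩ = 0. Hence w₁
  -- belongs to the radical ℝu, which it does not.
  have hperp : ∀ y z : L, B w₁ ⁅y, z⁆ = 0 := by
    intro y z
    have h1 := hskew w₂ ⁅y, z⁆ hu2 (hlie _ _)
    have h2 := hskew w₃ ⁅u, ⁅y, z⁆⁆ hw₃ (hlie _ _)
    rw [hDDlie, map_zero, add_zero, ← hw₂] at h2
    rw [h2, add_zero, ← hw₁'] at h1
    exact h1
  obtain ⟨c, hc⟩ := hr w₁ (by rw [hw₁']; exact lie_mem_derivedSubspace _ _) hperp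
  exact h1u c hc

end LineCase

/-! ### The isotropic subspace e and its centralizer. -/

section DerivedRadical

variable {L : Type*} [LieRing L] [LieAlgebra ℝ L] {B : LinearMap.BilinForm ℝ L}
  [FiniteDimensional ℝ L] [LieRing.IsNilpotent L]

/-- If ad u ≠ 0 on uᗮ, its last nonzero power on some vector supplies w = [u, a] with [u, w] = 0,
and u, w span a maximal isotropic plane. A vector of uᗮ not orthogonal to w then starts a chain of
length three, which has been excluded. -/
lemma lie_eq_zero_of_radical_line (hs : B.IsSymm) (hnd : B.Nondegenerate) (hGO : IsAlgebraicGO B)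
    (hB : ∀ W : Submodule ℝ L, (∀ x ∈ W, B x x ≤ 0) → Module.finrank ℝ W ≤ 2) {u : L}
    (hu : u ≠ 0) (hud : u ∈ derivedSubspace L) (hlie : ∀ x y : L, B u ⁅x, y⁆ = 0)
    (hr : ∀ x ∈ derivedSubspace L, (∀ y z : L, B x ⁅y, z⁆ = 0) → ∃ c : ℝ, x = c • u)
    (hinv : ∀ D, IsSkewDerivation B D → ∃ c : ℝ, D u = c • u) {x : L} (hx : B u x = 0) :
    ⁅u, x⁆ = 0 := by
  have hskew : ∀ x y, B u x = 0 → B u y = 0 → B ⁅u, x⁆ y + B x ⁅u, y⁆ = 0 := by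
    intro x y hx hy
    refine hGO.lie_skew_apply (W := Submodule.span ℝ {u}) ?_ hs
      (Submodule.mem_span_singleton_self u) ?_ ?_
    · intro D hD z hz
      obtain ⟨c, rfl⟩ := Submodule.mem_span_singleton.mp hz
      obtain ⟨c', hc'⟩ := hinv D hD
      rw [map_smul, hc', smul_smul]
      exact Submodule.mem_span_singleton.mpr ⟨_, rfl⟩
    · intro z hz
      obtain ⟨c, rfl⟩ := Submodule.mem_span_singleton.mp hz
      simp [hx]
    · intro z hz
      obtain ⟨c, rfl⟩ := Submodule.mem_span_singleton.mp hz
      simp [hy]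
  by_contra hne
  have hsy : ∀ x y, B x y = B y x := hs.eq
  -- `a` is the iterate of `x` two steps before ad u annihilates it.
  obtain ⟨a, hua, hw0, hDw⟩ : ∃ a, B u a = 0 ∧ ⁅u, a⁆ ≠ 0 ∧ ⁅u, ⁅u, a⁆⁆ = 0 := by
    have h1 : ∃ m, ((LieAlgebra.ad ℝ L u) ^ m) x = 0 := by
      obtain ⟨m, hm⟩ := exists_ad_pow_eq_zero u
      exact ⟨m, by rw [hm]; rfl⟩
    classical
    obtain ⟨k, hk⟩ : ∃ k, Nat.find h1 = k + 2 := by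
      refine ⟨Nat.find h1 - 2, ?_⟩
      have h2 : 2 ≤ Nat.find h1 := by
        rw [Nat.le_find_iff]
        intro m hm
        interval_cases m
        · intro h; apply hne
          rw [pow_zero] at h
          rw [show x = 0 from h, lie_zero]
        · intro h; apply hne
          simpa using h
      omega
    have h3 := Nat.find_spec h1
    have h4 := Nat.find_min h1 (m := k + 1) (by omega)
    rw [hk, pow_succ', pow_succ', Module.End.mul_apply, Module.End.mul_apply] at h3
    rw [pow_succ', Module.End.mul_apply] at h4
    refine ⟨((LieAlgebra.ad ℝ L u) ^ k) x, ?_, h4, h3⟩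
    cases k with
    | zero => simpa using hx
    | succ k => rw [pow_succ', Module.End.mul_apply]; exact hlie _ _
  obtain ⟨w, hw⟩ : ∃ w, w = ⁅u, a⁆ := ⟨_, rfl⟩
  rw [← hw] at hw0 hDw
  have huu : B u u = 0 := by
    rw [derivedSubspace_eq_span] at hud
    have : Submodule.span ℝ {z | ∃ x y : L, ⁅x, y⁆ = z} ≤ LinearMap.ker (B u) := by
      rw [Submodule.span_le]
      rintro _ ⟨x, y, rfl⟩
      exact hlie x y
    exact this hud
  have huD : ∀ y (c : ℝ), c • u = ⁅u, y⁆ → c = 0 := by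
    intro y c h
    have h1 := lie_eq_zero_of_lie_eq_smul_left h.symm
    rw [← h] at h1
    exact (smul_eq_zero.mp h1).resolve_right hu
  have huw : B u w = 0 := by rw [hw]; exact hlie _ _
  have hww : B w w = 0 := by
    have := hskew a w hua huw
    rwa [hDw, map_zero, add_zero, ← hw] at this
  have hwa : B w a = 0 := by
    have := hskew a a hua hua
    rw [← hw, hsy a w] at this
    linarith
  have hwu : ∀ c : ℝ, w ≠ c • u := by
    intro c h
    have := huD a c (by rw [← h, hw])
    rw [this, zero_smul] at h
    exact hw0 h
  have hR := mem_span_pair_of_nonpos hs hB hu hwu huu huw hww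
  have hRorth : ∀ x, B u x = 0 → B w x = 0 → ∀ r ∈ Submodule.span ℝ {u, w}, B r x = 0 := by
    intro x h1 h2 r hr
    obtain ⟨a, b, rfl⟩ := Submodule.mem_span_pair.mp hr
    simp [h1, h2]
  have hRorth' : ∀ x, (∀ r ∈ Submodule.span ℝ {u, w}, B r x = 0) → B u x = 0 ∧ B w x = 0 :=
    fun x h => ⟨h u (Submodule.subset_span (by simp)), h w (Submodule.subset_span (by simp))⟩
  have hRD : ∀ y, ⁅u, y⁆ ∈ Submodule.span ℝ {u, w} → ∃ b : ℝ, ⁅u, y⁆ = b • w := by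
    intro y h3
    obtain ⟨α, b, hab⟩ := Submodule.mem_span_pair.mp h3
    have h4 := huD (y - b • a) α (by rw [lie_sub, ← hab, lie_smul, ← hw]; abel)
    rw [h4, zero_smul, zero_add] at hab
    exact ⟨b, hab.symm⟩
  have hS : ∀ x, B u x = 0 → B w x = 0 → ∃ b : ℝ, ⁅u, x⁆ = b • w := by
    intro x h1 h2
    obtain ⟨m, hm⟩ := exists_ad_pow_eq_zero u
    refine hRD x (mem_of_isNilpotent_skew hR hm ?_ ?_ (hRorth x h1 h2))
    · intro y hy
      have hy := hRorth' y hy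
      refine hRorth _ (hlie _ _) ?_
      have := hskew w y huw hy.1
      rwa [hDw, map_zero, LinearMap.zero_apply, zero_add] at this
    · intro y z hy hz
      exact hskew y z (hRorth' y hy).1 (hRorth' z hz).1
  obtain ⟨w₃, hw3, hww3⟩ : ∃ w₃, B u w₃ = 0 ∧ B w w₃ ≠ 0 := by
    by_contra! h
    obtain ⟨c, hc⟩ := exists_eq_smul_of_orthogonal hs hnd h
    exact hwu c hc
  have hw2 : B w ⁅u, w₃⁆ = 0 := by
    have := hskew w w₃ huw hw3
    rwa [hDw, map_zero, LinearMap.zero_apply, zero_add] at this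
  obtain ⟨b, hb⟩ := hS ⁅u, w₃⁆ (hlie _ _) hw2
  refine false_of_ad_sq_ne_zero hs hnd hGO hB hu hud hlie hr hinv hskew hw3 ?_
    (by rw [hb, lie_smul, hDw, smul_zero])
  -- If (ad u)² w₃ = 0, then [u, w₃] is a null vector orthogonal to u and w, hence of the form c w,
  -- and skewness gives c = 0. But then ⟨w, w₃⟩ = -⟨a, [u, w₃]⟩ = 0.
  intro h0
  have h1 : B ⁅u, w₃⁆ ⁅u, w₃⁆ = 0 := by
    have := hskew w₃ ⁅u, w₃⁆ hw3 (hlie _ _)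
    rwa [h0, map_zero, add_zero] at this
  obtain ⟨c, hc⟩ := hRD w₃ (hR _ (hRorth _ (hlie _ _) hw2) h1.le)
  have h2 := hskew w₃ w₃ hw3 hw3
  have h3 : ⁅u, w₃⁆ = 0 := by
    rw [hc, map_smul, map_smul, LinearMap.smul_apply, hsy w₃ w, smul_eq_mul] at h2
    have h4 : c * B w w₃ = 0 := by linarith
    rw [hc, (mul_eq_zero.mp h4).resolve_right hww3, zero_smul]
  have h5 := hskew a w₃ hua hw3
  rw [h3, map_zero, add_zero, ← hw] at h5
  exact hww3 h5

/-- ad u is skew on uᗮ and kills Rᗮ, so [u, x] lies in Rᗮᗮ = R. If it is nonzero it is independent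
of u, and R is spanned by u and [u, x]. Both are orthogonal to x, so x ∈ Rᗮ and [u, x] = 0 after
all. -/
lemma lie_eq_zero_of_radical_plane (hs : B.IsSymm) (hnd : B.Nondegenerate) (hGO : IsAlgebraicGO B)
    {R : Submodule ℝ L} (hR2 : Module.finrank ℝ R = 2) {u : L} (hu : u ≠ 0) (huR : u ∈ R)
    (hinv : ∀ D, IsSkewDerivation B D → ∃ c : ℝ, D u = c • u)
    (hlie : ∀ T, T ∈ B.orthogonal R → ⁅u, T⁆ = 0) {x : L} (hx : B u x = 0) : ⁅u, x⁆ = 0 := by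
  have hsy : ∀ x y, B x y = B y x := hs.eq
  have hskew : ∀ x y, B u x = 0 → B u y = 0 → B ⁅u, x⁆ y + B x ⁅u, y⁆ = 0 := by
    intro x y hx hy
    refine hGO.lie_skew_apply (W := Submodule.span ℝ {u}) ?_ hs
      (Submodule.mem_span_singleton_self u) ?_ ?_
    · intro D hD z hz
      obtain ⟨c, rfl⟩ := Submodule.mem_span_singleton.mp hz
      obtain ⟨c', hc'⟩ := hinv D hD
      rw [map_smul, hc', smul_smul]
      exact Submodule.mem_span_singleton.mpr ⟨_, rfl⟩
    · intro z hz
      obtain ⟨c, rfl⟩ := Submodule.mem_span_singleton.mp hz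
      simp [hx]
    · intro z hz
      obtain ⟨c, rfl⟩ := Submodule.mem_span_singleton.mp hz
      simp [hy]
  by_contra hne
  have h1 : ⁅u, x⁆ ∈ R := by
    rw [← LinearMap.BilinForm.orthogonal_orthogonal hnd hs.isRefl R]
    intro T hT
    change B T ⁅u, x⁆ = 0
    have h2 := hskew x T hx (hT u huR)
    rw [hlie T hT, map_zero, add_zero] at h2
    rw [hsy, h2]
  have h3 : B ⁅u, x⁆ x = 0 := by
    have := hskew x x hx hx
    rw [hsy x] at this; linarith
  have h4 : ∀ c : ℝ, ⁅u, x⁆ ≠ c • u := fun c h => hne (lie_eq_zero_of_lie_eq_smul_left h)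
  have h5 : Submodule.span ℝ {u, ⁅u, x⁆} = R := by
    refine Submodule.eq_of_le_of_finrank_le ?_ ?_
    · rw [Submodule.span_le]
      rintro z (rfl | rfl)
      · exact huR
      · exact h1
    · rw [hR2, finrank_span_pair_eq_two hu h4]
  apply hne
  apply hlie
  intro z hz
  rw [← h5] at hz
  obtain ⟨a, b, rfl⟩ := Submodule.mem_span_pair.mp hz
  change B _ x = 0
  simp [hx, h3]

/-- The isotropic ideal by which a geodesic orbit metric Lie algebra with degenerate derived
algebra is reduced. -/
theorem exists_isotropic_of_degenerate (hs : B.IsSymm) (hnd : B.Nondegenerate)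
    (hGO : IsAlgebraicGO B)
    (hB : ∀ W : Submodule ℝ L, (∀ x ∈ W, B x x ≤ 0) → Module.finrank ℝ W ≤ 2)
    (hdeg : ¬ (B.restrict (derivedSubspace L)).Nondegenerate) :
    ∃ e : Submodule ℝ L, e ≤ derivedSubspace L ∧ e ≤ B.orthogonal (derivedSubspace L) ∧
      (∀ x ∈ e, ∀ y ∈ B.orthogonal e, ⁅x, y⁆ = 0) ∧
      (∀ D, IsSkewDerivation B D → ∀ x ∈ e, D x ∈ e) ∧
      (Module.finrank ℝ e = 1 ∨ Module.finrank ℝ e = 2) := by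
  have hsy : ∀ x y, B x y = B y x := hs.eq
  set d := derivedSubspace L with hd
  set r := d ⊓ B.orthogonal d with hrdef
  have hr0 : r ≠ ⊥ := by
    intro h
    exact hdeg (LinearMap.BilinForm.nondegenerate_restrict_of_disjoint_orthogonal B hs.isRefl
      (disjoint_iff.mpr h))
  have hrlie : ∀ u ∈ r, ∀ x y : L, B u ⁅x, y⁆ = 0 := fun u hu x y => by
    rw [hsy]; exact hu.2 _ (lie_mem_derivedSubspace x y)
  have hrr : ∀ u ∈ r, B u u = 0 := fun u hu => hu.2 u hu.1
  have hrinv : ∀ D, IsSkewDerivation B D → ∀ x ∈ r, D x ∈ r := fun D hD x hx =>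
    ⟨hD.mem_derivedSubspace hx.1, hD.mem_orthogonal (fun y hy => hD.mem_derivedSubspace hy) hx.2⟩
  have hr2 : Module.finrank ℝ r ≤ 2 := hB r fun x hx => (hrr x hx).le
  let C : ℕ → Submodule ℝ L := fun k => (LieModule.lowerCentralSeries ℝ L L k).toSubmodule
  -- e is cut out of r at the last step of the lower central series that meets r, so that a bracket
  -- with an element of e which falls back into r is zero.
  obtain ⟨k, hk, hk'⟩ : ∃ k, r ⊓ C k ≠ ⊥ ∧ r ⊓ C (k + 1) = ⊥ := by
    by_contra! h
    have h1 : ∀ k, r ⊓ C k ≠ ⊥ := by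
      intro k
      induction k with
      | zero => simpa [C] using hr0
      | succ k ih => exact h k ih
    obtain ⟨k, hk⟩ := LieModule.IsNilpotent.nilpotent ℝ L L
    exact h1 k (by simp [C, hk])
  set e := r ⊓ C k with he
  have hecc : ∀ D, IsSkewDerivation B D → ∀ x ∈ e, D x ∈ e := fun D hD x hx =>
    ⟨hrinv D hD x hx.1, derivation_mem_lowerCentralSeries hD.leibniz k hx.2⟩
  have her : Module.finrank ℝ e ≤ Module.finrank ℝ r := Submodule.finrank_mono inf_le_left
  have he0 : Module.finrank ℝ e ≠ 0 := fun h => hk (Submodule.finrank_eq_zero.mp h)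
  refine ⟨e, inf_le_left.trans inf_le_left, inf_le_left.trans inf_le_right, ?_, hecc, by omega⟩
  -- A plane r is maximal isotropic and orthogonal to all brackets. Hence ad u maps rᗮ into r, and
  -- also into the next term of the series, where nothing of r is left.
  have hplane : Module.finrank ℝ r = 2 → ∀ u ∈ e, ∀ T ∈ B.orthogonal r, ⁅u, T⁆ = 0 := by
    intro h2 u hu T hT
    obtain ⟨m, hm⟩ := exists_ad_pow_eq_zero u
    have h3 : ⁅u, T⁆ ∈ r := by
      refine mem_of_isNilpotent_skew (fun x => mem_of_isotropic_of_nonpos hs hB hrr h2 x) hm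
        (fun x _ s hs => hrlie s hs _ _) (fun x y hx hy => ?_) hT
      exact hGO.lie_skew_apply hrinv hs hu.1 hx hy
    have h4 : ⁅u, T⁆ ∈ r ⊓ C (k + 1) := by
      refine ⟨h3, ?_⟩
      rw [← lie_skew]
      exact neg_mem (lie_mem_lowerCentralSeries_succ T hu.2)
    rw [hk'] at h4
    simpa using h4
  have hline : Module.finrank ℝ e = 1 → ∃ u ∈ e, u ≠ 0 ∧ (∀ x ∈ e, ∃ c : ℝ, x = c • u) ∧
      ∀ D, IsSkewDerivation B D → ∃ c : ℝ, D u = c • u := by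
    intro h
    obtain ⟨⟨u, hu⟩, hu0, hspan⟩ := finrank_eq_one_iff'.mp h
    have h1 : ∀ x ∈ e, ∃ c : ℝ, x = c • u := fun x hx => by
      obtain ⟨c, hc⟩ := hspan ⟨x, hx⟩
      exact ⟨c, (congrArg Subtype.val hc).symm⟩
    exact ⟨u, hu, fun h => hu0 (Subtype.ext h), h1, fun D hD => h1 _ (hecc D hD u hu)⟩
  have hfin : Module.finrank ℝ e = 1 ∨ Module.finrank ℝ e = 2 := by omega
  rcases hfin with h1 | h2
  · obtain ⟨u, hue, hu0, hspan, hinv⟩ := hline h1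
    intro x hx y hy
    obtain ⟨c, rfl⟩ := hspan x hx
    have huy : B u y = 0 := hy u hue
    rw [smul_lie]
    have h3 : Module.finrank ℝ r = 1 ∨ Module.finrank ℝ r = 2 := by omega
    rcases h3 with h3 | h3
    · have h4 : e = r := Submodule.eq_of_le_of_finrank_eq inf_le_left (h1.trans h3.symm)
      rw [lie_eq_zero_of_radical_line hs hnd hGO hB hu0 hue.1.1 (hrlie u hue.1) ?_ hinv huy,
        smul_zero]
      intro z hz hz'
      apply hspan
      rw [h4]
      refine ⟨hz, fun w hw => ?_⟩
      change B w z = 0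
      rw [hsy]
      have h5 : d ≤ LinearMap.ker (B z) := by
        rw [hd, derivedSubspace_eq_span, Submodule.span_le]
        rintro _ ⟨x, y, rfl⟩
        exact hz' x y
      exact h5 hw
    · rw [lie_eq_zero_of_radical_plane hs hnd hGO h3 hu0 hue.1 hinv (hplane h3 u hue) huy, smul_zero]
  · have h3 : Module.finrank ℝ r = 2 := by omega
    have h4 : e = r := Submodule.eq_of_le_of_finrank_eq inf_le_left (h2.trans h3.symm)
    intro x hx y hy
    rw [h4] at hy
    exact hplane h3 x hx y hy

end DerivedRadical

/-! ### A trace argument for skew operators. -/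

section TraceArgument

variable {V : Type*} [AddCommGroup V] [Module ℝ V]

/-- A skew operator is trace-orthogonal to a symmetric form, so if `G (x, A x) ≥ 0` throughout
then it vanishes on an orthogonal basis. -/
lemma exists_basis_apply_skew_eq_zero [FiniteDimensional ℝ V] {B G : LinearMap.BilinForm ℝ V}
    (hs : B.IsSymm) (hpos : ∀ x, x ≠ 0 → 0 < B x x) {A : V →ₗ[ℝ] V}
    (hA : ∀ x y, B (A x) y + B x (A y) = 0) (hG : ∀ x y, G x y = G y x)
    (hGA : ∀ x, 0 ≤ G x (A x)) :
    ∃ b : Module.Basis (Fin (Module.finrank ℝ V)) ℝ V, ∀ i, G (b i) (A (b i)) = 0 := by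
  obtain ⟨b, hb⟩ := LinearMap.BilinForm.exists_orthogonal_basis (LinearMap.BilinForm.isSymm_iff.mp hs)
  refine ⟨b, ?_⟩
  have hc : ∀ i, 0 < B (b i) (b i) := fun i => hpos _ (b.ne_zero i)
  have ho : ∀ i j, i ≠ j → B (b i) (b j) = 0 := fun i j h => hb h
  have hrepr : ∀ i j, B (A (b i)) (b j) = b.repr (A (b i)) j * B (b j) (b j) := by
    intro i j
    conv_lhs => rw [← b.sum_repr (A (b i))]
    simp only [map_sum, map_smul, LinearMap.sum_apply, LinearMap.smul_apply, smul_eq_mul]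
    rw [Finset.sum_eq_single j (fun l _ hl => by rw [ho l j hl, mul_zero]) (by simp)]
  -- Divided by ⟨bᵢ, bᵢ⟩, the matrix of A is antisymmetric. Its contraction with the symmetric G,
  -- the sum in `hsum`, therefore vanishes.
  have hanti : ∀ i j, b.repr (A (b i)) j / B (b i) (b i) = - (b.repr (A (b j)) i / B (b j) (b j)) := by
    intro i j
    have h1 := hA (b i) (b j)
    rw [hs.eq (b i), hrepr, hrepr] at h1
    have h2 := (hc i).ne'
    have h3 := (hc j).ne'
    field_simp
    linarith
  have hexp : ∀ i, G (b i) (A (b i)) / B (b i) (b i)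
      = ∑ j, b.repr (A (b i)) j / B (b i) (b i) * G (b i) (b j) := by
    intro i
    conv_lhs => rw [← b.sum_repr (A (b i))]
    simp only [map_sum, map_smul, smul_eq_mul, Finset.sum_div]
    exact Finset.sum_congr rfl fun j _ => by ring
  have hsum : ∑ i, G (b i) (A (b i)) / B (b i) (b i) = 0 := by
    have h1 : ∑ i, G (b i) (A (b i)) / B (b i) (b i)
        = - ∑ i, G (b i) (A (b i)) / B (b i) (b i) := by
      conv_lhs => rw [Finset.sum_congr rfl fun i _ => hexp i, Finset.sum_comm]
      rw [Finset.sum_congr rfl fun i _ => hexp i, ← Finset.sum_neg_distrib]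
      refine Finset.sum_congr rfl fun i _ => ?_
      rw [← Finset.sum_neg_distrib]
      refine Finset.sum_congr rfl fun j _ => ?_
      rw [hanti j i, hG (b j)]
      ring
    linarith
  intro i
  have h1 := (Finset.sum_eq_zero_iff_of_nonneg
    (fun i _ => div_nonneg (hGA (b i)) (hc i).le)).mp hsum i (Finset.mem_univ i)
  exact (div_eq_zero_iff.mp h1).resolve_right (hc i).ne'

end TraceArgument

/-! ### Index at most one: the constant k can be taken to be zero. -/

section Lorentz

variable {L : Type*} [LieRing L] [LieAlgebra ℝ L] {B : LinearMap.BilinForm ℝ L}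

/-- If a skew derivation has null eigenvectors `u`, `v` with eigenvalues `k`, `-k ≠ 0` spanning a
hyperbolic plane with positive definite complement, then the complement centralizes `v`. -/
lemma lie_eq_zero_of_boost [FiniteDimensional ℝ L] [LieRing.IsNilpotent L] (hs : B.IsSymm)
    {A : L →ₗ[ℝ] L} (hA : IsSkewDerivation B A) {k : ℝ} (hk : k ≠ 0) {u v : L} (hu : A u = k • u)
    (hv : A v = -k • v) (huu : B u u = 0) (hvv : B v v = 0) (huv : B u v ≠ 0)
    (hpos : ∀ x, B u x = 0 → B v x = 0 → x ≠ 0 → 0 < B x x) {p : L} (hup : B u p = 0)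
    (hvp : B v p = 0) : ⁅p, v⁆ = 0 := by
  have hsy : ∀ x y, B x y = B y x := hs.eq
  let P : Submodule ℝ L := LinearMap.ker (B u) ⊓ LinearMap.ker (B v)
  have hPu : ∀ x : P, B u x = 0 := fun x => x.2.1
  have hPv : ∀ x : P, B v x = 0 := fun x => x.2.2
  have hAP : ∀ x ∈ P, A x ∈ P := by
    rintro x ⟨h1, h2⟩
    have h3 := hA.skew u x
    have h4 := hA.skew v x
    replace h1 : B u x = 0 := h1
    replace h2 : B v x = 0 := h2
    rw [hu, map_smul, LinearMap.smul_apply, h1, smul_zero, zero_add] at h3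
    rw [hv, map_smul, LinearMap.smul_apply, h2, smul_zero, zero_add] at h4
    exact ⟨h3, h4⟩
  let φ : P →ₗ[ℝ] L := (LieAlgebra.ad ℝ L v).comp P.subtype
  let α : L →ₗ[ℝ] ℝ := (B u v)⁻¹ • B v
  let b : L →ₗ[ℝ] ℝ := (B u v)⁻¹ • B u
  have hα : ∀ x, α x = (B u v)⁻¹ * B v x := fun x => rfl
  have hb : ∀ x, b x = (B u v)⁻¹ * B u x := fun x => rfl
  -- For y = α u + b v + q this is the form k (α α' + ⟨q, q'⟩). The operator A + k doubles k on u,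
  -- kills v and is k plus a skew map on q, so that G₀(y, (A + k) y) = k² (2α² + ⟨q, q⟩) ≥ 0. By
  -- `hφA`, ad v intertwines A with A + k, and so the pullback along ad v has the sign that the
  -- trace argument requires.
  let G₀ : LinearMap.BilinForm ℝ L := k • (LinearMap.BilinForm.linMulLin α α + B
    - B u v • (LinearMap.BilinForm.linMulLin α b + LinearMap.BilinForm.linMulLin b α))
  have hG₀ : ∀ x y, G₀ x y = k * (α x * α y + B x y - B u v * (α x * b y + b x * α y)) := by
    intro x y; simp [G₀]; ring_nf; simp
  let G : LinearMap.BilinForm ℝ P := G₀.compl₁₂ φ φ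
  have hG : ∀ x y : P, G x y = G₀ ⁅v, (x : L)⁆ ⁅v, (y : L)⁆ := fun x y => rfl
  have hdecomp : ∀ y, ∃ q, y = α y • u + b y • v + q ∧ B u q = 0 ∧ B v q = 0 := by
    intro y
    refine ⟨y - (α y • u + b y • v), by abel, ?_, ?_⟩
    · simp only [map_sub, map_add, map_smul, huu, smul_eq_mul, hb]
      field_simp
      ring
    · simp only [map_sub, map_add, map_smul, hvv, hsy v u, smul_eq_mul, hα]
      field_simp
      ring
  have hGval : ∀ y, ∃ q, y = α y • u + b y • v + q ∧ B u q = 0 ∧ B v q = 0 ∧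
      G₀ y (A y + k • y) = k ^ 2 * (2 * α y ^ 2 + B q q) := by
    intro y
    obtain ⟨q, hy, huq, hvq⟩ := hdecomp y
    refine ⟨q, hy, huq, hvq, ?_⟩
    have h1 : B u (A y) = - k * B u y := by
      have := hA.skew u y
      rw [hu, map_smul, LinearMap.smul_apply, smul_eq_mul] at this
      linarith
    have h2 : B v (A y) = k * B v y := by
      have := hA.skew v y
      rw [hv, map_smul, LinearMap.smul_apply, smul_eq_mul] at this
      linarith
    have h3 : B y (A y) = 0 := by
      have := hA.skew y y
      rw [hsy (A y) y] at this
      linarith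
    have h4 : B y y = 2 * B u v * α y * b y + B q q := by
      conv_lhs => rw [hy]
      simp only [map_add, map_smul, LinearMap.add_apply, LinearMap.smul_apply, smul_eq_mul, huu,
        hvv, huq, hvq, hsy q u, hsy q v, hsy v u]
      ring
    rw [hG₀]
    simp only [map_add, map_smul, smul_eq_mul, h3]
    rw [hα (A y), hb (A y), h1, h2, h4, show (B u v)⁻¹ * (k * B v y) = k * α y by rw [hα]; ring,
      show (B u v)⁻¹ * (-k * B u y) = -k * b y by rw [hb]; ring]
    ring
  have hφA : ∀ x : L, ⁅v, A x⁆ = A ⁅v, x⁆ + k • ⁅v, x⁆ := by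
    intro x
    rw [hA.leibniz, hv, smul_lie, neg_smul]
    abel
  have hqpos : ∀ q, B u q = 0 → B v q = 0 → 0 ≤ B q q := by
    intro q h1 h2
    by_cases hq : q = 0
    · simp [hq]
    · exact (hpos q h1 h2 hq).le
  obtain ⟨e, he⟩ := exists_basis_apply_skew_eq_zero (B := B.restrict P) (G := G)
    (A := A.restrict hAP) ⟨fun x y => hsy x y⟩
    (fun x hx => hpos x (hPu x) (hPv x) fun h => hx (Subtype.ext h))
    (fun x y => hA.skew x y)
    (fun x y => by rw [hG, hG, hG₀, hG₀, hsy]; ring)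
    (fun x => by
      rw [hG, LinearMap.coe_restrict_apply, hφA]
      obtain ⟨q, -, h1, h2, h3⟩ := hGval ⁅v, (x : L)⁆
      rw [h3]
      have := hqpos q h1 h2
      positivity)
  -- Vanishing on the basis leaves only the component of `⁅v, e i⁆` along v, and nilpotency removes
  -- it.
  have hφ : φ = 0 := by
    refine e.ext fun i => ?_
    have h0 := he i
    rw [hG, LinearMap.coe_restrict_apply, hφA] at h0
    obtain ⟨q, hy, h1, h2, h3⟩ := hGval ⁅v, (e i : L)⁆
    rw [h3] at h0
    have h4 := hqpos q h1 h2
    have h5 := (mul_eq_zero.mp h0).resolve_left (pow_ne_zero 2 hk)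
    have h6 : α ⁅v, (e i : L)⁆ = 0 := by nlinarith [sq_nonneg (α ⁅v, (e i : L)⁆)]
    have h7 : q = 0 := by
      by_contra hq
      nlinarith [hpos q h1 h2 hq]
    rw [h6, h7, zero_smul, zero_add, add_zero] at hy
    exact lie_eq_zero_of_lie_eq_smul_left hy
  have h1 : ⁅v, p⁆ = 0 := LinearMap.congr_fun hφ ⟨p, hup, hvp⟩
  rw [← lie_skew, h1, neg_zero]

/-- If `T ≠ 0` is a geodesic vector with `k ≠ 0`, then `-k` is an eigenvalue of the derivation. -/
lemma exists_eigenvector_neg [FiniteDimensional ℝ L] [LieRing.IsNilpotent L]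
    (hnd : B.Nondegenerate) (hs : B.IsSymm) {A : L →ₗ[ℝ] L} (hA : IsSkewDerivation B A) {k : ℝ} {T : L}
    (hT : T ≠ 0) (h : ∀ w, B T ⁅T, w⁆ = B (A T) w + k * B T w) :
    ∃ v, v ≠ 0 ∧ A v = -k • v := by
  let f : L →ₗ[ℝ] L := A + k • LinearMap.id
  have hf : ∀ x, f x = A x + k • x := fun x => rfl
  by_contra! hno
  have hinj : Function.Injective f := by
    rw [injective_iff_map_eq_zero]
    intro v hv
    by_contra hv0
    exact hno v hv0 (by rw [neg_smul]; exact eq_neg_of_add_eq_zero_left hv)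
  let C : ℕ → Submodule ℝ L := fun j => (LieModule.lowerCentralSeries ℝ L L j).toSubmodule
  obtain ⟨c, hc⟩ : ∃ c, C c = ⊥ := by
    obtain ⟨c, hc⟩ := (LieModule.isNilpotent_iff ℝ L L).mp inferInstance
    exact ⟨c, by simp [C, hc]⟩
  -- The condition on T says ⟨T, [T, w]⟩ = ⟨(A + k) T, w⟩. If T ⊥ `C (j + 1)`, then (A + k) T ⊥ `C
  -- j`. As A + k is bijective on the orthogonal complement of `C j`, also T ⊥ `C j`.
  have key : ∀ j, T ∈ B.orthogonal (C j) → T ∈ B.orthogonal (C 0) := by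
    intro j
    induction j with
    | zero => exact id
    | succ j ih =>
      refine fun hj => ih ?_
      have hfC : ∀ x ∈ B.orthogonal (C j), f x ∈ B.orthogonal (C j) := fun x hx =>
        add_mem (hA.mem_orthogonal (fun y hy => derivation_mem_lowerCentralSeries hA.leibniz j hy) hx)
          (Submodule.smul_mem _ _ hx)
      have hfT : f T ∈ B.orthogonal (C j) := by
        intro w hw
        change B w (f T) = 0
        rw [hs.eq, hf, map_add, LinearMap.add_apply, map_smul, LinearMap.smul_apply, smul_eq_mul,
          ← h w, hs.eq]
        exact hj _ (lie_mem_lowerCentralSeries_succ T hw)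
      have hsurj := LinearMap.surjective_of_injective (f := f.restrict hfC)
        fun x y hxy => Subtype.ext (hinj (congrArg Subtype.val hxy))
      obtain ⟨y, hy⟩ := hsurj ⟨f T, hfT⟩
      have h1 : (y : L) = T := hinj (congrArg Subtype.val hy)
      exact h1 ▸ y.2
  have h0 := key c (by rw [hc]; intro x hx; rw [(Submodule.mem_bot ℝ).mp hx]; simp)
  refine hT (hnd.1 T fun x => ?_)
  rw [hs.eq]
  exact h0 x (by simp [C])

/-- The adjoint of A + k is k - A, so its kernel is the orthogonal complement of the range of A + k,
a proper subspace. -/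
lemma exists_eigenvector_of_skew [FiniteDimensional ℝ L] (hnd : B.Nondegenerate) (hs : B.IsSymm)
    {A : L →ₗ[ℝ] L} (hA : ∀ x y, B (A x) y + B x (A y) = 0) {k : ℝ} {v : L} (hv0 : v ≠ 0)
    (hv : A v = -k • v) : ∃ u, u ≠ 0 ∧ A u = k • u := by
  let f : L →ₗ[ℝ] L := A + k • LinearMap.id
  have hf : ∀ x, f x = A x + k • x := fun x => rfl
  have hfv : f v = 0 := by rw [hf, hv, neg_smul, neg_add_cancel]
  have hr : LinearMap.range f ≠ ⊤ := fun h => hv0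
    ((LinearMap.injective_iff_surjective.mpr (LinearMap.range_eq_top.mp h)) (hfv.trans (map_zero f).symm))
  have ho : B.orthogonal (LinearMap.range f) ≠ ⊥ := by
    intro h
    have h1 := LinearMap.BilinForm.orthogonal_orthogonal hnd hs.isRefl (LinearMap.range f)
    rw [h, LinearMap.BilinForm.orthogonal_bot] at h1
    exact hr h1.symm
  obtain ⟨u, hu, hu0⟩ := Submodule.exists_mem_ne_zero_of_ne_bot ho
  refine ⟨u, hu0, sub_eq_zero.mp (hnd.1 _ fun x => ?_)⟩
  have h1 : B (f x) u = 0 := hu (f x) ⟨x, rfl⟩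
  have h2 := hA u x
  rw [hs.eq, hf, map_add, map_smul, smul_eq_mul] at h1
  rw [map_sub, LinearMap.sub_apply, map_smul, LinearMap.smul_apply, smul_eq_mul]
  linarith

/-- For Lorentz metrics (and Riemannian ones) geodesic vectors satisfy the geodesic orbit condition
with `k = 0`, possibly after changing the derivation. -/
theorem IsAlgebraicGO.exists_skewDerivation [FiniteDimensional ℝ L] [LieRing.IsNilpotent L]
    (hs : B.IsSymm) (hnd : B.Nondegenerate)
    (hB : ∀ W : Submodule ℝ L, (∀ x ∈ W, B x x ≤ 0) → Module.finrank ℝ W ≤ 1)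
    (hGO : IsAlgebraicGO B) (T : L) :
    ∃ D : L →ₗ[ℝ] L, IsSkewDerivation B D ∧ ∀ w, B T ⁅T, w⁆ = B (D T) w := by
  have hsy : ∀ x y, B x y = B y x := hs.eq
  obtain ⟨A, hA, k, h⟩ := hGO T
  rcases eq_or_ne k 0 with rfl | hk
  · exact ⟨A, hA, fun w => by rw [h w]; ring⟩
  rcases eq_or_ne T 0 with rfl | hT
  · exact ⟨A, hA, fun w => by simp⟩
  -- For k ≠ 0 the zero derivation works: T turns out to be a multiple of the (-k)-eigenvector v,
  -- for which the terms with A and k cancel.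
  refine ⟨0, IsSkewDerivation.zero B, fun w => ?_⟩
  rw [LinearMap.zero_apply, map_zero, LinearMap.zero_apply]
  have hTT : B T T = 0 := by
    have h1 := h T
    have h2 := hA.skew T T
    rw [hsy T (A T)] at h2
    rw [lie_self, map_zero, show B (A T) T = 0 by linarith, zero_add] at h1
    exact (mul_eq_zero.mp h1.symm).resolve_left hk
  obtain ⟨v, hv0, hv⟩ := exists_eigenvector_neg hnd hs hA hT h
  obtain ⟨u, hu0, hu⟩ := exists_eigenvector_of_skew hnd hs hA.skew hv0 hv
  have huu : B u u = 0 := by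
    have h1 := hA.skew u u
    simp only [hu, map_smul, LinearMap.smul_apply, smul_eq_mul] at h1
    exact (mul_eq_zero.mp (show k * B u u = 0 by linarith)).resolve_left hk
  have hvv : B v v = 0 := by
    have h1 := hA.skew v v
    simp only [hv, map_smul, LinearMap.smul_apply, smul_eq_mul] at h1
    exact (mul_eq_zero.mp (show k * B v v = 0 by linarith)).resolve_left hk
  have hspan : ∀ x, B u x = 0 → B x x ≤ 0 → ∃ c : ℝ, x = c • u := by
    intro x hx hxx
    have h1 := mem_of_isotropic_of_nonpos hs hB (R := Submodule.span ℝ {u})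
      (by intro y hy; obtain ⟨c, rfl⟩ := Submodule.mem_span_singleton.mp hy; simp [huu])
      (finrank_span_singleton hu0) x
      (by intro y hy; obtain ⟨c, rfl⟩ := Submodule.mem_span_singleton.mp hy; simp [hx]) hxx
    obtain ⟨c, hc⟩ := Submodule.mem_span_singleton.mp h1
    exact ⟨c, hc.symm⟩
  -- With index at most one, two orthogonal null vectors are proportional, but u and v have
  -- different eigenvalues.
  have huv : B u v ≠ 0 := by
    intro h0
    obtain ⟨c, rfl⟩ := hspan v h0 hvv.le
    rw [map_smul, hu, smul_smul, smul_smul] at hv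
    have h1 : (2 * (c * k)) • u = 0 := by
      rw [show 2 * (c * k) = c * k - -k * c by ring, sub_smul, hv, sub_self]
    rcases smul_eq_zero.mp h1 with h2 | h2
    · rcases mul_eq_zero.mp ((mul_eq_zero.mp h2).resolve_left two_ne_zero) with rfl | h3
      · exact hv0 (zero_smul _ _)
      · exact hk h3
    · exact hu0 h2
  have hpos : ∀ x, B u x = 0 → B v x = 0 → x ≠ 0 → 0 < B x x := by
    intro x h1 h2 h3
    by_contra! h4
    obtain ⟨c, rfl⟩ := hspan x h1 h4
    rw [map_smul, smul_eq_mul, hsy v u] at h2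
    rw [(mul_eq_zero.mp h2).resolve_right huv, zero_smul] at h3
    exact h3 rfl
  obtain ⟨a, ha⟩ : ∃ a : ℝ, a = (B u v)⁻¹ * B v T := ⟨_, rfl⟩
  obtain ⟨b, hb⟩ : ∃ b : ℝ, b = (B u v)⁻¹ * B u T := ⟨_, rfl⟩
  obtain ⟨p, hp⟩ : ∃ p, p = T - (a • u + b • v) := ⟨_, rfl⟩
  have hup : B u p = 0 := by
    simp only [hp, map_sub, map_add, map_smul, huu, smul_eq_mul, hb]
    field_simp
    ring
  have hvp : B v p = 0 := by
    simp only [hp, map_sub, map_add, map_smul, hvv, hsy v u, smul_eq_mul, ha]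
    field_simp
    ring
  have hTe : T = a • u + b • v + p := by rw [hp]; abel
  have hpv : ⁅p, v⁆ = 0 := lie_eq_zero_of_boost hs hA hk hu hv huu hvv huv hpos hup hvp
  have hpu : ⁅p, u⁆ = 0 := lie_eq_zero_of_boost (u := v) (v := u) hs hA (neg_ne_zero.mpr hk) hv
    (by rw [neg_neg]; exact hu) hvv huu (by rwa [hsy]) (fun x h1 h2 => hpos x h2 h1) hvp hup
  have hTv : ⁅T, v⁆ = a • ⁅u, v⁆ := by
    rw [hTe, add_lie, add_lie, smul_lie, smul_lie, lie_self, hpv, smul_zero, add_zero, add_zero]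
  have hTu : ⁅T, u⁆ = -(b • ⁅u, v⁆) := by
    rw [hTe, add_lie, add_lie, smul_lie, smul_lie, lie_self, hpu, smul_zero, add_zero, zero_add,
      ← lie_skew u v, smul_neg, neg_neg]
  have hAz : A ⁅u, v⁆ = 0 := by
    rw [hA.leibniz, hu, hv, smul_lie, lie_smul, neg_smul, add_neg_cancel]
  have huz : B u ⁅u, v⁆ = 0 := by
    have h1 := hA.skew u ⁅u, v⁆
    rw [hAz, hu, map_smul, LinearMap.smul_apply, map_zero, add_zero, smul_eq_mul] at h1
    exact (mul_eq_zero.mp h1).resolve_left hk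
  have e1 : a * B T ⁅u, v⁆ = 2 * k * B T v := by
    have h1 := h v
    have h2 := hA.skew T v
    rw [hTv, map_smul, smul_eq_mul] at h1
    rw [hv, map_smul, smul_eq_mul] at h2
    linarith
  have e2 : b * B T ⁅u, v⁆ = 0 := by
    have h1 := h u
    have h2 := hA.skew T u
    rw [hTu, map_neg, map_smul, smul_eq_mul] at h1
    rw [hu, map_smul, smul_eq_mul] at h2
    linarith
  have hBTv : B T v = a * B u v := by
    rw [ha, hsy T v]; field_simp
  have e3 : 2 * a * b * B u v + B p p = 0 := by
    rw [← hTT]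
    conv_rhs => rw [hTe]
    simp only [map_add, map_smul, LinearMap.add_apply, LinearMap.smul_apply, smul_eq_mul, huu,
      hvv, hup, hvp, hsy p u, hsy p v, hsy v u]
    ring
  have hp0 : B p p = 0 → p = 0 := fun h0 => by
    by_contra hne
    exact (hpos p hup hvp hne).ne' h0
  -- If a = 0, nullity of T kills p and T = b v. If a ≠ 0, then b = 0 and p = 0, so T = a u, and ⟨u,
  -- [u, v]⟩ = 0 contradicts `e1`.
  rcases eq_or_ne a 0 with ha0 | ha0
  · have h1 : p = 0 := hp0 (by rw [ha0] at e3; linarith)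
    have h2 : T = b • v := by rw [hTe, ha0, h1, zero_smul, zero_add, add_zero]
    rw [h w, h2]
    simp only [map_smul, LinearMap.smul_apply, hv, smul_eq_mul]
    ring
  · exfalso
    have h1 : B T ⁅u, v⁆ ≠ 0 := by
      intro h0
      rw [h0, mul_zero, hBTv] at e1
      exact mul_ne_zero (mul_ne_zero two_ne_zero hk) (mul_ne_zero ha0 huv) e1.symm
    have h2 : b = 0 := (mul_eq_zero.mp e2).resolve_right h1
    have h3 : p = 0 := hp0 (by rw [h2] at e3; linarith)
    refine h1 ?_
    rw [hTe, h2, h3, zero_smul, add_zero, add_zero, map_smul, LinearMap.smul_apply, huz, smul_zero]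

end Lorentz

/-! ### Signature of a form and of its isotropic reduction. -/

section Signature

variable {V : Type*} [AddCommGroup V] [Module ℝ V] {B : LinearMap.BilinForm ℝ V}

lemma sigPos_add_sigNeg_eq_finrank [FiniteDimensional ℝ V] (hs : B.IsSymm) (hnd : B.Nondegenerate) :
    sigPos B.toQuadraticMap + sigNeg B.toQuadraticMap = Module.finrank ℝ V := by
  have h1 := QuadraticForm.sigPos_add_sigNeg_add_radical (Q := B.toQuadraticMap)
  have h2 : B.toQuadraticMap.radical = ⊥ := by
    rw [QuadraticMap.radical_eq_ker_associated,
      QuadraticMap.associated_left_inverse ℝ hs.eq]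
    exact LinearMap.separatingLeft_iff_ker_eq_bot.mp hnd.1
  rw [h2, finrank_bot] at h1
  exact h1

variable {p q : ℕ}

lemma HasSignature.add_eq_finrank [FiniteDimensional ℝ V] (h : HasSignature B p q) :
    p + q = Module.finrank ℝ V := by
  rw [← sigPos_add_sigNeg_eq_finrank h.isSymm h.nondegenerate, h.sigPos_eq, h.sigNeg_eq]

lemma HasSignature.finrank_le_of_nonpos [FiniteDimensional ℝ V] (h : HasSignature B p q)
    (W : Submodule ℝ V) (hW : ∀ x ∈ W, B x x ≤ 0) : Module.finrank ℝ W ≤ q := by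
  have h1 := QuadraticForm.sigPos_add_finrank_le_of_nonpos (Q := B.toQuadraticMap) (V := W)
    fun x hx => hW x hx
  rw [h.sigPos_eq, ← h.add_eq_finrank] at h1
  omega

lemma HasSignature.finrank_le_of_nonneg [FiniteDimensional ℝ V] (h : HasSignature B p q)
    (W : Submodule ℝ V) (hW : ∀ x ∈ W, 0 ≤ B x x) : Module.finrank ℝ W ≤ p := by
  have h1 := QuadraticForm.sigPos_add_finrank_le_of_nonpos (Q := -B.toQuadraticMap) (V := W)
    fun x hx => neg_nonpos.mpr (hW x hx)
  rw [sigPos_neg, h.sigNeg_eq, ← h.add_eq_finrank] at h1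
  omega

/-- Both indices are bounded above and their sum is the dimension, so both bounds are attained. -/
lemma hasSignature_of_finrank_le [FiniteDimensional ℝ V] (hs : B.IsSymm) (hnd : B.Nondegenerate)
    (hpq : p + q = Module.finrank ℝ V)
    (hneg : ∀ W : Submodule ℝ V, (∀ x ∈ W, B x x ≤ 0) → Module.finrank ℝ W ≤ q)
    (hpos : ∀ W : Submodule ℝ V, (∀ x ∈ W, 0 ≤ B x x) → Module.finrank ℝ W ≤ p) :
    HasSignature B p q := by
  have h1 := sigPos_add_sigNeg_eq_finrank hs hnd
  obtain ⟨W₁, h2, h3⟩ := exists_finrank_eq_sigPos_and_posDef B.toQuadraticMap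
  obtain ⟨W₂, h4, h5⟩ := exists_finrank_eq_sigNeg_and_negDef B.toQuadraticMap
  have h6 := hpos W₁ fun x hx => h3.nonneg ⟨x, hx⟩
  have h7 := hneg W₂ fun x hx => neg_nonneg.mp (h5.nonneg ⟨x, hx⟩)
  exact ⟨hs, hnd, by omega, by omega⟩

variable {V₀ : Type*} [AddCommGroup V₀] [Module ℝ V₀] {B₀ : LinearMap.BilinForm ℝ V₀}
  {e m : Submodule ℝ V} {π : m →ₗ[ℝ] V₀}

lemma finrank_comap_of_ker_eq [FiniteDimensional ℝ V] (hπ : Function.Surjective π)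
    (hker : ∀ x : m, π x = 0 ↔ (x : V) ∈ e) (hem : e ≤ m) (W : Submodule ℝ V₀) :
    Module.finrank ℝ ((W.comap π).map m.subtype) = Module.finrank ℝ W + Module.finrank ℝ e := by
  rw [(Submodule.equivMapOfInjective m.subtype m.injective_subtype (W.comap π)).symm.finrank_eq,
    ← LinearMap.finrank_range_add_finrank_ker (π.domRestrict (W.comap π))]
  have h0 : LinearMap.range (π.domRestrict (W.comap π)) = W := by
    rw [LinearMap.range_domRestrict, Submodule.map_comap_eq_of_surjective hπ]
  rw [h0]
  congr 1
  have h1 : ((LinearMap.ker (π.domRestrict (W.comap π))).map (W.comap π).subtype).map m.subtype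
      = e := by
    ext x
    constructor
    · rintro ⟨y, ⟨z, hz, rfl⟩, rfl⟩
      exact (hker z).mp hz
    · intro hx
      have h2 := (hker ⟨x, hem hx⟩).mpr hx
      refine ⟨⟨x, hem hx⟩, ⟨⟨⟨x, hem hx⟩, ?_⟩, h2, rfl⟩, rfl⟩
      change π _ ∈ W
      rw [h2]
      exact zero_mem _
  rw [← h1, (Submodule.equivMapOfInjective m.subtype m.injective_subtype _).symm.finrank_eq,
    (Submodule.equivMapOfInjective (W.comap π).subtype (Submodule.injective_subtype _)
      _).symm.finrank_eq]

/-- Signature of the form induced on `eᗮ / e` for an isotropic subspace `e`. -/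
theorem HasSignature.quotient [FiniteDimensional ℝ V] [FiniteDimensional ℝ V₀]
    (h : HasSignature B p q) (hm : m = B.orthogonal e) (hem : e ≤ m) (hπ : Function.Surjective π)
    (hker : ∀ x : m, π x = 0 ↔ (x : V) ∈ e) (hB₀ : ∀ x y : m, B₀ (π x) (π y) = B x y) :
    HasSignature B₀ (p - Module.finrank ℝ e) (q - Module.finrank ℝ e) := by
  have hs : B₀.IsSymm := ⟨fun x y => by
    obtain ⟨x, rfl⟩ := hπ x
    obtain ⟨y, rfl⟩ := hπ y
    rw [hB₀, hB₀, h.isSymm.eq]⟩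
  have hsep : ∀ x, (∀ y, B₀ x y = 0) → x = 0 := by
    intro x hx
    obtain ⟨x, rfl⟩ := hπ x
    rw [hker, ← LinearMap.BilinForm.orthogonal_orthogonal h.nondegenerate h.isSymm.isRefl e, ← hm]
    intro y hy
    change B y x = 0
    rw [h.isSymm.eq, ← hB₀ x ⟨y, hy⟩, hx]
  have hnd : B₀.Nondegenerate := ⟨hsep, fun x hx => hsep x fun y => by rw [hs.eq]; exact hx y⟩
  have hiso : ∀ x ∈ e, B x x = 0 := fun x hx => by
    have h1 := hem hx
    rw [hm] at h1
    exact h1 x hx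
  have hp := h.finrank_le_of_nonneg e fun x hx => (hiso x hx).ge
  have hq := h.finrank_le_of_nonpos e fun x hx => (hiso x hx).le
  have hpq := h.add_eq_finrank
  have hdim : Module.finrank ℝ V₀ + Module.finrank ℝ e = Module.finrank ℝ m := by
    have h1 := finrank_comap_of_ker_eq hπ hker hem ⊤
    rw [finrank_top, Submodule.comap_top, Submodule.map_subtype_top] at h1
    exact h1.symm
  have hdm : Module.finrank ℝ m = Module.finrank ℝ V - Module.finrank ℝ e := by
    rw [hm, LinearMap.BilinForm.finrank_orthogonal h.nondegenerate]
  -- A semidefinite subspace of the quotient pulls back to a semidefinite subspace of V whose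
  -- dimension is larger by dim e.
  refine hasSignature_of_finrank_le hs hnd (by omega) (fun W hW => ?_) fun W hW => ?_
  · have h1 := h.finrank_le_of_nonpos ((W.comap π).map m.subtype) (by
      rintro _ ⟨x, hx, rfl⟩
      rw [Submodule.subtype_apply, ← hB₀]
      exact hW _ hx)
    rw [finrank_comap_of_ker_eq hπ hker hem] at h1
    omega
  · have h1 := h.finrank_le_of_nonneg ((W.comap π).map m.subtype) (by
      rintro _ ⟨x, hx, rfl⟩
      rw [Submodule.subtype_apply, ← hB₀]
      exact hW _ hx)
    rw [finrank_comap_of_ker_eq hπ hker hem] at h1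
    omega

end Signature

/-! ### The quotient metric Lie algebra. -/

section Quotient

variable {L : Type*} [LieRing L] [LieAlgebra ℝ L] {B : LinearMap.BilinForm ℝ L}
  {L₀ : Type*} [LieRing L₀] [LieAlgebra ℝ L₀] {m : LieIdeal ℝ L} {e : Submodule ℝ L}
  {π : m →ₗ⁅ℝ⁆ L₀}

/-- Any linear section of π serves: two lifts differ by an element of e, which is orthogonal to m.
-/
lemma exists_quotient_form (hs : B.IsSymm) (hπ : Function.Surjective π)
    (hker : ∀ x : m, π x = 0 ↔ (x : L) ∈ e) (hem : ∀ x ∈ e, ∀ y ∈ m, B x y = 0) :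
    ∃ B₀ : LinearMap.BilinForm ℝ L₀, ∀ x y : m, B₀ (π x) (π y) = B x y := by
  obtain ⟨s, hs'⟩ := LinearMap.exists_rightInverse_of_surjective (π : m →ₗ[ℝ] L₀)
    (LinearMap.range_eq_top.mpr hπ)
  have hsπ : ∀ x, π (s x) = x := fun x => LinearMap.congr_fun hs' x
  have h1 : ∀ x : m, ((s (π x) - x : m) : L) ∈ e := fun x => by
    rw [← hker, map_sub, hsπ, sub_self]
  let f : L₀ →ₗ[ℝ] L := m.toSubmodule.subtype ∘ₗ s
  refine ⟨B.compl₁₂ f f, fun x y => ?_⟩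
  change B (s (π x)) (s (π y)) = B x y
  have h2 := hem _ (h1 x) _ (s (π y)).2
  have h3 := hem _ (h1 y) _ x.2
  rw [hs.eq] at h3
  simp only [LieSubmodule.coe_sub, map_sub, LinearMap.sub_apply] at h2 h3
  linarith

/-- A skew derivation preserves m and e, hence descends to the quotient; the condition at a lift of
T, tested on m only, descends with the same k. -/
theorem IsAlgebraicGO.quotient {B₀ : LinearMap.BilinForm ℝ L₀} (hGO : IsAlgebraicGO B)
    (hm : ∀ D, IsSkewDerivation B D → ∀ x ∈ m, D x ∈ m)
    (he : ∀ D, IsSkewDerivation B D → ∀ x ∈ e, D x ∈ e) (hπ : Function.Surjective π)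
    (hker : ∀ x : m, π x = 0 ↔ (x : L) ∈ e) (hB₀ : ∀ x y : m, B₀ (π x) (π y) = B x y) :
    IsAlgebraicGO B₀ := by
  intro T
  obtain ⟨T, rfl⟩ := hπ T
  obtain ⟨D, hD, k, h⟩ := hGO T
  obtain ⟨s, hs'⟩ := LinearMap.exists_rightInverse_of_surjective (π : m →ₗ[ℝ] L₀)
    (LinearMap.range_eq_top.mpr hπ)
  have hsπ : ∀ x, π (s x) = x := fun x => LinearMap.congr_fun hs' x
  let Dm : m.toSubmodule →ₗ[ℝ] m.toSubmodule := D.restrict (hm D hD)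
  let D₀ : L₀ →ₗ[ℝ] L₀ := (π : m →ₗ[ℝ] L₀) ∘ₗ Dm ∘ₗ s
  have hD₀ : ∀ x : m, D₀ (π x) = π ⟨D x, hm D hD x x.2⟩ := by
    intro x
    have h1 : ((s (π x) - x : m) : L) ∈ e := by
      rw [← hker, map_sub, hsπ, sub_self]
    have h2 := (hker ⟨D ((s (π x) - x : m) : L), hm D hD _ (s (π x) - x).2⟩).mpr (he D hD _ h1)
    refine sub_eq_zero.mp (Eq.trans ?_ h2)
    change π (Dm (s (π x))) - _ = _
    rw [← map_sub]
    congr 1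
    exact Subtype.ext (map_sub D _ _).symm
  refine ⟨D₀, ⟨fun x y => ?_, fun x y => ?_⟩, k, fun w => ?_⟩
  · obtain ⟨x, rfl⟩ := hπ x
    obtain ⟨y, rfl⟩ := hπ y
    rw [← LieHom.map_lie, hD₀, hD₀, hD₀, ← LieHom.map_lie, ← LieHom.map_lie, ← map_add]
    congr 1
    exact Subtype.ext (hD.leibniz x y)
  · obtain ⟨x, rfl⟩ := hπ x
    obtain ⟨y, rfl⟩ := hπ y
    rw [hD₀, hD₀, hB₀, hB₀]
    exact hD.skew x y
  · obtain ⟨w, rfl⟩ := hπ w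
    rw [← LieHom.map_lie, hD₀, hB₀, hB₀, hB₀]
    exact h w

/-- The Lie algebra `m / e`. -/
lemma exists_quotient_lieAlgebra [LieRing.IsNilpotent L] [FiniteDimensional ℝ L]
    (hlie : ∀ x ∈ e, ∀ y ∈ m, ⁅x, y⁆ = 0) :
    ∃ (I : LieIdeal ℝ m), LieRing.IsNilpotent (m ⧸ I) ∧ FiniteDimensional ℝ (m ⧸ I) ∧
      ∃ π : m →ₗ⁅ℝ⁆ m ⧸ I, Function.Surjective π ∧ ∀ x : m, π x = 0 ↔ (x : L) ∈ e := by
  let I : LieIdeal ℝ m :=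
    { e.comap m.toSubmodule.subtype with
      lie_mem := by
        intro x y hy
        have h1 : ⁅y, x⁆ = 0 := Subtype.ext (hlie _ hy _ x.2)
        rw [← lie_skew, h1, neg_zero]
        exact zero_mem e }
  have h1 : LieRing.IsNilpotent m :=
    Function.Injective.lieAlgebra_isNilpotent (R := ℝ) (f := m.incl) Subtype.val_injective
  have hsurj : Function.Surjective (LieSubmodule.Quotient.mk' I) :=
    LieSubmodule.Quotient.surjective_mk' I
  let π : m →ₗ⁅ℝ⁆ m ⧸ I :=
    { (LieSubmodule.Quotient.mk' I : m →ₗ[ℝ] m ⧸ I) with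
      map_lie' := fun {x y} => LieSubmodule.Quotient.mk_bracket I x y }
  have hπ : Function.Surjective π := hsurj
  refine ⟨I, hπ.lieAlgebra_isNilpotent, ?_, π, hπ, fun x => ?_⟩
  · exact Module.Finite.of_surjective (LieSubmodule.Quotient.mk' I : m →ₗ[ℝ] m ⧸ I) hsurj
  · exact LieSubmodule.Quotient.mk_eq_zero I

end Quotient

/-! ### Integrating a nilpotent Lie algebra: the Maurer-Cartan form. -/

/-- A nilpotent Lie algebra structure on a normed space, with a central filtration. -/
structure NilpotentBracket (E : Type*) [NormedAddCommGroup E] [NormedSpace ℝ E] where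
  /-- The bracket. -/
  br : E →L[ℝ] E →L[ℝ] E
  br_self : ∀ x, br x x = 0
  jacobi : ∀ x y z, br x (br y z) = br (br x y) z + br y (br x z)
  /-- The filtration. -/
  fil : ℕ → Submodule ℝ E
  fil_zero : fil 0 = ⊤
  fil_succ_le : ∀ k, fil (k + 1) ≤ fil k
  br_mem : ∀ k x y, y ∈ fil k → br x y ∈ fil (k + 1)
  /-- The length of the filtration. -/
  len : ℕ
  fil_len : fil len = ⊥

section SubmoduleCurves

variable {E : Type*} [NormedAddCommGroup E] [NormedSpace ℝ E] [FiniteDimensional ℝ E]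

/-- Along J, a linear functional that vanishes on S is constant on f; one of them would separate a
value outside S. -/
lemma mem_submodule_of_hasDerivAt {S : Submodule ℝ E} {J : Set ℝ} (hJ : IsOpen J)
    (hJc : J.OrdConnected) {f f' : ℝ → E} (hf : ∀ t ∈ J, HasDerivAt f (f' t) t)
    (hf' : ∀ t ∈ J, f' t ∈ S) {t₀ : ℝ} (ht₀ : t₀ ∈ J) (h₀ : f t₀ ∈ S) {t : ℝ} (ht : t ∈ J) :
    f t ∈ S := by
  by_contra hne
  obtain ⟨φ, hφ, hS⟩ := Submodule.exists_le_ker_of_notMem hne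
  let ψ : E →L[ℝ] ℝ := LinearMap.toContinuousLinearMap φ
  have hd : ∀ t ∈ J, HasDerivAt (fun t => ψ (f t)) 0 t := fun t ht => by
    have h1 := ψ.hasFDerivAt.comp_hasDerivAt t (hf t ht)
    have h2 : ψ (f' t) = 0 := hS (hf' t ht)
    rwa [h2] at h1
  have h1 := hJ.is_const_of_deriv_eq_zero hJc.isPreconnected
    (fun t ht => (hd t ht).differentiableAt.differentiableWithinAt) (fun t ht => (hd t ht).deriv)
    ht ht₀
  have h2 : ψ (f t₀) = 0 := hS h₀
  exact hφ (h1.trans h2)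

end SubmoduleCurves

namespace NilpotentBracket

open Polynomial

variable {E : Type*} [NormedAddCommGroup E] [NormedSpace ℝ E] (b : NilpotentBracket E)

lemma br_swap (x y : E) : b.br x y = - b.br y x := by
  have h1 := b.br_self (x + y)
  simp only [map_add, add_apply, b.br_self, zero_add, add_zero] at h1
  exact eq_neg_of_add_eq_zero_right h1

lemma br_mem' {k : ℕ} {x : E} (y : E) (hx : x ∈ b.fil k) : b.br x y ∈ b.fil (k + 1) := by
  rw [b.br_swap]
  exact neg_mem (b.br_mem k y x hx)

lemma mem_fil_zero (x : E) : x ∈ b.fil 0 := by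
  rw [b.fil_zero]; trivial

lemma eq_zero_of_mem_fil {x : E} (h : x ∈ b.fil b.len) : x = 0 := by
  rw [b.fil_len] at h
  exact (Submodule.mem_bot ℝ).mp h

/-- The operator `p (ad x)`. -/
def adPoly (p : ℝ[X]) (x : E) : E →L[ℝ] E := aeval (b.br x) p

lemma adPoly_add (p q : ℝ[X]) (x : E) : b.adPoly (p + q) x = b.adPoly p x + b.adPoly q x :=
  map_add _ _ _

lemma adPoly_mul (p q : ℝ[X]) (x : E) : b.adPoly (p * q) x = b.adPoly p x * b.adPoly q x :=
  map_mul _ _ _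

lemma adPoly_monomial (n : ℕ) (a : ℝ) (x : E) : b.adPoly (monomial n a) x = a • b.br x ^ n := by
  rw [adPoly, aeval_monomial, Algebra.smul_def]

lemma adPoly_zero (p : ℝ[X]) : b.adPoly p 0 = p.coeff 0 • 1 := by
  rw [adPoly, map_zero, aeval_def, eval₂_at_zero, Algebra.algebraMap_eq_smul_one]

lemma br_pow_mem (x : E) (n : ℕ) {k : ℕ} {y : E} (hy : y ∈ b.fil k) :
    (b.br x ^ n) y ∈ b.fil (k + n) := by
  induction n with
  | zero => exact hy
  | succ n ih => rw [pow_succ']; exact b.br_mem _ _ _ ih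

lemma br_pow_len (x : E) : b.br x ^ b.len = 0 := by
  ext y
  have h1 := b.br_pow_mem x b.len (b.mem_fil_zero y)
  rw [zero_add] at h1
  exact b.eq_zero_of_mem_fil h1

lemma fil_antitone : Antitone b.fil := antitone_nat_of_succ_le b.fil_succ_le

lemma br_pow_sub_mem {k : ℕ} {x x' : E} (h : x - x' ∈ b.fil k) (n : ℕ) (y : E) :
    (b.br x ^ n) y - (b.br x' ^ n) y ∈ b.fil (k + 1) := by
  induction n with
  | zero => simp
  | succ n ih =>
    rw [pow_succ', pow_succ']
    have h1 : (b.br x * b.br x ^ n) y - (b.br x' * b.br x' ^ n) y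
        = b.br x ((b.br x ^ n) y - (b.br x' ^ n) y) + b.br (x - x') ((b.br x' ^ n) y) := by
      rw [mul_apply_eq_comp, mul_apply_eq_comp, map_sub, map_sub]
      change _ = _ + (b.br x ((b.br x' ^ n) y) - b.br x' ((b.br x' ^ n) y))
      abel
    rw [h1]
    exact add_mem (b.fil_succ_le _ (b.br_mem _ _ _ ih)) (b.br_mem' _ h)

/-- Polynomials in ad x gain one step of the filtration. This makes Picard iteration stop after
finitely many steps and gives uniqueness without estimates. -/
lemma adPoly_sub_mem (p : ℝ[X]) {k : ℕ} {x x' : E} (h : x - x' ∈ b.fil k) (y : E) :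
    b.adPoly p x y - b.adPoly p x' y ∈ b.fil (k + 1) := by
  induction p using Polynomial.induction_on' with
  | add p q hp hq =>
    rw [adPoly_add, adPoly_add]
    convert add_mem hp hq using 1
    simp only [add_apply]
    abel
  | monomial n a =>
    rw [adPoly_monomial, adPoly_monomial]
    have h1 := Submodule.smul_mem _ a (b.br_pow_sub_mem h n y)
    rwa [smul_sub] at h1

lemma contDiff_adPoly (p : ℝ[X]) : ContDiff ℝ ∞ (b.adPoly p) := by
  induction p using Polynomial.induction_on' with
  | add p q hp hq => simp only [funext fun x => b.adPoly_add p q x]; exact hp.add hq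
  | monomial n a =>
    simp only [funext fun x => b.adPoly_monomial n a x]
    exact ((b.br.contDiff).pow n).const_smul a

lemma br_pow_self (x : E) {n : ℕ} (hn : n ≠ 0) : (b.br x ^ n) x = 0 := by
  obtain ⟨m, rfl⟩ := Nat.exists_eq_succ_of_ne_zero hn
  rw [pow_succ, mul_apply_eq_comp, b.br_self, map_zero]

lemma adPoly_smul_self (p : ℝ[X]) (t : ℝ) (x : E) : b.adPoly p (t • x) x = p.coeff 0 • x := by
  induction p using Polynomial.induction_on' with
  | add p q hp hq => rw [adPoly_add, coeff_add, add_smul, ← hp, ← hq]; rfl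
  | monomial n a =>
    rw [adPoly_monomial, coeff_monomial, map_smul, _root_.smul_pow]
    rcases eq_or_ne n 0 with rfl | hn
    · simp
    · rw [if_neg hn, zero_smul, smul_apply, smul_apply, b.br_pow_self x hn, smul_zero, smul_zero]

lemma adPoly_map {f : E →L[ℝ] E} (hf : ∀ x y, f (b.br x y) = b.br (f x) (f y)) (p : ℝ[X]) (x y : E) :
    f (b.adPoly p x y) = b.adPoly p (f x) (f y) := by
  induction p using Polynomial.induction_on' with
  | add p q hp hq => rw [adPoly_add, adPoly_add, add_apply, map_add, hp, hq]; rfl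
  | monomial n a =>
    rw [adPoly_monomial, adPoly_monomial, smul_apply, map_smul, smul_apply]
    congr 1
    induction n with
    | zero => rfl
    | succ n ih =>
      rw [pow_succ', pow_succ', mul_apply_eq_comp, mul_apply_eq_comp, hf, ih]

/-- The series `(1 - exp (-X)) / X`, truncated. -/
def mcPoly (c : ℕ) : ℝ[X] :=
  ∑ k ∈ Finset.range (c + 1), monomial k ((-1) ^ k / (k + 1).factorial : ℝ)

lemma mcPoly_coeff_zero (c : ℕ) : (mcPoly c).coeff 0 = 1 := by
  rw [mcPoly, finsetSum_coeff, Finset.sum_eq_single 0]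
  · simp
  · intro k _ hk
    rw [coeff_monomial, if_neg hk]
  · simp

/-- An inverse of `mcPoly c` modulo `X ^ c`. -/
def mcInvPoly (c : ℕ) : ℝ[X] := ∑ k ∈ Finset.range c, (1 - mcPoly c) ^ k

/-- Geometric series in `1 - mcPoly c`, which is divisible by X. -/
lemma exists_mcPoly_mul_mcInvPoly (c : ℕ) : ∃ r : ℝ[X], mcPoly c * mcInvPoly c = 1 - X ^ c * r := by
  obtain ⟨r, hr⟩ : X ∣ 1 - mcPoly c := by
    rw [X_dvd_iff, coeff_sub, mcPoly_coeff_zero, coeff_one_zero, sub_self]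
  refine ⟨r ^ c, ?_⟩
  have h1 := mul_neg_geom_sum (1 - mcPoly c) c
  rw [sub_sub_cancel] at h1
  rw [mcInvPoly, h1, hr, mul_pow]

/-- The logarithmic derivative `(1 - exp (-ad x)) / ad x` of the exponential map. -/
def mc (x : E) : E →L[ℝ] E := b.adPoly (mcPoly b.len) x

/-- The inverse of `mc`. -/
def mcInv (x : E) : E →L[ℝ] E := b.adPoly (mcInvPoly b.len) x

lemma adPoly_mcPoly_mul (x : E) : b.adPoly (mcPoly b.len * mcInvPoly b.len) x = 1 := by
  obtain ⟨r, hr⟩ := exists_mcPoly_mul_mcInvPoly b.len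
  rw [hr, adPoly, map_sub, map_one, map_mul, map_pow, aeval_X, b.br_pow_len, zero_mul, sub_zero]

lemma mc_mcInv (x y : E) : b.mc x (b.mcInv x y) = y := by
  have h1 := b.adPoly_mcPoly_mul x
  rw [adPoly_mul] at h1
  exact DFunLike.congr_fun h1 y

lemma mcInv_mc (x y : E) : b.mcInv x (b.mc x y) = y := by
  have h1 := b.adPoly_mcPoly_mul x
  rw [mul_comm, adPoly_mul] at h1
  exact DFunLike.congr_fun h1 y

lemma mc_zero : b.mc 0 = 1 := by
  rw [mc, adPoly_zero, mcPoly_coeff_zero, one_smul]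

lemma mc_smul_self (t : ℝ) (x : E) : b.mc (t • x) x = x := by
  rw [mc, adPoly_smul_self, mcPoly_coeff_zero, one_smul]

lemma mcInv_smul_self (t : ℝ) (x : E) : b.mcInv (t • x) x = x := by
  have h := b.mcInv_mc (t • x) x
  rwa [mc_smul_self] at h

lemma contDiff_mc : ContDiff ℝ ∞ b.mc := b.contDiff_adPoly _

lemma contDiff_mcInv : ContDiff ℝ ∞ b.mcInv := b.contDiff_adPoly _

/-- s · mc(s x) w solves K' = w - [x, K] with K(0) = 0, and the proofs below use it only through
this equation. The truncation of the series is exact because (ad x)^len = 0. -/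
lemma hasDerivAt_smul_mc (x w : E) (s : ℝ) :
    HasDerivAt (fun s : ℝ => s • b.mc (s • x) w) (w - b.br x (s • b.mc (s • x) w)) s := by
  have hfun : ∀ s : ℝ, s • b.mc (s • x) w = ∑ k ∈ Finset.range (b.len + 1),
      s ^ (k + 1) • ((-1) ^ k / (k + 1).factorial : ℝ) • (b.br x ^ k) w := by
    intro s
    rw [mc, adPoly, mcPoly, map_sum, sum_apply, Finset.smul_sum]
    refine Finset.sum_congr rfl fun k _ => ?_
    have h1 := b.adPoly_monomial k ((-1) ^ k / (k + 1).factorial : ℝ) (s • x)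
    rw [adPoly] at h1
    rw [h1, map_smul, _root_.smul_pow, smul_apply, smul_apply, smul_smul, smul_smul, smul_smul]
    congr 1
    ring
  have h1 : HasDerivAt (fun s : ℝ => s • b.mc (s • x) w) (∑ k ∈ Finset.range (b.len + 1),
      (((k + 1 : ℕ) : ℝ) * s ^ k) • ((-1) ^ k / (k + 1).factorial : ℝ) • (b.br x ^ k) w) s := by
    simp only [hfun]
    refine HasDerivAt.fun_sum fun k _ => ?_
    have h2 := hasDerivAt_pow (k + 1) s
    exact h2.smul_const _
  convert h1 using 1
  rw [hfun, map_sum, Finset.sum_range_succ' (fun k => (((k + 1 : ℕ) : ℝ) * s ^ k) • _),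
    add_comm (∑ k ∈ Finset.range b.len, _) _, sub_eq_add_neg, ← Finset.sum_neg_distrib, Finset.sum_range_succ]
  have h3 : b.br x (s ^ (b.len + 1) • ((-1) ^ b.len / (b.len + 1).factorial : ℝ) •
      (b.br x ^ b.len) w) = 0 := by
    rw [b.br_pow_len, zero_apply, smul_zero, smul_zero, map_zero]
  rw [h3, neg_zero, add_zero]
  congr 1
  · simp
  · refine Finset.sum_congr rfl fun k _ => ?_
    rw [map_smul, map_smul, pow_succ' (b.br x), mul_apply_eq_comp, smul_smul, smul_smul,
      ← neg_smul]
    congr 1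
    rw [Nat.factorial_succ (k + 1)]
    have h4 : ((k + 1).factorial : ℝ) ≠ 0 := by positivity
    push_cast
    field_simp
    ring

end NilpotentBracket

/-! ### Differentiating a differential equation in a parameter. -/

section MixedPartials

variable {P G : Type*} [NormedAddCommGroup P] [NormedSpace ℝ P] [NormedAddCommGroup G]
  [NormedSpace ℝ G]

lemma hasDerivAt_fderiv_of_contDiff {f g : P → ℝ → G}
    (hf : ContDiff ℝ 2 fun q : P × ℝ => f q.1 q.2) (hd : ∀ p t, HasDerivAt (f p) (g p t) t) (p u : P)
    (t : ℝ) :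
    HasDerivAt (fun t => fderiv ℝ (fun p => f p t) p u) (fderiv ℝ (fun p => g p t) p u) t := by
  set F : P × ℝ → G := fun q => f q.1 q.2 with hF
  have hFd : ∀ q, HasFDerivAt F (fderiv ℝ F q) q := fun q =>
    (hf.differentiable two_ne_zero q).hasFDerivAt
  have hD : ContDiff ℝ 1 (fderiv ℝ F) := hf.fderiv_right (by norm_num)
  have hDd : ∀ q, HasFDerivAt (fderiv ℝ F) (fderiv ℝ (fderiv ℝ F) q) q := fun q =>
    (hD.differentiable one_ne_zero q).hasFDerivAt
  have h1 : ∀ t, fderiv ℝ (fun p => f p t) p u = fderiv ℝ F (p, t) (u, 0) := fun t => by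
    have h2 := HasFDerivAt.comp (g := F) p (hFd (p, t)) (hasFDerivAt_prodMk_left (𝕜 := ℝ) p t)
    change fderiv ℝ (F ∘ fun e => (e, t)) p u = _
    rw [h2.fderiv]
    simp
  have hslice : ∀ p t, HasDerivAt (fun t : ℝ => (p, t)) ((0 : P), (1 : ℝ)) t := fun p t =>
    (hasDerivAt_const t p).prodMk (hasDerivAt_id t)
  have h3 : ∀ p t, g p t = fderiv ℝ F (p, t) (0, 1) := fun p t =>
    (hd p t).unique ((hFd (p, t)).comp_hasDerivAt t (hslice p t))
  have h4 : HasDerivAt (fun t => fderiv ℝ F (p, t) (u, 0))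
      (fderiv ℝ (fderiv ℝ F) (p, t) (0, 1) (u, 0)) t :=
    ((ContinuousLinearMap.apply ℝ G ((u, 0) : P × ℝ)).hasFDerivAt).comp_hasDerivAt t
      ((hDd (p, t)).comp_hasDerivAt t (hslice p t))
  have h5 := HasFDerivAt.comp p ((ContinuousLinearMap.apply ℝ G ((0, 1) : P × ℝ)).hasFDerivAt)
    (HasFDerivAt.comp (g := fderiv ℝ F) p (hDd (p, t)) (hasFDerivAt_prodMk_left (𝕜 := ℝ) p t))
  have h6 : (fun p => g p t) = ContinuousLinearMap.apply ℝ G ((0, 1) : P × ℝ) ∘ fderiv ℝ F ∘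
      fun e => (e, t) := funext fun p => h3 p t
  rw [h6, h5.fderiv]
  simp only [h1]
  convert h4 using 1
  simp only [ContinuousLinearMap.comp_apply, ContinuousLinearMap.inl_apply,
    ContinuousLinearMap.apply_apply]
  exact second_derivative_symmetric hFd (hDd (p, t)) _ _

end MixedPartials

/-! ### Functions polynomial in time and smooth in a parameter. -/

section PolynomialFamilies

variable {P F G H : Type*} [NormedAddCommGroup P] [NormedSpace ℝ P] [NormedAddCommGroup F]
  [NormedSpace ℝ F] [NormedAddCommGroup G] [NormedSpace ℝ G] [NormedAddCommGroup H] [NormedSpace ℝ H]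

/-- Polynomial functions of `t` whose coefficients are smooth functions of a parameter. -/
inductive IsPolyFamily {P F : Type*} [NormedAddCommGroup P] [NormedSpace ℝ P] [NormedAddCommGroup F]
    [NormedSpace ℝ F] : (P → ℝ → F) → Prop
  | monomial (n : ℕ) (a : P → F) (ha : ContDiff ℝ ∞ a) : IsPolyFamily fun p t => t ^ n • a p
  | add (f g : P → ℝ → F) (hf : IsPolyFamily f) (hg : IsPolyFamily g) :
    IsPolyFamily fun p t => f p t + g p t

namespace IsPolyFamily

lemma const {a : P → F} (ha : ContDiff ℝ ∞ a) : IsPolyFamily fun p (_ : ℝ) => a p := by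
  simpa using monomial 0 a ha

lemma contDiff {f : P → ℝ → F} (hf : IsPolyFamily f) : ContDiff ℝ ∞ fun q : P × ℝ => f q.1 q.2 := by
  induction hf with
  | monomial n a ha => exact (contDiff_snd.pow n).smul (ha.comp contDiff_fst)
  | add f g _ _ hf hg => exact hf.add hg

lemma clm {f : P → ℝ → F} (hf : IsPolyFamily f) (A : F →L[ℝ] G) :
    IsPolyFamily fun p t => A (f p t) := by
  induction hf with
  | monomial n a ha =>
    simp only [map_smul]
    exact monomial n _ (A.contDiff.comp ha)
  | add f g _ _ hf hg =>
    simp only [map_add]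
    exact add _ _ hf hg

lemma bilin {f : P → ℝ → F} {g : P → ℝ → G} (hf : IsPolyFamily f) (hg : IsPolyFamily g)
    (A : F →L[ℝ] G →L[ℝ] H) : IsPolyFamily fun p t => A (f p t) (g p t) := by
  induction hf with
  | add f₁ f₂ _ _ h₁ h₂ =>
    simp only [map_add, add_apply]
    exact add _ _ h₁ h₂
  | monomial n a ha =>
    induction hg with
    | add g₁ g₂ _ _ h₁ h₂ =>
      simp only [map_add]
      exact add _ _ h₁ h₂
    | monomial m c hc =>
      simp only [map_smul, smul_apply, smul_smul, ← pow_add]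
      exact monomial (m + n) _ ((A.contDiff.comp ha).clm_apply hc)

lemma exists_primitive {f : P → ℝ → F} (hf : IsPolyFamily f) :
    ∃ g : P → ℝ → F, IsPolyFamily g ∧ ∀ p, g p 0 = 0 ∧ ∀ t, HasDerivAt (g p) (f p t) t := by
  induction hf with
  | monomial n a ha =>
    refine ⟨_, monomial (n + 1) (fun p => ((n : ℝ) + 1)⁻¹ • a p) (ha.const_smul _),
      fun p => ⟨by simp, fun t => ?_⟩⟩
    have h1 := (hasDerivAt_pow (n + 1) t).smul_const (((n : ℝ) + 1)⁻¹ • a p)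
    convert h1 using 1
    have h2 : (n : ℝ) + 1 ≠ 0 := by positivity
    rw [smul_smul]
    push_cast
    field_simp
  | add f₁ f₂ _ _ h₁ h₂ =>
    obtain ⟨g₁, hg₁, h₁⟩ := h₁
    obtain ⟨g₂, hg₂, h₂⟩ := h₂
    exact ⟨_, add _ _ hg₁ hg₂, fun p => ⟨by rw [(h₁ p).1, (h₂ p).1, add_zero],
      fun t => ((h₁ p).2 t).add ((h₂ p).2 t)⟩⟩

lemma pow {f : P → ℝ → (F →L[ℝ] F)} (hf : IsPolyFamily f) (n : ℕ) :
    IsPolyFamily fun p t => f p t ^ n := by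
  induction n with
  | zero => simpa using const (P := P) (contDiff_const (c := (1 : F →L[ℝ] F)))
  | succ n ih =>
    simp only [pow_succ]
    exact ih.bilin hf (ContinuousLinearMap.mul ℝ (F →L[ℝ] F))

end IsPolyFamily

end PolynomialFamilies

/-! ### Triangular differential equations and the Campbell-Hausdorff product. -/

namespace NilpotentBracket

open Polynomial

variable {E : Type*} [NormedAddCommGroup E] [NormedSpace ℝ E] (b : NilpotentBracket E)

lemma isPolyFamily_adPoly {P : Type*} [NormedAddCommGroup P] [NormedSpace ℝ P] {f : P → ℝ → E}
    (hf : IsPolyFamily f) (q : ℝ[X]) : IsPolyFamily fun p t => b.adPoly q (f p t) := by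
  induction q using Polynomial.induction_on' with
  | add q r hq hr =>
    simp only [adPoly_add]
    exact .add _ _ hq hr
  | monomial n a =>
    simp only [adPoly_monomial]
    exact ((hf.clm b.br).pow n).clm (a • ContinuousLinearMap.id ℝ _)

variable [FiniteDimensional ℝ E]

/-- Uniqueness for differential equations that are triangular with respect to the filtration. -/
lemma eq_zero_of_triangular {J : Set ℝ} (hJ : IsOpen J) (hJc : J.OrdConnected) {f f' : ℝ → E}
    (hf : ∀ t ∈ J, HasDerivAt f (f' t) t)
    (htri : ∀ i, ∀ t ∈ J, f t ∈ b.fil i → f' t ∈ b.fil (i + 1)) {t₀ : ℝ} (ht₀ : t₀ ∈ J)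
    (h₀ : f t₀ = 0) {t : ℝ} (ht : t ∈ J) : f t = 0 := by
  have h1 : ∀ i, ∀ t ∈ J, f t ∈ b.fil i := by
    intro i
    induction i with
    | zero => exact fun t _ => b.mem_fil_zero _
    | succ i ih =>
      exact fun t ht => mem_submodule_of_hasDerivAt hJ hJc hf (fun s hs => htri i s hs (ih s hs)) ht₀
        (h₀ ▸ zero_mem _) ht
  exact b.eq_zero_of_mem_fil (h1 _ t ht)

lemma eqOn_of_hasDerivAt_mcInv {J : Set ℝ} (hJ : IsOpen J) (hJc : J.OrdConnected) {f g Y : ℝ → E}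
    (hf : ∀ t ∈ J, HasDerivAt f (b.mcInv (f t) (Y t)) t)
    (hg : ∀ t ∈ J, HasDerivAt g (b.mcInv (g t) (Y t)) t) {t₀ : ℝ} (ht₀ : t₀ ∈ J) (h₀ : f t₀ = g t₀)
    {t : ℝ} (ht : t ∈ J) : f t = g t := by
  have h1 := b.eq_zero_of_triangular hJ hJc (f := fun t => f t - g t)
    (f' := fun t => b.mcInv (f t) (Y t) - b.mcInv (g t) (Y t)) (fun t ht => (hf t ht).sub (hg t ht))
    (fun i t _ h => b.adPoly_sub_mem _ h _) ht₀ (sub_eq_zero.mpr h₀) ht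
  exact sub_eq_zero.mp h1

/-- Picard iteration for `Z' = mcInv Z Y` terminates, so it stays in any class of functions which
is stable under one iteration step. -/
lemma exists_solution {P : Type*} (C : (P → ℝ → E) → Prop) (x : P → E) (Y : P → ℝ → E)
    (h₀ : ∃ Z, C Z)
    (hstep : ∀ Z, C Z → ∃ W, C W ∧ ∀ p, W p 0 = x p ∧
      ∀ t, HasDerivAt (W p) (b.mcInv (Z p t) (Y p t)) t) :
    ∃ Z, C Z ∧ ∀ p, Z p 0 = x p ∧ ∀ t, HasDerivAt (Z p) (b.mcInv (Z p t) (Y p t)) t := by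
  -- After i steps consecutive iterates agree modulo `fil i`, so after `len` steps the iterate is a
  -- fixed point.
  have key : ∀ i, ∃ Z W : P → ℝ → E, C W ∧ (∀ p, W p 0 = x p ∧
      ∀ t, HasDerivAt (W p) (b.mcInv (Z p t) (Y p t)) t) ∧ ∀ p t, W p t - Z p t ∈ b.fil i := by
    intro i
    induction i with
    | zero =>
      obtain ⟨Z, hZ⟩ := h₀
      obtain ⟨W, hW, h⟩ := hstep Z hZ
      exact ⟨Z, W, hW, h, fun p t => b.mem_fil_zero _⟩
    | succ i ih =>
      obtain ⟨Z, W, hW, h, hi⟩ := ih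
      obtain ⟨X, hX, hX'⟩ := hstep W hW
      refine ⟨W, X, hX, hX', fun p t => ?_⟩
      exact mem_submodule_of_hasDerivAt (f := fun t => X p t - W p t) isOpen_univ ordConnected_univ
        (fun t _ => ((hX' p).2 t).sub ((h p).2 t)) (fun t _ => b.adPoly_sub_mem _ (hi p t) _)
        (mem_univ 0) (by rw [(hX' p).1, (h p).1, sub_self]; exact zero_mem _) (mem_univ t)
  obtain ⟨Z, W, hW, h, hi⟩ := key b.len
  obtain rfl : W = Z := funext fun p => funext fun t =>
    sub_eq_zero.mp (b.eq_zero_of_mem_fil (hi p t))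
  exact ⟨W, hW, h⟩

/-- The Maurer-Cartan equation for `mc`. -/
theorem fderiv_mc_sub (x u v : E) :
    fderiv ℝ b.mc x u v - fderiv ℝ b.mc x v u = - b.br (b.mc x u) (b.mc x v) := by
  let K : E → E → ℝ → E := fun w x s => s • b.mc (s • x) w
  have hKs : ∀ w, ContDiff ℝ ∞ fun q : E × ℝ => K w q.1 q.2 := fun w =>
    contDiff_snd.smul ((b.contDiff_mc.comp (contDiff_snd.smul contDiff_fst)).clm_apply contDiff_const)
  have hKx : ∀ w s, Differentiable ℝ fun x => K w x s := fun w s =>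
    ((hKs w).comp (contDiff_id.prodMk contDiff_const)).differentiable (by simp)
  have hKd : ∀ w x s, HasDerivAt (K w x) (w - b.br x (K w x s)) s := fun w x s =>
    b.hasDerivAt_smul_mc x w s
  have hKm : ∀ w u s, HasDerivAt (fun s => fderiv ℝ (fun x => K w x s) x u)
      (-(b.br u (K w x s) + b.br x (fderiv ℝ (fun x => K w x s) x u))) s := by
    intro w u s
    have h1 := hasDerivAt_fderiv_of_contDiff ((hKs w).of_le (WithTop.coe_le_coe.mpr le_top))
      (hKd w) x u s
    have h2 : HasFDerivAt (fun x => w - b.br x (K w x s)) _ x :=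
      (b.br.hasFDerivAt.clm_apply (hKx w s x).hasFDerivAt).const_sub w
    rw [h2.fderiv] at h1
    convert h1 using 1
    simp [add_comm]
  -- Write K_w(s) = s · mc(s x) w. The defect z = ∂_u K_v - ∂_v K_u + [K_u, K_v] satisfies z' = -[x,
  -- z] and z(0) = 0, hence vanishes; s = 1 is the claim.
  have hz : ∀ s : ℝ, fderiv ℝ (fun x => K v x s) x u - fderiv ℝ (fun x => K u x s) x v
      + b.br (K u x s) (K v x s) = 0 := by
    intro s
    refine b.eq_zero_of_triangular isOpen_univ ordConnected_univ (t₀ := 0)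
      (f := fun s => fderiv ℝ (fun x => K v x s) x u - fderiv ℝ (fun x => K u x s) x v
        + b.br (K u x s) (K v x s))
      (f' := fun s => - b.br x (fderiv ℝ (fun x => K v x s) x u - fderiv ℝ (fun x => K u x s) x v
        + b.br (K u x s) (K v x s))) (fun s _ => ?_) (fun i s _ h => neg_mem (b.br_mem _ _ _ h))
      (mem_univ _) ?_ (mem_univ s)
    · have h1 := (b.br.hasFDerivAt.comp_hasDerivAt s (hKd u x s)).clm_apply (hKd v x s)
      simp only [Function.comp_apply] at h1
      convert! ((hKm v u s).sub (hKm u v s)).add h1 using 1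
      simp only [map_add, map_sub, sub_apply]
      rw [b.jacobi x, b.br_swap v (K u x s)]
      abel
    · simp [K]
  have h1 := hz 1
  have h2 : ∀ w, (fun x => K w x 1) = fun x => b.mc x w := fun w => by
    funext x; simp only [K, one_smul]
  have h3 : ∀ w u, fderiv ℝ (fun x => b.mc x w) x u = fderiv ℝ b.mc x u w := fun w u => by
    have h4 : HasFDerivAt (fun x => b.mc x w) _ x :=
      ((b.contDiff_mc.differentiable (by simp) x).hasFDerivAt).clm_apply (hasFDerivAt_const w x)
    rw [h4.fderiv]
    simp
  rw [h2, h2, h3, h3] at h1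
  simp only [K, one_smul] at h1
  exact eq_neg_of_add_eq_zero_left h1

/-! ### The group law -/

/-- The Picard iterates stay polynomial in time with coefficients smooth in the initial data. So the
flow exists for all times and is jointly smooth. -/
lemma exists_flow : ∃ Z : E × E → ℝ → E, IsPolyFamily Z ∧
    ∀ p, Z p 0 = p.1 ∧ ∀ t, HasDerivAt (Z p) (b.mcInv (Z p t) p.2) t := by
  refine b.exists_solution IsPolyFamily Prod.fst (fun p _ => p.2) ⟨_, .const contDiff_fst⟩
    fun Z hZ => ?_
  obtain ⟨g, hg, h⟩ := ((b.isPolyFamily_adPoly hZ (mcInvPoly b.len)).bilin (.const contDiff_snd)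
    (ContinuousLinearMap.id ℝ (E →L[ℝ] E))).exists_primitive
  refine ⟨_, .add _ _ (.const contDiff_fst) hg, fun p => ⟨?_, fun t => ?_⟩⟩
  · rw [(h p).1, add_zero]
  · exact ((h p).2 t).const_add p.1

/-- The flow of the left-invariant vector fields `z ↦ mcInv z y`. -/
def flow (x y : E) (t : ℝ) : E := b.exists_flow.choose (x, y) t

lemma contDiff_flow : ContDiff ℝ ∞ fun q : (E × E) × ℝ => b.flow q.1.1 q.1.2 q.2 :=
  b.exists_flow.choose_spec.1.contDiff

lemma flow_zero (x y : E) : b.flow x y 0 = x := (b.exists_flow.choose_spec.2 (x, y)).1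

lemma hasDerivAt_flow (x y : E) (t : ℝ) :
    HasDerivAt (b.flow x y) (b.mcInv (b.flow x y t) y) t :=
  (b.exists_flow.choose_spec.2 (x, y)).2 t

lemma flow_eq {x y : E} {Z : ℝ → E} (hZ : ∀ t, HasDerivAt Z (b.mcInv (Z t) y) t) (h₀ : Z 0 = x)
    (t : ℝ) : b.flow x y t = Z t :=
  b.eqOn_of_hasDerivAt_mcInv (Y := fun _ => y) isOpen_univ ordConnected_univ
    (fun t _ => b.hasDerivAt_flow x y t) (fun t _ => hZ t) (mem_univ 0)
    (by rw [flow_zero, h₀]) (mem_univ t)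

/-- The Campbell-Hausdorff product. -/
def bch (x y : E) : E := b.flow x y 1

lemma contDiff_bch : ContDiff ℝ ∞ fun q : E × E => b.bch q.1 q.2 :=
  b.contDiff_flow.comp (contDiff_id.prodMk contDiff_const)

lemma bch_smul (x y : E) (t : ℝ) : b.bch x (t • y) = b.flow x y t := by
  have h1 := b.flow_eq (x := x) (y := t • y) (Z := fun s => b.flow x y (t * s)) (fun s => ?_)
    (by rw [mul_zero, flow_zero]) 1
  · rw [bch, h1, mul_one]
  · have h2 : HasDerivAt (fun s : ℝ => t * s) t s := by simpa using (hasDerivAt_id s).const_mul t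
    rw [map_smul]
    exact (b.hasDerivAt_flow x y (t * s)).scomp s h2

lemma zero_bch (y : E) : b.bch 0 y = y := by
  have h1 := b.flow_eq (x := 0) (y := y) (Z := fun s => s • y) (fun s => ?_) (zero_smul _ _) 1
  · rw [bch, h1, one_smul]
  · rw [b.mcInv_smul_self]
    simpa using (hasDerivAt_id s).smul_const y

lemma bch_zero (x : E) : b.bch x 0 = x := by
  rw [← zero_smul ℝ (0 : E), bch_smul, flow_zero]

lemma bch_neg (x : E) : b.bch x (-x) = 0 := by
  have h1 := b.flow_eq (x := x) (y := -x) (Z := fun s => (1 - s) • x) (fun s => ?_) (by simp) 1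
  · rw [bch, h1, sub_self, zero_smul]
  · rw [map_neg, b.mcInv_smul_self]
    simpa using ((hasDerivAt_id s).const_sub 1).smul_const x

lemma neg_bch (x : E) : b.bch (-x) x = 0 := by
  simpa using b.bch_neg (-x)

/-- Left translations preserve the Maurer-Cartan form. -/
theorem mc_fderiv_bch (x y w : E) :
    b.mc (b.bch x y) (fderiv ℝ (b.bch x) y w) = b.mc y w := by
  let f : E → ℝ → E := fun y t => b.flow x y t
  have hf : ContDiff ℝ ∞ fun q : E × ℝ => f q.1 q.2 :=
    b.contDiff_flow.comp ((contDiff_const.prodMk contDiff_fst).prodMk contDiff_snd)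
  have hfy : ∀ t, Differentiable ℝ fun y => f y t := fun t =>
    (hf.comp (contDiff_id.prodMk contDiff_const)).differentiable (by simp)
  have hmc : ∀ z, HasFDerivAt b.mc (fderiv ℝ b.mc z) z := fun z =>
    (b.contDiff_mc.differentiable (by simp) z).hasFDerivAt
  have hmcInv : ∀ z, HasFDerivAt b.mcInv (fderiv ℝ b.mcInv z) z := fun z =>
    (b.contDiff_mcInv.differentiable (by simp) z).hasFDerivAt
  have hmix := fun t => hasDerivAt_fderiv_of_contDiff (hf.of_le (WithTop.coe_le_coe.mpr le_top))
    (fun y t => b.hasDerivAt_flow x y t) y w t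
  have hkey : ∀ t, fderiv ℝ b.mc (f y t) (fderiv ℝ (fun y => f y t) y w) (b.mcInv (f y t) y)
      + b.mc (f y t) (fderiv ℝ (fun y => b.mcInv (b.flow x y t) y) y w) = w := by
    intro t
    have h1 : DifferentiableAt ℝ (fun y => b.mcInv (b.flow x y t) y) y :=
      ((hmcInv (f y t)).comp y (hfy t y).hasFDerivAt).differentiableAt.clm_apply
        differentiableAt_id
    have h2 : HasFDerivAt (fun y => b.mc (f y t) (b.mcInv (b.flow x y t) y)) _ y :=
      HasFDerivAt.clm_apply ((hmc (f y t)).comp y (hfy t y).hasFDerivAt) h1.hasFDerivAt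
    have h3 : (fun y => b.mc (f y t) (b.mcInv (b.flow x y t) y)) = fun y => y :=
      funext fun y => b.mc_mcInv _ _
    rw [h3] at h2
    have h4 := DFunLike.congr_fun (h2.unique (hasFDerivAt_id y)) w
    simp only [add_apply, ContinuousLinearMap.comp_apply, ContinuousLinearMap.flip_apply,
      ContinuousLinearMap.id_apply] at h4
    rw [add_comm] at h4
    exact h4
  -- This function of t satisfies X' = w - [y, X], the equation solved by t · mc(t y) w. Both start
  -- at 0, and at time 1 their equality is the claim.
  have hE : ∀ t, HasDerivAt (fun t => b.mc (f y t) (fderiv ℝ (fun y => f y t) y w))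
      (w - b.br y (b.mc (f y t) (fderiv ℝ (fun y => f y t) y w))) t := by
    intro t
    have h1 := ((hmc (f y t)).comp_hasDerivAt t (b.hasDerivAt_flow x y t)).clm_apply (hmix t)
    convert! h1 using 1
    have h2 := b.fderiv_mc_sub (f y t) (b.mcInv (f y t) y) (fderiv ℝ (fun y => f y t) y w)
    rw [b.mc_mcInv] at h2
    have aux : ∀ {A B C W D : E}, A - C = -D → C + B = W → W - D = A + B := by
      rintro A B C _ D h rfl
      rw [sub_eq_add_neg, ← h]
      abel
    exact aux h2 (hkey t)
  have h0 : ∀ t, b.mc (f y t) (fderiv ℝ (fun y => f y t) y w) - t • b.mc (t • y) w = 0 := by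
    intro t
    refine b.eq_zero_of_triangular isOpen_univ ordConnected_univ (t₀ := 0)
      (fun t _ => (hE t).sub (b.hasDerivAt_smul_mc y w t)) (fun i t _ h => ?_) (mem_univ _) ?_
      (mem_univ t)
    · rw [sub_sub_sub_cancel_left, ← map_sub, ← neg_sub, map_neg]
      exact neg_mem (b.br_mem _ _ _ h)
    · have h5 : (fun y => f y 0) = fun _ => x := funext fun y => b.flow_zero x y
      simp only [Pi.sub_apply]
      rw [h5]
      simp
  have h6 := h0 1
  rw [one_smul, one_smul] at h6
  exact sub_eq_zero.mp h6

lemma differentiable_bch (x : E) : Differentiable ℝ (b.bch x) :=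
  (b.contDiff_bch.comp (contDiff_const.prodMk contDiff_id)).differentiable (by simp)

/-- Left translates of solutions of `Z' = mcInv Z Y` are solutions. -/
lemma hasDerivAt_bch {Z : ℝ → E} {Y : E} {t : ℝ} (x : E) (hZ : HasDerivAt Z (b.mcInv (Z t) Y) t) :
    HasDerivAt (fun t => b.bch x (Z t)) (b.mcInv (b.bch x (Z t)) Y) t := by
  have h1 := (b.differentiable_bch x (Z t)).hasFDerivAt.comp_hasDerivAt t hZ
  have h2 := b.mc_fderiv_bch x (Z t) (b.mcInv (Z t) Y)
  rw [b.mc_mcInv] at h2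
  have h3 := congrArg (b.mcInv (b.bch x (Z t))) h2
  rw [b.mcInv_mc] at h3
  rwa [h3] at h1

/-- Left translates of flow lines are flow lines, so both sides are the flow line of z through bch x
y at time 1. -/
lemma bch_assoc (x y z : E) : b.bch (b.bch x y) z = b.bch x (b.bch y z) :=
  b.flow_eq (Z := fun t => b.bch x (b.flow y z t))
    (fun t => b.hasDerivAt_bch x (b.hasDerivAt_flow y z t)) (by rw [flow_zero]) 1

lemma map_bch {f : E →L[ℝ] E} (hf : ∀ x y, f (b.br x y) = b.br (f x) (f y)) (x y : E) :
    f (b.bch x y) = b.bch (f x) (f y) := by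
  refine (b.flow_eq (x := f x) (y := f y) (Z := fun t => f (b.flow x y t)) (fun t => ?_)
    (by rw [flow_zero]) 1).symm
  rw [mcInv, ← b.adPoly_map hf]
  exact f.hasFDerivAt.comp_hasDerivAt t (b.hasDerivAt_flow x y t)

end NilpotentBracket

/-! ### The nilpotent Lie group in exponential coordinates. -/

namespace NilpotentBracket

variable {E : Type*} [NormedAddCommGroup E] [NormedSpace ℝ E] (b : NilpotentBracket E)

lemma br_pow_apply_sub_mem (z : E) (n : ℕ) {k : ℕ} {y : E} (hy : y ∈ b.fil k) (hn : n ≠ 0) :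
    (b.br z ^ n) y ∈ b.fil (k + 1) :=
  b.fil_antitone (by omega) (b.br_pow_mem z n hy)

lemma mcInv_apply_sub_mem (z : E) {k : ℕ} {y : E} (hy : y ∈ b.fil k) :
    b.mcInv z y - y ∈ b.fil (k + 1) := by
  have h1 : ∀ q : Polynomial ℝ, b.adPoly q z y - q.coeff 0 • y ∈ b.fil (k + 1) := by
    intro q
    induction q using Polynomial.induction_on' with
    | add p q hp hq =>
      rw [adPoly_add, Polynomial.coeff_add, add_smul, add_apply, add_sub_add_comm]
      exact add_mem hp hq
    | monomial n a =>
      rw [adPoly_monomial, Polynomial.coeff_monomial]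
      rcases eq_or_ne n 0 with rfl | hn
      · simp
      · rw [if_neg hn, zero_smul, sub_zero]
        exact Submodule.smul_mem _ _ (b.br_pow_apply_sub_mem z n hy hn)
  have h2 := h1 (mcInvPoly b.len)
  have h3 : (mcInvPoly b.len).coeff 0 • y = y := by
    rw [← b.adPoly_smul_self (mcInvPoly b.len) 0 y]
    exact b.mcInv_smul_self 0 y
  rwa [h3] at h2

/-- The simply connected nilpotent Lie group with Lie algebra `b`, in exponential coordinates. -/
def Grp (_ : NilpotentBracket E) : Type _ := E

instance : TopologicalSpace b.Grp := inferInstanceAs (TopologicalSpace E)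

instance : ChartedSpace E b.Grp := inferInstanceAs (ChartedSpace E E)

lemma extChartAt_grp (x : b.Grp) : extChartAt 𝓘(ℝ, E) x = PartialEquiv.refl E := by
  exact extChartAt_model_space_eq_id ℝ (show E from x)

variable [FiniteDimensional ℝ E]

/-- To leading order in the filtration the product is addition. The commutator estimate, and with it
the nilpotency of the group, rests on this. -/
lemma bch_sub_mem {x y : E} {j : ℕ} (hy : y ∈ b.fil j) : b.bch x y - x - y ∈ b.fil (j + 1) := by
  have h1 := mem_submodule_of_hasDerivAt (S := b.fil (j + 1)) (f := fun t => b.flow x y t - x - t • y)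
    (f' := fun t => b.mcInv (b.flow x y t) y - y) isOpen_univ ordConnected_univ
    (fun t _ => ((b.hasDerivAt_flow x y t).sub_const x).sub
      (by simpa using (hasDerivAt_id t).smul_const y))
    (fun t _ => b.mcInv_apply_sub_mem _ hy) (mem_univ 0) (by simp [b.flow_zero]) (mem_univ 1)
  simpa [bch] using h1

lemma eq_neg_of_bch_eq_zero {x y : E} (h : b.bch x y = 0) : y = -x := by
  have h1 := b.bch_assoc (-x) x y
  rwa [neg_bch, zero_bch, h, bch_zero] at h1

/-- Inversion exchanges the factors, which transfers estimates for the right factor to the left one.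
-/
lemma neg_bch_eq (x y : E) : -b.bch x y = b.bch (-y) (-x) := by
  symm
  apply b.eq_neg_of_bch_eq_zero
  rw [b.bch_assoc, ← b.bch_assoc y, bch_neg, zero_bch, bch_neg]

lemma bch_sub_mem' {x y : E} {j : ℕ} (hx : x ∈ b.fil j) : b.bch x y - x - y ∈ b.fil (j + 1) := by
  have h1 := neg_mem (b.bch_sub_mem (x := -y) (neg_mem hx))
  rw [← neg_bch_eq] at h1
  convert h1 using 1
  abel

lemma bch_mem {x y : E} {j : ℕ} (hx : x ∈ b.fil j) (hy : y ∈ b.fil j) : b.bch x y ∈ b.fil j := by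
  have h1 := add_mem (add_mem (b.fil_succ_le _ (b.bch_sub_mem (x := x) hy)) hx) hy
  convert h1 using 1
  abel

lemma bch_left_sub_mem {x x' : E} (y : E) {j : ℕ} (h : x - x' ∈ b.fil j) :
    b.bch x y - b.bch x' y ∈ b.fil j := by
  have h1 : ∀ i ≤ j, ∀ t, b.flow x y t - b.flow x' y t ∈ b.fil i := by
    intro i
    induction i with
    | zero => exact fun _ t => b.mem_fil_zero _
    | succ i ih =>
      intro hi t
      refine mem_submodule_of_hasDerivAt (f := fun t => b.flow x y t - b.flow x' y t) isOpen_univ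
        ordConnected_univ (fun t _ => (b.hasDerivAt_flow x y t).sub (b.hasDerivAt_flow x' y t))
        (fun t _ => b.adPoly_sub_mem _ (ih (by omega) t) y) (mem_univ 0) ?_ (mem_univ t)
      rw [b.flow_zero, b.flow_zero]
      exact b.fil_antitone hi h
  exact h1 j le_rfl 1

lemma bch_commutator_mem {x : E} (g : E) {j : ℕ} (hx : x ∈ b.fil j) :
    b.bch (b.bch (b.bch x g) (-x)) (-g) ∈ b.fil (j + 1) := by
  have h1 : b.bch (b.bch x g) (-x) - g ∈ b.fil (j + 1) := by
    have h2 := add_mem (b.bch_sub_mem (x := b.bch x g) (neg_mem hx)) (b.bch_sub_mem' (y := g) hx)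
    convert h2 using 1
    abel
  have h3 := b.bch_left_sub_mem (-g) h1
  rwa [bch_neg, sub_zero] at h3

instance : Group b.Grp where
  mul := b.bch
  one := (0 : E)
  inv := fun x : E => (-x : E)
  mul_assoc := b.bch_assoc
  one_mul := b.zero_bch
  mul_one := b.bch_zero
  inv_mul_cancel := b.neg_bch

instance : IsManifold 𝓘(ℝ, E) ∞ b.Grp := inferInstanceAs (IsManifold 𝓘(ℝ, E) ∞ E)

instance : LieGroup 𝓘(ℝ, E) ∞ b.Grp where
  contMDiff_mul := by
    have h1 : ContMDiff (𝓘(ℝ, E).prod 𝓘(ℝ, E)) 𝓘(ℝ, E) ∞ fun p : E × E => b.bch p.1 p.2 :=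
      b.contDiff_bch.contMDiff.comp (contMDiff_fst.prodMk_space contMDiff_snd)
    exact h1
  contMDiff_inv := by
    have h1 : ContMDiff 𝓘(ℝ, E) 𝓘(ℝ, E) ∞ fun x : E => -x := contDiff_neg.contMDiff
    exact h1

instance : LieGroup 𝓘(ℝ, E) (minSmoothness ℝ 3) b.Grp := by
  rw [minSmoothness_of_isRCLikeNormedField]
  exact LieGroup.of_le (n := ∞) (WithTop.coe_le_coe.mpr le_top)

instance : ConnectedSpace b.Grp := inferInstanceAs (ConnectedSpace E)

instance : Group.IsNilpotent b.Grp := by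
  rw [Subgroup.nilpotent_iff_finite_descending_central_series]
  let H : ℕ → Subgroup b.Grp := fun j =>
    { carrier := {x | (show E from x) ∈ b.fil j}
      mul_mem' := fun hx hy => b.bch_mem hx hy
      one_mem' := zero_mem (b.fil j)
      inv_mem' := fun hx => neg_mem (S := Submodule ℝ E) hx }
  refine ⟨b.len, H, ⟨?_, fun x j hx g => b.bch_commutator_mem g hx⟩, ?_⟩
  · exact eq_top_iff.mpr fun x _ => b.mem_fil_zero x
  · exact eq_bot_iff.mpr fun x hx => Subgroup.mem_bot.mpr (b.eq_zero_of_mem_fil hx)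

/-- The chart is the identity and y⁻¹ z is bch (-y) z; by left invariance its derivative at z = y is
`b.mc y`, since `b.mc 0 = 1`. -/
lemma mcForm_grp (x₀ : b.Grp) (y : E) : mcForm x₀ y = b.mc y := by
  have hy : y ∈ (extChartAt 𝓘(ℝ, E) x₀).target := by rw [extChartAt_grp]; trivial
  rw [mcForm_eq_fderiv hy]
  have h1 : (fun z => leftQuotient x₀ (y, z)) = b.bch (-y) := by
    funext z
    rw [leftQuotient, extChartAt_grp, extChartAt_grp]
    rfl
  rw [h1]
  ext w
  have h2 := b.mc_fderiv_bch (-y) y w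
  rwa [neg_bch, mc_zero] at h2

lemma fderiv_mc_zero_sub (u w : E) : fderiv ℝ b.mc 0 u w - fderiv ℝ b.mc 0 w u = -b.br u w := by
  have h1 := b.fderiv_mc_sub 0 u w
  rwa [mc_zero] at h1

/-- The Maurer-Cartan form determines the bracket through the Maurer-Cartan equation, and that
equation holds for both brackets with the same form. -/
lemma groupBracket_grp (u w : E) : groupBracket b.Grp u w = b.br u w := by
  have h1 := fderiv_mcForm_sub (1 : b.Grp) u w
  have h2 : extChartAt 𝓘(ℝ, E) (1 : b.Grp) (1 : b.Grp) = (0 : E) := by rw [extChartAt_grp]; rfl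
  rw [funext fun y => b.mcForm_grp 1 y, h2, b.fderiv_mc_zero_sub, b.mc_zero] at h1
  exact (neg_injective h1).symm

end NilpotentBracket

/-! ### Uniqueness of solutions and one-parameter groups of operators. -/

section OrdinaryDifferentialEquations

variable {E : Type*} [NormedAddCommGroup E] [NormedSpace ℝ E]

/-- By local uniqueness the two curves agree near every point where they are equal; the points where
they differ also form an open set, and J is connected. -/
lemma eqOn_of_hasDerivAt_autonomous {F : E → E} (hF : ContDiff ℝ 1 F) {J : Set ℝ} (hJ : IsOpen J)
    (hJc : J.OrdConnected) {f g : ℝ → E} (hf : ∀ t ∈ J, HasDerivAt f (F (f t)) t)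
    (hg : ∀ t ∈ J, HasDerivAt g (F (g t)) t) {t₀ : ℝ} (ht₀ : t₀ ∈ J) (h₀ : f t₀ = g t₀) :
    EqOn f g J := by
  have hloc : ∀ t ∈ J, f t = g t → f =ᶠ[𝓝 t] g := by
    intro t ht h
    obtain ⟨K, s, hs, hK⟩ := (hF.contDiffAt (x := f t)).exists_lipschitzOnWith
    refine ODE_solution_unique_of_eventually (v := fun _ => F) (s := fun _ => s) (K := K)
      (Eventually.of_forall fun _ => hK) ?_ ?_ h
    · filter_upwards [hJ.mem_nhds ht, (hf t ht).continuousAt.eventually_mem hs] with τ h1 h2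
        using ⟨hf τ h1, h2⟩
    · rw [h] at hs
      filter_upwards [hJ.mem_nhds ht, (hg t ht).continuousAt.eventually_mem hs] with τ h1 h2
        using ⟨hg τ h1, h2⟩
  have hc : ContinuousOn (fun t => f t - g t) J := fun t ht =>
    ((hf t ht).continuousAt.sub (hg t ht).continuousAt).continuousWithinAt
  have h1 : J ⊆ interior {t | f t = g t} := by
    refine IsPreconnected.subset_left_of_subset_union isOpen_interior
      (hc.isOpen_inter_preimage hJ isOpen_compl_singleton (t := {0}ᶜ)) ?_ ?_ ⟨t₀, ht₀, ?_⟩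
      hJc.isPreconnected
    · rw [Set.disjoint_left]
      rintro t h1 ⟨-, h2⟩
      exact h2 (sub_eq_zero.mpr (interior_subset h1 : t ∈ {t | f t = g t}))
    · intro t ht
      by_cases h : f t = g t
      · exact Or.inl (mem_interior_iff_mem_nhds.mpr (hloc t ht h))
      · exact Or.inr ⟨ht, fun h' => h (sub_eq_zero.mp h')⟩
    · exact mem_interior_iff_mem_nhds.mpr (hloc t₀ ht₀ h₀)
  exact fun t ht => (interior_subset (h1 ht) : t ∈ {t | f t = g t})

lemma exists_oneParameterGroup [CompleteSpace E] (A : E →L[ℝ] E) :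
    ∃ R : ℝ → E →L[ℝ] E, R 0 = 1 ∧ (∀ s t, R (s + t) = R s * R t) ∧
      (∀ s, HasDerivAt R (A * R s) s) ∧ (∀ s, HasDerivAt R (R s * A) s) ∧ ContDiff ℝ ∞ R := by
  let _ : NormedAlgebra ℚ (E →L[ℝ] E) := NormedAlgebra.restrictScalars ℚ ℝ (E →L[ℝ] E)
  have h1 : ∀ s, HasDerivAt (fun s : ℝ => NormedSpace.exp (s • A))
      (A * NormedSpace.exp (s • A)) s := fun s => hasDerivAt_exp_smul_const' A s
  refine ⟨fun s => NormedSpace.exp (s • A), ?_, fun s t => ?_, h1,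
    fun s => hasDerivAt_exp_smul_const A s, ?_⟩
  · simp only [zero_smul, NormedSpace.exp_zero]
  · simp only [add_smul]
    exact NormedSpace.exp_add_of_commute (((Commute.refl A).smul_right t).smul_left s)
  · refine contDiff_infty.mpr fun m => contDiffOn_univ.mp ?_
    exact contDiffOn_of_hasDerivAt_autonomous (f := fun X => A * X) (U := univ) isOpen_univ
      (contDiff_const.mul contDiff_id).contDiffOn (fun _ _ => mem_univ _) (fun s _ => h1 s) m

lemma exists_primitive_of_contDiff [CompleteSpace E] {f : ℝ → E} (hf : ContDiff ℝ ∞ f) (x : E) :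
    ∃ g : ℝ → E, ContDiff ℝ ∞ g ∧ g 0 = x ∧ ∀ t, HasDerivAt g (f t) t := by
  have h1 : ∀ t, HasDerivAt (fun t => x + ∫ s in (0 : ℝ)..t, f s) (f t) t := fun t =>
    (hf.continuous.integral_hasStrictDerivAt 0 t).hasDerivAt.const_add x
  refine ⟨_, ?_, by simp, h1⟩
  rw [contDiff_infty_iff_deriv, funext fun t => (h1 t).deriv]
  exact ⟨fun t => (h1 t).differentiableAt, hf⟩

end OrdinaryDifferentialEquations

/-! ### Exponentials of skew derivations and one-parameter subgroups. -/

namespace NilpotentBracket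

variable {E : Type*} [NormedAddCommGroup E] [NormedSpace ℝ E] (b : NilpotentBracket E)

/-- The function s ↦ R(-s) [R(s) x, R(s) y] has derivative zero. -/
lemma map_br_of_derivation {A : E →L[ℝ] E} (hA : ∀ x y, A (b.br x y) = b.br (A x) y + b.br x (A y))
    {R : ℝ → E →L[ℝ] E} (h0 : R 0 = 1) (hadd : ∀ s t, R (s + t) = R s * R t)
    (hR : ∀ s, HasDerivAt R (A * R s) s) (hR' : ∀ s, HasDerivAt R (R s * A) s) (s : ℝ) (x y : E) :
    R s (b.br x y) = b.br (R s x) (R s y) := by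
  have hinv : ∀ s z, R s (R (-s) z) = z := fun s z => by
    rw [← mul_apply_eq_comp, ← hadd, add_neg_cancel, h0]; rfl
  have hx : ∀ x s, HasDerivAt (fun s => R s x) (A (R s x)) s := fun x s => by
    simpa using (hR s).clm_apply (hasDerivAt_const s x)
  have h1 : ∀ s, HasDerivAt (fun s => R (-s) (b.br (R s x) (R s y))) 0 s := by
    intro s
    have h2 : HasDerivAt (fun s => R (-s)) (-(R (-s) * A)) s := by
      have h := (hR' (-s)).scomp s (hasDerivAt_neg s)
      rwa [neg_one_smul] at h
    have h3 := h2.clm_apply ((b.br.hasFDerivAt.comp_hasDerivAt s (hx x s)).clm_apply (hx y s))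
    convert! h3 using 1
    simp only [neg_apply, mul_apply_eq_comp, Function.comp_apply, hA, map_add]
    abel
  have h2 := is_const_of_deriv_eq_zero (fun s => (h1 s).differentiableAt) (fun s => (h1 s).deriv) s 0
  simp only [neg_zero, h0, one_apply_eq_self] at h2
  rw [← h2, hinv]

lemma map_mcInv {f : E →L[ℝ] E} (hf : ∀ x y, f (b.br x y) = b.br (f x) (f y)) (x y : E) :
    f (b.mcInv x y) = b.mcInv (f x) (f y) :=
  b.adPoly_map hf _ x y

end NilpotentBracket

lemma form_map_of_skew {E : Type*} [NormedAddCommGroup E] [NormedSpace ℝ E] {B : E →L[ℝ] E →L[ℝ] ℝ}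
    {A : E →L[ℝ] E} (hA : ∀ x y, B (A x) y + B x (A y) = 0) {R : ℝ → E →L[ℝ] E} (h0 : R 0 = 1)
    (hR : ∀ s, HasDerivAt R (A * R s) s) (s : ℝ) (x y : E) : B (R s x) (R s y) = B x y := by
  have hx : ∀ x s, HasDerivAt (fun s => R s x) (A (R s x)) s := fun x s => by
    simpa using (hR s).clm_apply (hasDerivAt_const s x)
  have h1 : ∀ s, HasDerivAt (fun s => B (R s x) (R s y)) 0 s := by
    intro s
    have h3 := (B.hasFDerivAt.comp_hasDerivAt s (hx x s)).clm_apply (hx y s)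
    convert! h3 using 1
    exact (hA _ _).symm
  have h2 := is_const_of_deriv_eq_zero (fun s => (h1 s).differentiableAt) (fun s => (h1 s).deriv) s 0
  simpa [h0] using h2

namespace NilpotentBracket

variable {E : Type*} [NormedAddCommGroup E] [NormedSpace ℝ E] [FiniteDimensional ℝ E]
  (b : NilpotentBracket E)

lemma exists_solution_of_contDiff {Y : ℝ → E} (hY : ContDiff ℝ ∞ Y) :
    ∃ Z : ℝ → E, ContDiff ℝ ∞ Z ∧ Z 0 = 0 ∧ ∀ t, HasDerivAt Z (b.mcInv (Z t) (Y t)) t := by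
  have : CompleteSpace E := FiniteDimensional.complete ℝ E
  obtain ⟨Z, hZ, h⟩ := b.exists_solution (P := Unit) (fun Z => ContDiff ℝ ∞ (Z ())) (fun _ => 0)
    (fun _ => Y) ⟨fun _ _ => 0, contDiff_const⟩ fun Z hZ => by
      obtain ⟨g, hg, h0, h⟩ := exists_primitive_of_contDiff
        ((b.contDiff_mcInv.comp hZ).clm_apply hY) (0 : E)
      exact ⟨fun _ => g, hg, fun _ => ⟨h0, h⟩⟩
  exact ⟨Z (), hZ, h ()⟩

/-- The translational part of a one-parameter subgroup of the semidirect product. -/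
lemma exists_cocycle {R : ℝ → E →L[ℝ] E} (hadd : ∀ s t, R (s + t) = R s * R t)
    (hR : ContDiff ℝ ∞ R) (hbr : ∀ s x y, R s (b.br x y) = b.br (R s x) (R s y)) (T : E) :
    ∃ Z : ℝ → E, ContDiff ℝ ∞ Z ∧ Z 0 = 0 ∧ (∀ t, HasDerivAt Z (b.mcInv (Z t) (R t T)) t) ∧
      ∀ s t, Z (s + t) = b.bch (Z s) (R s (Z t)) := by
  obtain ⟨Z, hZ, hZ0, hZd⟩ := b.exists_solution_of_contDiff (hR.clm_apply (contDiff_const (c := T)))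
  refine ⟨Z, hZ, hZ0, hZd, fun s t => ?_⟩
  refine b.eqOn_of_hasDerivAt_mcInv (f := fun t => Z (s + t)) (g := fun t => b.bch (Z s) (R s (Z t)))
    (Y := fun t => R (s + t) T) isOpen_univ ordConnected_univ (fun t _ => ?_) (fun t _ => ?_)
    (mem_univ 0) ?_ (mem_univ t)
  · have h := (hZd (s + t)).scomp t ((hasDerivAt_id t).const_add s)
    rwa [one_smul] at h
  · refine b.hasDerivAt_bch (Z s) ?_
    have h1 := (R s).hasFDerivAt.comp_hasDerivAt t (hZd t)
    rw [b.map_mcInv (hbr s), ← mul_apply_eq_comp (R s), ← hadd] at h1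
    exact h1
  · simp only [add_zero, hZ0, map_zero, bch_zero]

end NilpotentBracket

section SemidirectAction

variable {N : Type*} [Group N] {H : Subgroup (MulAut N)}

lemma semidirectAct_mul (g h : N ⋊[H.subtype] H) (x : N) :
    semidirectAct (g * h) x = semidirectAct g (semidirectAct h x) := by
  simp [semidirectAct, mul_assoc]

lemma semidirectAct_one (x : N) : semidirectAct (1 : N ⋊[H.subtype] H) x = x := by
  simp [semidirectAct]

end SemidirectAction

/-! ### Geodesics of the integrated group are orbits. -/

namespace NilpotentBracket

variable {m : ℕ} (b : NilpotentBracket (Euc m))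
  (B : LinearMap.BilinForm ℝ (GroupLieAlgebra 𝓘(ℝ, Euc m) b.Grp))

/-- The exponential map, which is the identity. -/
abbrev exp (x : Euc m) : b.Grp := x

/-- The logarithm, which is the identity. -/
abbrev log (x : b.Grp) : Euc m := x

/-- The automorphism of the group given by an automorphism of the Lie algebra. -/
def mulAutOfEquiv (f : Euc m ≃L[ℝ] Euc m) (hf : ∀ x y, f (b.br x y) = b.br (f x) (f y)) :
    MulAut b.Grp where
  toFun := f
  invFun := f.symm
  left_inv := f.left_inv
  right_inv := f.right_inv
  map_mul' := b.map_bch (f := (f : Euc m →L[ℝ] Euc m)) hf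

/-- The group of isometric automorphisms. -/
def isometryGroup : Subgroup (MulAut b.Grp) where
  carrier := {a | ∃ f : Euc m ≃L[ℝ] Euc m, (∀ x : Euc m, a x = f x) ∧
    ∀ u v, formCLM B (f u) (f v) = formCLM B u v}
  mul_mem' := by
    rintro a a' ⟨f, hf, hfB⟩ ⟨f', hf', hfB'⟩
    refine ⟨f'.trans f, fun x => ?_, fun u v => (hfB _ _).trans (hfB' u v)⟩
    exact (congrArg a (hf' x)).trans (hf (f' x))
  one_mem' := ⟨ContinuousLinearEquiv.refl ℝ _, fun x => rfl, fun u v => rfl⟩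
  inv_mem' := by
    rintro a ⟨f, hf, hfB⟩
    refine ⟨f.symm, fun x => ?_, fun u v => ?_⟩
    · exact (MulEquiv.symm_apply_eq a).mpr ((hf _).trans (f.apply_symm_apply x)).symm
    · rw [← hfB, f.apply_symm_apply, f.apply_symm_apply]

lemma derivAtOne_of_linear {a : b.Grp → b.Grp} {f : Euc m →L[ℝ] Euc m} (h : ∀ x : Euc m, a x = f x) :
    derivAtOne (Euc m) a = f := by
  have h1 : ∀ x : Euc m, (mfderiv 𝓘(ℝ, Euc m) 𝓘(ℝ, Euc m) (f : Euc m → Euc m) x : Euc m →L[ℝ] Euc m)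
      = f := fun x => by
    rw [mfderiv_eq_fderiv, f.fderiv]
  have h2 : a = fun x => f x := funext h
  rw [h2]
  exact h1 0

lemma contMDiff_grp_iff {a : b.Grp → b.Grp} :
    ContMDiff 𝓘(ℝ, Euc m) 𝓘(ℝ, Euc m) ∞ a ↔ ContDiff ℝ ∞ (fun x : Euc m => b.log (a (b.exp x))) :=
  contMDiff_iff_contDiff

lemma bodyVelocity_grp {γ : ℝ → b.Grp} {γ' : Euc m} {t : ℝ}
    (h : HasDerivAt (F := Euc m) γ γ' t) :
    bodyVelocity (Euc m) γ t = b.mc (b.log (γ t)) γ' := by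
  have h1 := bodyVelocity_eq (E := Euc m) (x₀ := (1 : b.Grp)) (γ := γ) (c := (γ : ℝ → Euc m)) h
    (by rw [extChartAt_grp]; trivial) (Eventually.of_forall fun τ => by rw [extChartAt_grp]; rfl)
  exact h1.trans (DFunLike.congr_fun (b.mcForm_grp 1 (b.log (γ t))) γ')

/-- Geodesics of the group, in terms of their body velocity. -/
lemma IsGeodesicOn.hasDerivAt_grp {B : LinearMap.BilinForm ℝ (GroupLieAlgebra 𝓘(ℝ, Euc m) b.Grp)}
    (hs : B.IsSymm) {γ : ℝ → b.Grp} {J : Set ℝ} (hJ : IsOpen J)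
    (h : IsGeodesicOn (leftInvMetric B) γ J) {t : ℝ} (ht : t ∈ J) :
    HasDerivAt (F := Euc m) γ (b.mcInv (b.log (γ t)) (bodyVelocity (Euc m) γ t)) t ∧
    DifferentiableAt ℝ (bodyVelocity (Euc m) γ) t ∧
      ∀ w, formCLM B (deriv (bodyVelocity (Euc m) γ) t) w =
        formCLM B (bodyVelocity (Euc m) γ t) (b.br (bodyVelocity (Euc m) γ t) w) := by
  obtain ⟨h1, h2⟩ := (isGeodesicOn_leftInvMetric_iff hs hJ).mp h
  obtain ⟨h3, h4⟩ := h2 t ht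
  refine ⟨?_, h3, fun w => ?_⟩
  · have h5 : ContDiffAt ℝ 2 (fun t => b.log (γ t)) t :=
      contMDiffAt_iff_contDiffAt.mp (h1.contMDiffAt (hJ.mem_nhds ht))
    have h6 := (h5.differentiableAt two_ne_zero).hasDerivAt
    rw [b.bodyVelocity_grp h6, b.mcInv_mc]
    exact h6
  · rw [h4, groupBracket_grp]

/-- The subgroup s ↦ (Z(s), R(s)) has orbit Z through the identity. Conjugating it by the
translation by x turns this into the orbit x · Z(s) through x. -/
lemma exists_oneParameterSubgroup {B : LinearMap.BilinForm ℝ (GroupLieAlgebra 𝓘(ℝ, Euc m) b.Grp)}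
    {A : Euc m →L[ℝ] Euc m} (hA : ∀ x y, A (b.br x y) = b.br (A x) y + b.br x (A y))
    (hskew : ∀ x y, formCLM B (A x) y + formCLM B x (A y) = 0) (T : Euc m) (x : b.Grp) :
    ∃ (R : ℝ → Euc m →L[ℝ] Euc m) (Z : ℝ → Euc m), R 0 = 1 ∧ (∀ s, HasDerivAt R (R s * A) s) ∧
      (∀ s u v, formCLM B (R s u) (R s v) = formCLM B u v) ∧
      (∀ s u v, R s (b.br u v) = b.br (R s u) (R s v)) ∧ (∀ s t, R (s + t) = R s * R t) ∧
      Z 0 = 0 ∧ (∀ t, HasDerivAt Z (b.mcInv (Z t) (R t T)) t) ∧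
      ∃ φ : Multiplicative ℝ →* b.Grp ⋊[(b.isometryGroup B).subtype] (b.isometryGroup B),
        IsOneParameterSubgroup m φ ∧ ∀ s, semidirectAct (φ (Multiplicative.ofAdd s)) x
          = b.bch (b.log x) (Z s) := by
  obtain ⟨R, hR0, hadd, hR, hR', hRs⟩ := exists_oneParameterGroup A
  have hbr := b.map_br_of_derivation hA hR0 hadd hR hR'
  have hiso := form_map_of_skew hskew hR0 hR
  obtain ⟨Z, hZs, hZ0, hZd, hZadd⟩ := b.exists_cocycle hadd hRs hbr T
  have hinv : ∀ s, R (-s) * R s = 1 := fun s => by rw [← hadd, neg_add_cancel, hR0]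
  have hinv' : ∀ s, R s * R (-s) = 1 := fun s => by rw [← hadd, add_neg_cancel, hR0]
  let f : ℝ → Euc m ≃L[ℝ] Euc m := fun s => ContinuousLinearEquiv.equivOfInverse (R s) (R (-s))
    (fun x => DFunLike.congr_fun (hinv s) x) (fun x => DFunLike.congr_fun (hinv' s) x)
  let a : ℝ → b.isometryGroup B := fun s =>
    ⟨b.mulAutOfEquiv (f s) (hbr s), f s, fun _ => rfl, hiso s⟩
  have ha : ∀ s (y : Euc m), (a s : MulAut b.Grp) y = R s y := fun s y => rfl
  let ψ : Multiplicative ℝ →* b.Grp ⋊[(b.isometryGroup B).subtype] (b.isometryGroup B) :=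
    { toFun := fun s => ⟨Z (Multiplicative.toAdd s), a (Multiplicative.toAdd s)⟩
      map_one' := by
        refine SemidirectProduct.ext hZ0 (Subtype.ext (MulEquiv.ext fun y => ?_))
        exact DFunLike.congr_fun hR0 y
      map_mul' := by
        intro s t
        refine SemidirectProduct.ext (hZadd _ _) (Subtype.ext (MulEquiv.ext fun y => ?_))
        exact DFunLike.congr_fun (hadd _ _) y }
  let g : b.Grp ⋊[(b.isometryGroup B).subtype] (b.isometryGroup B) := ⟨x, 1⟩
  let φ := (MulAut.conj g).toMonoidHom.comp ψ
  have hφ : ∀ s (p : b.Grp), semidirectAct (φ (Multiplicative.ofAdd s)) p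
      = x * (b.exp (Z s) * (a s : MulAut b.Grp) (x⁻¹ * p)) := by
    intro s p
    change semidirectAct (g * ψ (Multiplicative.ofAdd s) * g⁻¹) p = _
    rw [semidirectAct_mul, semidirectAct_mul]
    simp [semidirectAct, g, ψ]
  refine ⟨R, Z, hR0, hR', hiso, hbr, hadd, hZ0, hZd, φ, ?_, fun s => ?_⟩
  · rw [IsOneParameterSubgroup]
    simp only [hφ]
    have h1 : ContDiff ℝ ∞ fun q : ℝ × Euc m =>
        b.bch (b.log x) (b.bch (Z q.1) (R q.1 (b.bch (-(b.log x)) q.2))) := by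
      refine b.contDiff_bch.comp (contDiff_const.prodMk ?_)
      refine b.contDiff_bch.comp ((hZs.comp contDiff_fst).prodMk ?_)
      refine (hRs.comp contDiff_fst).clm_apply ?_
      exact b.contDiff_bch.comp (contDiff_const.prodMk contDiff_snd)
    have h2 : ContMDiff (𝓘(ℝ, ℝ).prod 𝓘(ℝ, Euc m)) 𝓘(ℝ, Euc m) ∞ fun q : ℝ × Euc m =>
        b.bch (b.log x) (b.bch (Z q.1) (R q.1 (b.bch (-(b.log x)) q.2))) :=
      h1.contMDiff.comp (contMDiff_fst.prodMk_space contMDiff_snd)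
    exact h2
  · rw [hφ, inv_mul_cancel, map_one, mul_one]
    rfl

/-- Since k = 0, Euler's equation with initial value T is solved by R(s) T with R(s) = exp(s A),
because R preserves bracket and form. A geodesic therefore has the body velocity of the orbit x ·
Z(t - t₀); both curves solve the same first-order equation with the same value at t₀, and only a
shift of the parameter is needed. -/
theorem isGONilmanifold_grp (hs : B.IsSymm) (hnd : B.Nondegenerate)
    (hGO : ∀ T : Euc m, ∃ A : Euc m →L[ℝ] Euc m,
      (∀ x y, A (b.br x y) = b.br (A x) y + b.br x (A y)) ∧
      (∀ x y, formCLM B (A x) y + formCLM B x (A y) = 0) ∧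
      ∀ w, formCLM B T (b.br T w) = formCLM B (A T) w) :
    IsGONilmanifold B (b.isometryGroup B) where
  connected := inferInstance
  nilpotent := inferInstance
  symm := hs
  nondegenerate := hnd
  smooth := by
    rintro a ⟨f, hf, -⟩
    rw [contMDiff_grp_iff, show (a : b.Grp → b.Grp) = f from funext hf]
    exact f.contDiff
  isometric := by
    rintro a ⟨f, hf, hfB⟩ u v
    have h1 := b.derivAtOne_of_linear (f := (f : Euc m →L[ℝ] Euc m)) hf
    have h2 : ∀ u, derivAtOne (Euc m) (a : b.Grp → b.Grp) u = f u := fun u =>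
      DFunLike.congr_fun h1 u
    exact (congrArg₂ (fun p q => formCLM B p q) (h2 u) (h2 v)).trans (hfB u v)
  geodesicOrbit := by
    intro J γ hJ hJc hγ
    rcases J.eq_empty_or_nonempty with rfl | ⟨t₀, ht₀⟩
    · refine ⟨1, ?_, 1, fun _ => 0, contDiff_const.contDiffOn, fun t ht => ht.elim⟩
      rw [IsOneParameterSubgroup]
      simp only [MonoidHom.one_apply, semidirectAct_one]
      exact contMDiff_snd
    obtain ⟨A, hA, hskew, hT⟩ := hGO (bodyVelocity (Euc m) γ t₀)
    set T := bodyVelocity (Euc m) γ t₀ with hTdef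
    obtain ⟨R, Z, hR0, hR', hiso, hbr, hadd, hZ0, hZd, φ, hφ, hφx⟩ :=
      b.exists_oneParameterSubgroup hA hskew T (γ t₀)
    refine ⟨φ, hφ, γ t₀, fun t => t - t₀, (contDiff_id.sub contDiff_const).contDiffOn,
      fun t ht => ?_⟩
    rw [hφx]
    have hgeo := fun t (ht : t ∈ J) => IsGeodesicOn.hasDerivAt_grp b hs hJ hγ ht
    obtain ⟨F, hF, hFB⟩ := exists_geodesicField hnd
    have hinj : ∀ u v : Euc m, (∀ w, formCLM B u w = formCLM B v w) → u = v := by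
      intro u v h
      have h1 : ∀ w, formCLM B (u - v) w = 0 := fun w => by
        rw [map_sub, sub_apply, h, sub_self]
      exact sub_eq_zero.mp (hnd.1 (u - v) h1)
    have hVd : ∀ t ∈ J, HasDerivAt (bodyVelocity (Euc m) γ) (F (bodyVelocity (Euc m) γ t)) t := by
      intro t ht
      obtain ⟨-, h2, h3⟩ := hgeo t ht
      have h4 : F (bodyVelocity (Euc m) γ t) = deriv (bodyVelocity (Euc m) γ) t :=
        hinj _ _ fun w => by rw [h3, hFB, groupBracket_grp]
      rw [h4]
      exact h2.hasDerivAt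
    have hsub : ∀ {G : Type} [NormedAddCommGroup G] [NormedSpace ℝ G] {X : ℝ → G} {X' : G} {t : ℝ},
        HasDerivAt X X' (t - t₀) → HasDerivAt (fun t => X (t - t₀)) X' t := by
      intro G _ _ X X' t h
      have h1 := h.scomp t ((hasDerivAt_id t).sub_const t₀)
      rwa [one_smul] at h1
    have hRd : ∀ t, HasDerivAt (fun t => R (t - t₀) T) (F (R (t - t₀) T)) t := by
      intro t
      have h1 := (hsub (hR' (t - t₀))).clm_apply (hasDerivAt_const t T)
      rw [map_zero, add_zero] at h1
      have h4 : F (R (t - t₀) T) = R (t - t₀) (A T) := by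
        refine hinj _ _ fun w => ?_
        obtain ⟨w, rfl⟩ : ∃ w', R (t - t₀) w' = w := ⟨R (-(t - t₀)) w, by
          rw [← mul_apply_eq_comp, ← hadd, add_neg_cancel, hR0]; rfl⟩
        rw [hFB, groupBracket_grp, ← hbr, hiso, hiso, hT]
      rw [h4]
      exact h1
    have hV : EqOn (bodyVelocity (Euc m) γ) (fun t => R (t - t₀) T) J :=
      eqOn_of_hasDerivAt_autonomous (hF.of_le (WithTop.coe_le_coe.mpr le_top)) hJ hJc hVd
        (fun t _ => hRd t) ht₀ (by simp [hR0, hTdef])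
    refine b.eqOn_of_hasDerivAt_mcInv (f := (γ : ℝ → Euc m))
      (g := fun t => b.bch (b.log (γ t₀)) (Z (t - t₀)))
      (Y := fun t => R (t - t₀) T) hJ hJc (fun t ht => ?_) (fun t _ => ?_) ht₀ ?_ ht
    · have h1 := (hgeo t ht).1
      rw [hV ht] at h1
      exact h1
    · exact b.hasDerivAt_bch _ (hsub (hZd (t - t₀)))
    · simp only [sub_self, hZ0]
      exact (b.bch_zero _).symm

end NilpotentBracket

/-! ### Realising a metric Lie algebra by a geodesic orbit nilmanifold. -/

section LieAlgebraToGroup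

variable {L : Type*} [LieRing L] [LieAlgebra ℝ L] {m : ℕ}

/-- The bracket of a nilpotent Lie algebra in coordinates. -/
def nilpotentBracketOfEquiv (Φ : L ≃ₗ[ℝ] Euc m) {c : ℕ}
    (hc : LieModule.lowerCentralSeries ℝ L L c = ⊥) : NilpotentBracket (Euc m) where
  br := IsBilinearMap.toContinuousBilinearMap (f := fun x y => Φ ⁅Φ.symm x, Φ.symm y⁆)
    { add_left := fun x y z => by rw [map_add, add_lie, map_add]
      smul_left := fun c x y => by rw [map_smul, smul_lie, map_smul]
      add_right := fun x y z => by rw [map_add, lie_add, map_add]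
      smul_right := fun c x y => by rw [map_smul, lie_smul, map_smul] }
  br_self x := by
    change Φ ⁅Φ.symm x, Φ.symm x⁆ = 0
    rw [lie_self, map_zero]
  jacobi x y z := by
    change Φ ⁅Φ.symm x, Φ.symm (Φ ⁅Φ.symm y, Φ.symm z⁆)⁆
      = Φ ⁅Φ.symm (Φ ⁅Φ.symm x, Φ.symm y⁆), Φ.symm z⁆
        + Φ ⁅Φ.symm y, Φ.symm (Φ ⁅Φ.symm x, Φ.symm z⁆)⁆
    simp only [LinearEquiv.symm_apply_apply]
    rw [← map_add, ← leibniz_lie]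
  fil k := (LieModule.lowerCentralSeries ℝ L L k).toSubmodule.map (Φ : L →ₗ[ℝ] Euc m)
  fil_zero := by simp
  fil_succ_le k := Submodule.map_mono (LieModule.antitone_lowerCentralSeries ℝ L L (Nat.le_succ k))
  br_mem := by
    rintro k x _ ⟨y, hy, rfl⟩
    refine ⟨⁅Φ.symm x, y⁆, lie_mem_lowerCentralSeries_succ _ hy, ?_⟩
    change Φ ⁅Φ.symm x, y⁆ = Φ ⁅Φ.symm x, Φ.symm (Φ y)⁆
    rw [LinearEquiv.symm_apply_apply]
  len := c
  fil_len := by simp [hc]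

lemma nilpotentBracketOfEquiv_br (Φ : L ≃ₗ[ℝ] Euc m) {c : ℕ}
    (hc : LieModule.lowerCentralSeries ℝ L L c = ⊥) (x y : L) :
    (nilpotentBracketOfEquiv Φ hc).br (Φ x) (Φ y) = Φ ⁅x, y⁆ := by
  change Φ ⁅Φ.symm (Φ x), Φ.symm (Φ y)⁆ = _
  rw [LinearEquiv.symm_apply_apply, LinearEquiv.symm_apply_apply]

/-- A nilpotent metric Lie algebra satisfying the infinitesimal geodesic orbit condition is the
metric Lie algebra of a geodesic orbit nilmanifold. -/
theorem exists_isGONilmanifold [FiniteDimensional ℝ L] [LieRing.IsNilpotent L]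
    {B : LinearMap.BilinForm ℝ L} (hs : B.IsSymm) (hnd : B.Nondegenerate)
    (hGO : ∀ T, ∃ D : L →ₗ[ℝ] L, IsSkewDerivation B D ∧ ∀ w, B T ⁅T, w⁆ = B (D T) w) :
    ∃ (m : ℕ) (N₀ : Type) (_ : Group N₀) (_ : TopologicalSpace N₀)
      (_ : ChartedSpace (EuclideanSpace ℝ (Fin m)) N₀)
      (_ : LieGroup 𝓘(ℝ, EuclideanSpace ℝ (Fin m)) ∞ N₀)
      (H₀ : Subgroup (MulAut N₀))
      (B₀ : LinearMap.BilinForm ℝ (GroupLieAlgebra 𝓘(ℝ, EuclideanSpace ℝ (Fin m)) N₀))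
      (Ψ : L →ₗ⁅ℝ⁆ GroupLieAlgebra 𝓘(ℝ, EuclideanSpace ℝ (Fin m)) N₀),
      IsGONilmanifold B₀ H₀ ∧ Function.Bijective Ψ ∧ ∀ x y, B₀ (Ψ x) (Ψ y) = B x y := by
  obtain ⟨c, hc⟩ := (LieModule.isNilpotent_iff ℝ L L).mp inferInstance
  obtain ⟨m, hm⟩ : ∃ m, m = Module.finrank ℝ L := ⟨_, rfl⟩
  let Φ : L ≃ₗ[ℝ] Euc m := LinearEquiv.ofFinrankEq _ _ (by rw [finrank_euclideanSpace_fin, hm])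
  let b := nilpotentBracketOfEquiv Φ hc
  have hbr : ∀ x y, b.br (Φ x) (Φ y) = Φ ⁅x, y⁆ := nilpotentBracketOfEquiv_br Φ hc
  let B₀ : LinearMap.BilinForm ℝ (Euc m) :=
    B.compl₁₂ (Φ.symm : Euc m →ₗ[ℝ] L) (Φ.symm : Euc m →ₗ[ℝ] L)
  have hB₀ : ∀ x y, B₀ (Φ x) (Φ y) = B x y := fun x y => by simp [B₀]
  have hB₀s : B₀.IsSymm := ⟨fun x y => hs.eq (Φ.symm x) (Φ.symm y)⟩
  have hB₀sep : ∀ x, (∀ y, B₀ x y = 0) → x = 0 := fun x hx => by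
    obtain ⟨x, rfl⟩ := Φ.surjective x
    rw [hnd.1 x fun y => by rw [← hB₀, hx], map_zero]
  have hB₀nd : B₀.Nondegenerate :=
    ⟨hB₀sep, fun x hx => hB₀sep x fun y => by rw [hB₀s.eq]; exact hx y⟩
  let Ψ : L →ₗ⁅ℝ⁆ GroupLieAlgebra 𝓘(ℝ, Euc m) b.Grp :=
    { toFun := Φ
      map_add' := fun x y => Φ.map_add x y
      map_smul' := fun c x => Φ.map_smul c x
      map_lie' := fun {x y} => (hbr x y).symm.trans (b.groupBracket_grp (Φ x) (Φ y)).symm }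
  refine ⟨m, b.Grp, inferInstance, inferInstance, inferInstance, inferInstance,
    b.isometryGroup B₀, B₀, Ψ, b.isGONilmanifold_grp B₀ hB₀s hB₀nd fun T => ?_, Φ.bijective, hB₀⟩
  obtain ⟨T, rfl⟩ := Φ.surjective T
  obtain ⟨D, hD, hT⟩ := hGO T
  let A : Euc m →L[ℝ] Euc m := LinearMap.toContinuousLinearMap
    ((Φ : L →ₗ[ℝ] Euc m) ∘ₗ D ∘ₗ (Φ.symm : Euc m →ₗ[ℝ] L))
  have hA : ∀ x, A (Φ x) = Φ (D x) := fun x => by simp [A]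
  have hform : ∀ x y, formCLM (N := b.Grp) B₀ (Φ x) (Φ y) = B x y := hB₀
  refine ⟨A, fun x y => ?_, fun x y => ?_, fun w => ?_⟩
  · obtain ⟨x, rfl⟩ := Φ.surjective x
    obtain ⟨y, rfl⟩ := Φ.surjective y
    rw [hbr, hA, hA, hA, hbr, hbr, ← map_add, hD.leibniz]
  · obtain ⟨x, rfl⟩ := Φ.surjective x
    obtain ⟨y, rfl⟩ := Φ.surjective y
    rw [hA, hA, hform, hform]
    exact hD.skew x y
  · obtain ⟨w, rfl⟩ := Φ.surjective w
    rw [hbr, hA, hform, hform]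
    exact hT w

end LieAlgebraToGroup

/-! ### Reduction and conclusion. -/

/-- Reduction of a geodesic orbit nilmanifold by an isotropic invariant ideal. -/
theorem IsGONilmanifold.exists_isDoubleExtension {n : ℕ} {N : Type*} [Group N] [TopologicalSpace N]
    [ChartedSpace (Euc n) N] [LieGroup 𝓘(ℝ, Euc n) ∞ N] {H : Subgroup (MulAut N)}
    {B : LinearMap.BilinForm ℝ (GroupLieAlgebra 𝓘(ℝ, Euc n) N)} (hGO : IsGONilmanifold B H)
    {p q : ℕ} (hsig : HasSignature B p q)
    {e : Submodule ℝ (GroupLieAlgebra 𝓘(ℝ, Euc n) N)} (hq : q ≤ Module.finrank ℝ e + 1)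
    (hed : e ≤ derivedSubspace (GroupLieAlgebra 𝓘(ℝ, Euc n) N))
    (heo : e ≤ B.orthogonal (derivedSubspace (GroupLieAlgebra 𝓘(ℝ, Euc n) N)))
    (hlie : ∀ x ∈ e, ∀ y ∈ B.orthogonal e, ⁅x, y⁆ = 0)
    (hinv : ∀ D, IsSkewDerivation B D → ∀ x ∈ e, D x ∈ e) :
    ∃ (m : ℕ) (N₀ : Type) (_ : Group N₀) (_ : TopologicalSpace N₀)
      (_ : ChartedSpace (EuclideanSpace ℝ (Fin m)) N₀)
      (_ : LieGroup 𝓘(ℝ, EuclideanSpace ℝ (Fin m)) ∞ N₀)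
      (H₀ : Subgroup (MulAut N₀))
      (B₀ : LinearMap.BilinForm ℝ (GroupLieAlgebra 𝓘(ℝ, EuclideanSpace ℝ (Fin m)) N₀)),
      IsGONilmanifold B₀ H₀ ∧
        HasSignature B₀ (p - Module.finrank ℝ e) (q - Module.finrank ℝ e) ∧
        p - Module.finrank ℝ e + (q - Module.finrank ℝ e) = m ∧
        IsDoubleExtension (isotropyAlgebra n H) B (2 * Module.finrank ℝ e) B₀ := by
  let L := GroupLieAlgebra 𝓘(ℝ, Euc n) N
  have : Group.IsNilpotent N := hGO.nilpotent
  have : LieRing.IsNilpotent L := isNilpotent_groupLieAlgebra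
  have : FiniteDimensional ℝ L := inferInstanceAs (FiniteDimensional ℝ (Euc n))
  have hs := hGO.symm
  have hnd := hGO.nondegenerate
  -- eᗮ is an ideal because e is orthogonal to the derived algebra, so that eᗮ contains all
  -- brackets.
  let m₁ : LieIdeal ℝ L :=
    { B.orthogonal e with
      lie_mem := by
        intro x y _ z hz
        change B z ⁅x, y⁆ = 0
        rw [hs.eq]
        exact heo hz _ (lie_mem_derivedSubspace x y) }
  have hm₁ : m₁.toSubmodule = B.orthogonal e := rfl
  have hdm : derivedSubspace L ≤ m₁.toSubmodule := fun x hx z hz => by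
    change B z x = 0
    rw [hs.eq]
    exact heo hz x hx
  have hem : e ≤ m₁.toSubmodule := hed.trans hdm
  have horth : ∀ x ∈ e, ∀ y ∈ m₁, B x y = 0 := fun x hx y hy => hy x hx
  have hm₁inv : ∀ D, IsSkewDerivation B D → ∀ x ∈ m₁, D x ∈ m₁ := fun D hD x hx =>
    hD.mem_orthogonal (hinv D hD) hx
  obtain ⟨I, hI, hIf, π, hπ, hker⟩ := exists_quotient_lieAlgebra (m := m₁) (e := e) hlie
  obtain ⟨B₁, hB₁⟩ := exists_quotient_form hs hπ hker horth
  have hGO₁ : IsAlgebraicGO B₁ :=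
    (isAlgebraicGO_of_isGONilmanifold hGO).quotient hm₁inv hinv hπ hker hB₁
  have hsig₁ := hsig.quotient (π := (π : m₁ →ₗ[ℝ] m₁ ⧸ I)) hm₁ hem hπ hker hB₁
  -- By `hq` the quotient form has index at most one, which is what makes k = 0 available.
  obtain ⟨m, N₀, i₁, i₂, i₃, i₄, H₀, B₀, Ψ, h₀, hΨ, hB₀⟩ :=
    exists_isGONilmanifold hsig₁.isSymm hsig₁.nondegenerate
      (hGO₁.exists_skewDerivation hsig₁.isSymm hsig₁.nondegenerate fun W hW =>
        (hsig₁.finrank_le_of_nonpos W hW).trans (tsub_le_iff_left.mpr hq))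
  let π₀ : m₁ →ₗ⁅ℝ⁆ GroupLieAlgebra 𝓘(ℝ, Euc m) N₀ := Ψ.comp π
  have hπ₀ : Function.Surjective π₀ := hΨ.2.comp hπ
  have hker₀ : ∀ x : m₁, π₀ x = 0 ↔ (x : L) ∈ e := fun x => by
    rw [← hker, LieHom.comp_apply, ← hΨ.1.eq_iff, map_zero]
  have hB₀' : ∀ x y : m₁, B₀ (π₀ x) (π₀ y) = B x y := fun x y => (hB₀ _ _).trans (hB₁ x y)
  have : FiniteDimensional ℝ (GroupLieAlgebra 𝓘(ℝ, Euc m) N₀) :=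
    inferInstanceAs (FiniteDimensional ℝ (Euc m))
  have hsig₀ := hsig.quotient (π := (π₀ : m₁ →ₗ[ℝ] GroupLieAlgebra 𝓘(ℝ, Euc m) N₀)) hm₁ hem hπ₀
    hker₀ hB₀'
  have hdim : Module.finrank ℝ m₁.toSubmodule + Module.finrank ℝ e = Module.finrank ℝ L := by
    rw [hm₁, LinearMap.BilinForm.finrank_orthogonal hnd]
    exact Nat.sub_add_cancel (Submodule.finrank_le e)
  refine ⟨m, N₀, i₁, i₂, i₃, i₄, H₀, B₀, h₀, hsig₀, ?_, m₁, e, π₀, hed, hdm, ?_, ?_, horth, hlie,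
    hdim, rfl, hπ₀, hker₀, hB₀'⟩
  · rw [hsig₀.add_eq_finrank]
    exact finrank_euclideanSpace_fin (𝕜 := ℝ)
  · exact fun A hA => hm₁inv A (isSkewDerivation_of_mem_isotropyAlgebra hGO hA)
  · exact fun A hA => hinv A (isSkewDerivation_of_mem_isotropyAlgebra hGO hA)

theorem theorem2 (n : ℕ) (N : Type*) [Group N] [TopologicalSpace N]
    [ChartedSpace (EuclideanSpace ℝ (Fin n)) N] [LieGroup 𝓘(ℝ, EuclideanSpace ℝ (Fin n)) ∞ N]
    (H : Subgroup (MulAut N))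
    (B : LinearMap.BilinForm ℝ (GroupLieAlgebra 𝓘(ℝ, EuclideanSpace ℝ (Fin n)) N))
    (hGO : IsGONilmanifold B H) (hsig : HasSignature B (n - 2) 2)
    (hdeg : ¬ (B.restrict
      (derivedSubspace (GroupLieAlgebra 𝓘(ℝ, EuclideanSpace ℝ (Fin n)) N))).Nondegenerate) :
    (∃ (m : ℕ) (N₀ : Type) (_ : Group N₀) (_ : TopologicalSpace N₀)
      (_ : ChartedSpace (EuclideanSpace ℝ (Fin m)) N₀)
      (_ : LieGroup 𝓘(ℝ, EuclideanSpace ℝ (Fin m)) ∞ N₀)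
      (H₀ : Subgroup (MulAut N₀))
      (B₀ : LinearMap.BilinForm ℝ (GroupLieAlgebra 𝓘(ℝ, EuclideanSpace ℝ (Fin m)) N₀)),
      IsGONilmanifold B₀ H₀ ∧ HasSignature B₀ (m - 1) 1 ∧
        IsDoubleExtension (isotropyAlgebra n H) B 2 B₀) ∨
    (∃ (m : ℕ) (N₀ : Type) (_ : Group N₀) (_ : TopologicalSpace N₀)
      (_ : ChartedSpace (EuclideanSpace ℝ (Fin m)) N₀)
      (_ : LieGroup 𝓘(ℝ, EuclideanSpace ℝ (Fin m)) ∞ N₀)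
      (H₀ : Subgroup (MulAut N₀))
      (B₀ : LinearMap.BilinForm ℝ (GroupLieAlgebra 𝓘(ℝ, EuclideanSpace ℝ (Fin m)) N₀)),
      IsGONilmanifold B₀ H₀ ∧ HasSignature B₀ m 0 ∧
        IsDoubleExtension (isotropyAlgebra n H) B 4 B₀) := by
  have : Group.IsNilpotent N := hGO.nilpotent
  have : LieRing.IsNilpotent (GroupLieAlgebra 𝓘(ℝ, EuclideanSpace ℝ (Fin n)) N) :=
    isNilpotent_groupLieAlgebra
  have : FiniteDimensional ℝ (GroupLieAlgebra 𝓘(ℝ, EuclideanSpace ℝ (Fin n)) N) :=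
    inferInstanceAs (FiniteDimensional ℝ (EuclideanSpace ℝ (Fin n)))
  obtain ⟨e, hed, heo, hlie, hinv, hdim⟩ := exists_isotropic_of_degenerate hGO.symm
    hGO.nondegenerate (isAlgebraicGO_of_isGONilmanifold hGO) hsig.finrank_le_of_nonpos hdeg
  have hq : 2 ≤ Module.finrank ℝ e + 1 := by rcases hdim with h | h <;> simp [h]
  obtain ⟨m, N₀, i₁, i₂, i₃, i₄, H₀, B₀, h₀, hsig₀, hm, hext⟩ :=
    hGO.exists_isDoubleExtension hsig hq hed heo hlie hinv
  -- An isotropic line leaves index one and an isotropic plane index zero.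
  rcases hdim with h | h
  · rw [h] at hsig₀ hm hext
    refine Or.inl ⟨m, N₀, i₁, i₂, i₃, i₄, H₀, B₀, h₀, ?_, hext⟩
    rwa [show m - 1 = n - 2 - 1 by omega]
  · rw [h] at hsig₀ hm hext
    refine Or.inr ⟨m, N₀, i₁, i₂, i₃, i₄, H₀, B₀, h₀, ?_, hext⟩
    rwa [show n - 2 - 2 = m by omega] at hsig₀
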